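/- Setting. Let $(\mathcal V,g)$ be a connected spherically symmetric spacetime covered by advanced Eddington–Finkelstein coordinates, $$ds^2=-e^{2\beta}\Big(1-\frac{2m}{r}\Big)dv^2+2e^{\beta}\,dv\,dr+r^2d\Omega^2,\qquad \beta=\beta(v,r),\quad m=m(v,r),$$ with the future given by increasing $v$. Explicitly, $\mathcal V$ is a connected rotation-invariant open subset of $\mathbb R\times\mathbb R^3\ni(t,x)$ with $r=|x|$, $v=t+r$, $r^2d\Omega^2=|dx|^2-dr^2$, and the metric is $C^1$ on $\mathcal V$ (including the points of the axis $r=0$, if $\mathcal V$ contains any: a regular centre). A *closed f-trapped surface* is a compact connected imbedded $C^3$ spacelike surface without boundary in $\mathcal V$ both of whose future null expansions are negative everywhere. Let $\mathscr T$ be the set of points lying on closed f-trapped surfaces, and put $$\mathscr Z=\{r>0,\ r\le 2m\},\qquad \mathscr R_0=\mathcal V\setminus\mathscr Z,\qquad AH=\{r>0,\ r=2m\},\qquad AH^{iso}=\{p\in AH:\ \partial m/\partial v=0\}$$ (on $AH$, $G_{\mu\nu}k^\mu k^\nu=2e^{\beta}r^{-2}\,\partial m/\partial v$ for the outgoing radial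 null vector $k$). Boundaries are taken in $\mathcal V$. Let $\mathscr T_1$ be a connected component of $\mathscr T$. Call a relatively closed set $Z_1\subset\mathcal V$ *removable for* $\mathscr T_1$ if every closed f-trapped surface contained in $\mathscr T_1$ meets $Z_1$, and every point of the closure of $\mathcal V\setminus Z_1$ in $\mathcal V$ can be joined to $\partial\mathscr T_1$ by a continuous curve (possibly of zero length) which, except possibly for its end points, lies in $\mathcal V\setminus Z_1$. A *core* of $\mathscr T_1$ is a connected removable set that contains no other connected removable set for $\mathscr T_1$. Theorem. Assume $AH^{iso}=\emptyset$. Then: 1. $\mathscr Z\subset\mathscr T$, $\partial\mathscr Z=AH$, and every closed f-trapped surface meets $\mathscr Z$. (Hence every component of $\mathscr Z$ lies in exactly one component of $\mathscr T$, and every component of $\mathscr T$ contains at least one component of $\mathscr Z$.) 2. Let $\mathscr T_1$ be a connected component of $\mathscr T$ that does not contain any whole connected component of $\mathscr R_0$. Then $\mathscr Z\cap\mathscr T_1$ is removable for $\mathscr T_1$, no other removable set (connected or not) is contained in it, and $\partial(\mathscr Z\cap\mathscr T_1)=AH\cap\mathscr T_1$. 3. Let $\mathscr T_1$ be as in 2.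 If $\mathscr Z\cap\mathscr T_1$ is a single connected component $\mathscr Z_1$ of $\mathscr Z$, then $\mathscr Z_1$ is a core of $\mathscr T_1$, and its boundary is $AH\cap\mathscr Z_1$. In particular, if this holds for every component of $\mathscr T$, then $\mathscr Z$ is the disjoint union of cores, one for each component of $\mathscr T$. 4. The condition on $\mathscr T_1$ in 2 holds for every component of $\mathscr T$ if the spacetime is imploding: it contains all round spheres $(v,r)$ with $v<0$, $r>0$ and $m=0$ there; with any round sphere $(v,r)$ it contains $(v',r)$ for all $v'\le v$; $m$ is bounded above; and $\partial m/\partial v\ge 0$ on $AH$. -/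

import Mathlib

namespace TrappedCore

open Set Topology

/-- Events `(t, x)`. The area radius is `r = ‖x‖` and the advanced null coordinate is `v = t + r`. -/
abbrev Event : Type := ℝ × EuclideanSpace ℝ (Fin 3)

/-- The area radius `r`. -/
noncomputable def radius (p : Event) : ℝ := ‖p.2‖

/-- The advanced null coordinate `v`, constant on the incoming radial null rays. -/
noncomputable def advTime (p : Event) : ℝ := p.1 + ‖p.2‖

/-- The one-form `dr` (set to be `0` on the axis `x = 0`, where `r` is not differentiable). -/
noncomputable def dr (p X : Event) : ℝ := inner ℝ p.2 X.2 / ‖p.2‖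

/-- The one-form `dv = dt + dr`. -/
noncomputable def dv (p X : Event) : ℝ := X.1 + dr p X

/-- The line element `-e^{2β} (1 - 2m/r) dv² + 2 e^β dv dr + r² dΩ²`, where `β` and `m` are functions
of `(v, r)` and `r² dΩ² = |dx|² - dr²`. On the axis the formula reads
`-e^{2β} dt² + |dx|²`, since there `dr = 0` and `2m/r = 0` in Lean. -/
noncomputable def efMetric (β m : ℝ → ℝ → ℝ) (p X Y : Event) : ℝ :=
  -Real.exp (2 * β (advTime p) (radius p))
      * (1 - 2 * m (advTime p) (radius p) / radius p) * dv p X * dv p Y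
    + Real.exp (β (advTime p) (radius p)) * (dv p X * dr p Y + dv p Y * dr p X)
    + (inner ℝ X.2 Y.2 - dr p X * dr p Y)

/-- A (connected) spherically symmetric spacetime in advanced Eddington-Finkelstein coordinates.
The axis `x = 0` may or may not meet the spacetime; where it does, the metric has to be
continuously differentiable across it (a regular centre; this forces `2m/r → 0` there). -/
structure SphSpacetime where
  /-- the set of events -/
  carrier : Set Event
  /-- the metric function `β(v, r)` -/
  β : ℝ → ℝ → ℝ
  /-- the mass function `m(v, r)` -/
  m : ℝ → ℝ → ℝ
  isOpen_carrier : IsOpen carrier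
  isConnected_carrier : IsConnected carrier
  rotation_mem : ∀ p ∈ carrier, ∀ x : EuclideanSpace ℝ (Fin 3), ‖x‖ = ‖p.2‖ → (p.1, x) ∈ carrier
  contDiffOn_metric : ∀ X Y : Event, ContDiffOn ℝ 1 (fun p => efMetric β m p X Y) carrier

namespace SphSpacetime

variable (M : SphSpacetime)

/-- The spacetime metric `g_p(X, Y)`. -/
noncomputable def g (p X Y : Event) : ℝ := efMetric M.β M.m p X Y

/-- `g(Z, ∇_X Y)` at `p` for `X`, `Y`, `Z` constant in the coordinates `(t, x)`: the Christoffel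
symbol of the first kind of the Levi-Civita connection. -/
noncomputable def christoffel (p X Y Z : Event) : ℝ :=
  (fderiv ℝ (fun q => M.g q Y Z) p X + fderiv ℝ (fun q => M.g q X Z) p Y
    - fderiv ℝ (fun q => M.g q X Y) p Z) / 2

/-- `k` is a future-directed null vector at `p`. The future is given by increasing `v`; among the
null vectors with `dv = 0` the future-directed ones are the positive multiples of `-∂_r`. -/
def IsFutureNull (p k : Event) : Prop :=
  M.g p k k = 0 ∧ (0 < dv p k ∨ (dv p k = 0 ∧ dr p k < 0))

end SphSpacetime

/-- The parameter space `(λ¹, λ²)` of a surface. -/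
abbrev Param : Type := EuclideanSpace ℝ (Fin 2)

/-- The coordinate tangent vector `e_A` of a parametrized surface. -/
noncomputable def tangent (φ : Param → Event) (u : Param) (A : Fin 2) : Event :=
  fderiv ℝ φ u (EuclideanSpace.single A 1)

/-- The second partial derivatives `∂_A ∂_B φ` of a parametrized surface. -/
noncomputable def secondDeriv (φ : Param → Event) (u : Param) (A B : Fin 2) : Event :=
  fderiv ℝ (fun w => tangent φ w B) u (EuclideanSpace.single A 1)

/-- `φ`, restricted to the open set `U`, is a `C³` imbedded parametrization of a (relatively) open
piece of the set `S`. -/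
def IsSurfaceChart (S : Set Event) (φ : Param → Event) (U : Set Param) : Prop :=
  IsOpen U ∧ ContDiffOn ℝ 3 φ U ∧ (∀ u ∈ U, Function.Injective (fderiv ℝ φ u)) ∧
    IsEmbedding (U.domRestrict φ) ∧ ∃ W : Set Event, IsOpen W ∧ φ '' U = S ∩ W

namespace SphSpacetime

variable (M : SphSpacetime)

/-- The first fundamental form `γ_AB`. -/
noncomputable def firstForm (φ : Param → Event) (u : Param) : Matrix (Fin 2) (Fin 2) ℝ :=
  Matrix.of fun A B => M.g (φ u) (tangent φ u A) (tangent φ u B)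

/-- The second fundamental form along a normal vector `k`: `K_AB = -g(k, ∇_{e_A} e_B)`. -/
noncomputable def secondForm (φ : Param → Event) (u : Param) (k : Event) (A B : Fin 2) : ℝ :=
  -(M.g (φ u) k (secondDeriv φ u A B)
    + M.christoffel (φ u) (tangent φ u A) (tangent φ u B) k)

/-- The expansion `θ = γ^{AB} K_AB` along a normal vector `k`. -/
noncomputable def expansion (φ : Param → Event) (u : Param) (k : Event) : ℝ :=
  ∑ A : Fin 2, ∑ B : Fin 2, (M.firstForm φ u)⁻¹ A B * M.secondForm φ u k A B

/-- The parametrized surface is spacelike at `φ u` and the expansions along both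
future-directed null normal directions are negative there. -/
def IsFTrappedAt (φ : Param → Event) (u : Param) : Prop :=
  (M.firstForm φ u).PosDef ∧
    ∀ k : Event, M.IsFutureNull (φ u) k → (∀ A : Fin 2, M.g (φ u) k (tangent φ u A) = 0) →
      M.expansion φ u k < 0

/-- `S` is a closed f-trapped surface: a compact connected `C³` imbedded spacelike surface without
boundary, both of whose future null expansions are negative everywhere. -/
def IsClosedFTrapped (S : Set Event) : Prop :=
  S ⊆ M.carrier ∧ IsCompact S ∧ IsConnected S ∧
    ∀ p ∈ S, ∃ (φ : Param → Event) (U : Set Param) (u : Param),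
      IsSurfaceChart S φ U ∧ u ∈ U ∧ φ u = p ∧ M.IsFTrappedAt φ u

/-- The future-trapped region `𝒯`. -/
def trapped : Set Event := {p | ∃ S, M.IsClosedFTrapped S ∧ p ∈ S}

/-- The region `𝒵 = {r ≤ 2m}`. The events of a regular centre `r = 0` do not belong to it. -/
def Z : Set Event :=
  {p | p ∈ M.carrier ∧ 0 < radius p ∧ radius p ≤ 2 * M.m (advTime p) (radius p)}

/-- The complement `ℛ₀` of `𝒵`. -/
def R₀ : Set Event := M.carrier \ M.Z

/-- The apparent 3-horizon `AH = {r = 2m}`. -/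
def AH : Set Event :=
  {p | p ∈ M.carrier ∧ 0 < radius p ∧ radius p = 2 * M.m (advTime p) (radius p)}

/-- The partial derivative `∂m/∂v`. -/
noncomputable def massFlux (v r : ℝ) : ℝ := deriv (fun w => M.m w r) v

/-- The isolated-horizon portion of `AH`, where `∂m/∂v = 0`; equivalently, where `G(k,k) = 0` for
the radial outgoing null vector `k`, as `G(k,k) = 2 e^β r⁻² ∂m/∂v` on `AH`. -/
def AHiso : Set Event := {p | p ∈ M.AH ∧ M.massFlux (advTime p) (radius p) = 0}

/-- The boundary, in the spacetime, of a set of events. -/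
def bdry (A : Set Event) : Set Event := frontier A ∩ M.carrier

/-- `x` can be joined to the boundary `∂T₁` by a curve that runs in the excised spacetime
`𝒱 \ Z₁`, except possibly for its end points (the curve may have zero length). -/
def JoinedToBdry (T₁ Z₁ : Set Event) (x : Event) : Prop :=
  x ∈ M.bdry T₁ ∨
    ∃ c : ℝ → Event, ContinuousOn c (Icc 0 1) ∧ c 0 = x ∧ c 1 ∈ M.bdry T₁ ∧
      ∀ s ∈ Ioo (0 : ℝ) 1, c s ∈ M.carrier \ Z₁

/-- `Z₁` is a closed subset of the spacetime whose removal gets rid of all closed f-trapped surfaces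
in `T₁`, and every point in the closure of the remainder `𝒱 \ Z₁` is joined to `∂T₁` through
the remainder. -/
def IsRemovable (T₁ Z₁ : Set Event) : Prop :=
  (∃ F : Set Event, IsClosed F ∧ Z₁ = F ∩ M.carrier) ∧
    (∀ S, M.IsClosedFTrapped S → S ⊆ T₁ → (S ∩ Z₁).Nonempty) ∧
    ∀ x ∈ closure (M.carrier \ Z₁) ∩ M.carrier, M.JoinedToBdry T₁ Z₁ x

/-- `Z₁` is a core of the connected component `T₁` of the trapped region: it is connected, has the
properties `IsRemovable`, and no other such set is contained in it. -/
def IsCore (T₁ Z₁ : Set Event) : Prop :=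
  IsConnected Z₁ ∧ M.IsRemovable T₁ Z₁ ∧
    ∀ Z' ⊆ Z₁, IsConnected Z' → M.IsRemovable T₁ Z' → Z' = Z₁

/-- `T₁` is a connected component of the trapped region. -/
def IsTrappedComponent (T₁ : Set Event) : Prop :=
  ∃ p ∈ M.trapped, T₁ = connectedComponentIn M.trapped p

/-- `Z₁` is a connected component of `𝒵`. -/
def IsZComponent (Z₁ : Set Event) : Prop :=
  ∃ p ∈ M.Z, Z₁ = connectedComponentIn M.Z p

/-- No connected component of `ℛ₀` is completely filled by `T₁`. -/
def LeavesRoom (T₁ : Set Event) : Prop :=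
  ∀ p ∈ M.R₀, ¬ connectedComponentIn M.R₀ p ⊆ T₁

/-- The pairs `(v, r)`, `r > 0`, of the round spheres of the spacetime. -/
def spheres : Set (ℝ × ℝ) :=
  {q | 0 < q.2 ∧ ∃ x : EuclideanSpace ℝ (Fin 3), ‖x‖ = q.2 ∧ (q.1 - q.2, x) ∈ M.carrier}

/-- An imploding spacetime: it contains all round spheres with `v < 0`, and there is no mass
there; the lines `r = const` extend to `v → -∞`; the mass function is bounded;
and `∂m/∂v ≥ 0` on `AH`. -/
structure IsImploding : Prop where
  empty_past : ∀ v r : ℝ, v < 0 → 0 < r → (v, r) ∈ M.spheres ∧ M.m v r = 0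
  extends_to_past : ∀ v v' r : ℝ, v' ≤ v → (v, r) ∈ M.spheres → (v', r) ∈ M.spheres
  bounded_mass : ∃ C : ℝ, ∀ v r : ℝ, (v, r) ∈ M.spheres → M.m v r ≤ C
  influx : ∀ p ∈ M.AH, 0 ≤ M.massFlux (advTime p) (radius p)

end SphSpacetime

end TrappedCore

namespace TrappedCore

open Set Topology Filter

-- Write `f = 1 - 2m/r`. In the `(v, r)` plane the outgoing radial null rays solve `dr/dv = e^β f /
-- 2`, and the sign of `f` decides whether the radius grows or shrinks along them. Two constructions
-- carry everything.
--
-- Barrier. Among the outgoing radial light cones `r = R(v)`, the lowest one lying above a closed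
-- f-trapped surface touches it (`exists_supporting_solution`). At a contact point `r - R(v)`,
-- restricted to the surface, has a maximum, so the cone's null normal is normal to the surface, and
-- the second derivative test bounds the expansion of the surface below by that of the round cone, a
-- positive multiple of `f`. Trapping forces `f < 0` there (`fval_neg_of_supported`). At a regular
-- centre contact is impossible, since a spacelike surface cannot stay inside the light cone of one
-- of its own points (`false_of_supported_axis`). Hence every closed f-trapped surface meets `𝒵`
-- (`exists_supporting_curve`).
--
-- Deformation. Start from a round sphere with `f = 0` and pass to the graph `r + ε H`, `v + ε y`,
-- with `H`, `y` functions of the cosine `c` of the angle to an axis. To first order in `ε` the sign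
-- of the outgoing expansion is that of `df(y, H) - ΔH / r`, with `Δ` the Laplacian of the unit
-- sphere, while the ingoing one stays negative (`exists_trapped_deformation`). Because `∂f/∂v ≠ 0`
-- on `AH`, `y` can be chosen to give `df(y, H)` any prescribed values, so every profile `H` can be
-- made trapped. The profile `H = 1 - c` sweeps out a whole neighbourhood of a horizon event
-- (`eventually_mem_trapped`). A profile with `ΔH = 1/(n+1) - ((1+c)/2)^n` yields trapped surfaces
-- on which `f > 0` except in a tiny cap around the axis (`exists_localized_surface`): `ΔH` must
-- have mean zero, but its negative part can be concentrated in the cap.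
--
-- The rest is topology. A component `T₁` of the trapped region is a neighbourhood of each point of
-- `𝒵 ∩ T₁`. A component of the excised spacetime must meet `T₁`, because the spacetime is
-- connected, and cannot lie inside `T₁`, because `T₁` contains no component of `ℛ₀`; so it reaches
-- `∂T₁`. For minimality, suppose a removable subset omits a point of `𝒵 ∩ T₁`. The curve from that
-- point to `∂T₁` leaves `𝒵 ∩ T₁` through an omitted horizon event, and a surface localized there
-- avoids the subset (`IsTrappedComponent.eq_of_isRemovable`).
--
-- In an imploding spacetime `f > 0` persists to the past along `r = const`, so each component of
-- `ℛ₀` contains the empty past. Far out there no event is trapped: a supporting light cone starting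
-- beyond `r = 2 sup m` never shrinks, hence cannot touch the surface in `𝒵`.

local notation "E3" => EuclideanSpace ℝ (Fin 3)

/-! ### Calculus of `r`, `v` and the angular form along curves. -/

/-- The area element `r² dΩ² = |dx|² - dr²` of the round spheres. -/
noncomputable def sig (p X Y : Event) : ℝ := inner ℝ X.2 Y.2 - dr p X * dr p Y

/-- The pair `(v, r)` of an event. -/
noncomputable def vr (p : Event) : ℝ × ℝ := (advTime p, radius p)

/-- The event with coordinates `(v, r)` in the direction `e`. -/
noncomputable def ray (e : EuclideanSpace ℝ (Fin 3)) (q : ℝ × ℝ) : Event := (q.1 - q.2, q.2 • e)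

lemma dr_add (p X Y : Event) : dr p (X + Y) = dr p X + dr p Y := by
  simp [dr, inner_add_right, add_div]

lemma dr_smul (p X : Event) (c : ℝ) : dr p (c • X) = c * dr p X := by
  simp [dr, inner_smul_right, mul_div_assoc]

lemma dv_add (p X Y : Event) : dv p (X + Y) = dv p X + dv p Y := by
  simp only [dv, dr_add, Prod.fst_add]; ring

lemma dv_smul (p X : Event) (c : ℝ) : dv p (c • X) = c * dv p X := by
  simp only [dv, dr_smul, Prod.smul_fst, smul_eq_mul]; ring

lemma dr_zero (p : Event) : dr p 0 = 0 := by simp [dr]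

lemma sig_comm (p X Y : Event) : sig p X Y = sig p Y X := by
  simp only [sig, real_inner_comm]; ring

lemma sig_add_right (p X Y Z : Event) : sig p X (Y + Z) = sig p X Y + sig p X Z := by
  simp only [sig, dr_add, Prod.snd_add, inner_add_right]; ring

lemma sig_smul_right (p X Y : Event) (c : ℝ) : sig p X (c • Y) = c * sig p X Y := by
  simp only [sig, dr_smul, Prod.smul_snd, inner_smul_right]; ring

lemma sig_add_left (p X Y Z : Event) : sig p (X + Y) Z = sig p X Z + sig p Y Z := by
  rw [sig_comm, sig_add_right, sig_comm p Z X, sig_comm p Z Y]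

lemma sig_smul_left (p X Y : Event) (c : ℝ) : sig p (c • X) Y = c * sig p X Y := by
  rw [sig_comm, sig_smul_right, sig_comm]

lemma hasDerivAt_fst {Y : ℝ → Event} {X : Event} {s : ℝ} (hY : HasDerivAt Y X s) :
    HasDerivAt (fun t => (Y t).1) X.1 s := by
  simpa using (HasFDerivAt.fst hY).hasDerivAt

lemma hasDerivAt_snd {Y : ℝ → Event} {X : Event} {s : ℝ} (hY : HasDerivAt Y X s) :
    HasDerivAt (fun t => (Y t).2) X.2 s := by
  simpa using (HasFDerivAt.snd hY).hasDerivAt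

lemma hasDerivAt_comp_of_eq {V : Type*} [NormedAddCommGroup V] [NormedSpace ℝ V] {F : V → ℝ}
    {F' : V →L[ℝ] ℝ} {Y : ℝ → V} {X p : V} {s : ℝ} (hp : Y s = p) (hF : HasFDerivAt F F' p)
    (hY : HasDerivAt Y X s) : HasDerivAt (fun t => F (Y t)) (F' X) s := by
  subst hp
  exact hF.comp_hasDerivAt s hY

lemma hasDerivAt_radius {Y : ℝ → Event} {X : Event} {s : ℝ} (hY : HasDerivAt Y X s)
    (h0 : (Y s).2 ≠ 0) : HasDerivAt (fun t => radius (Y t)) (dr (Y s) X) s := by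
  have h1 := hasDerivAt_snd hY
  have h2 := (h1.norm_sq).sqrt (by positivity)
  have h3 : (fun t => radius (Y t)) = fun t => √(‖(Y t).2‖ ^ 2) := by
    funext t; simp [radius]
  rw [h3]
  convert h2 using 1
  rw [Real.sqrt_sq (norm_nonneg _), dr]
  field_simp

lemma hasDerivAt_advTime {Y : ℝ → Event} {X : Event} {s : ℝ} (hY : HasDerivAt Y X s)
    (h0 : (Y s).2 ≠ 0) : HasDerivAt (fun t => advTime (Y t)) (dv (Y s) X) s :=
  (hasDerivAt_fst hY).add (hasDerivAt_radius hY h0)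

lemma hasDerivAt_vr {Y : ℝ → Event} {X : Event} {s : ℝ} (hY : HasDerivAt Y X s)
    (h0 : (Y s).2 ≠ 0) : HasDerivAt (fun t => vr (Y t)) (dv (Y s) X, dr (Y s) X) s :=
  (hasDerivAt_advTime hY h0).prodMk (hasDerivAt_radius hY h0)

/-- The extra term is the Hessian of `r = |x|` in flat space. Since `v - r = t` is linear, `v` has
the same Hessian, which later allows `r` and `v` to be treated alike. -/
lemma hasDerivAt_dr {Y Y' : ℝ → Event} {X X' : Event} {s : ℝ} (hY : HasDerivAt Y X s)
    (hY' : HasDerivAt Y' X' s) (h0 : (Y s).2 ≠ 0) :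
    HasDerivAt (fun t => dr (Y t) (Y' t))
      (dr (Y s) X' + sig (Y s) X (Y' s) / radius (Y s)) s := by
  have h1 : HasDerivAt (fun t => inner ℝ (Y t).2 (Y' t).2) _ s :=
    (hasDerivAt_snd hY).inner ℝ (hasDerivAt_snd hY')
  have h2 := h1.div (hasDerivAt_radius hY h0) (by simpa [radius] using h0)
  have hn : ‖(Y s).2‖ ≠ 0 := by simpa using h0
  refine h2.congr_deriv ?_
  simp only [dr, sig, radius]
  field_simp
  ring

lemma hasDerivAt_dv {Y Y' : ℝ → Event} {X X' : Event} {s : ℝ} (hY : HasDerivAt Y X s)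
    (hY' : HasDerivAt Y' X' s) (h0 : (Y s).2 ≠ 0) :
    HasDerivAt (fun t => dv (Y t) (Y' t))
      (dv (Y s) X' + sig (Y s) X (Y' s) / radius (Y s)) s := by
  refine ((hasDerivAt_fst hY').add (hasDerivAt_dr hY hY' h0)).congr_deriv ?_
  simp only [dv]; ring

lemma continuous_radius : Continuous radius := by unfold radius; fun_prop
lemma continuous_advTime : Continuous advTime := by unfold advTime; fun_prop
lemma continuous_vr : Continuous vr := continuous_advTime.prodMk continuous_radius
lemma continuous_ray (e : EuclideanSpace ℝ (Fin 3)) : Continuous (ray e) := by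
  unfold ray; fun_prop

lemma radius_ray {e : EuclideanSpace ℝ (Fin 3)} (he : ‖e‖ = 1) {q : ℝ × ℝ} (hq : 0 ≤ q.2) :
    radius (ray e q) = q.2 := by
  simp [radius, ray, norm_smul, he, abs_of_nonneg hq]

lemma advTime_ray {e : EuclideanSpace ℝ (Fin 3)} (he : ‖e‖ = 1) {q : ℝ × ℝ} (hq : 0 ≤ q.2) :
    advTime (ray e q) = q.1 := by
  simp [advTime, ray, norm_smul, he, abs_of_nonneg hq]

lemma vr_ray {e : EuclideanSpace ℝ (Fin 3)} (he : ‖e‖ = 1) {q : ℝ × ℝ} (hq : 0 ≤ q.2) :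
    vr (ray e q) = q := by
  rw [vr, radius_ray he hq, advTime_ray he hq]

lemma radius_pos {p : Event} : 0 < radius p ↔ p.2 ≠ 0 := by simp [radius]

lemma ray_vr {p : Event} (hp : p.2 ≠ 0) : ray (‖p.2‖⁻¹ • p.2) (vr p) = p := by
  have : ‖p.2‖ ≠ 0 := by simpa using hp
  ext1
  · simp [ray, vr, advTime, radius]
  · simp [ray, vr, advTime, radius, smul_smul, this]

lemma exists_unit : ∃ e : EuclideanSpace ℝ (Fin 3), ‖e‖ = 1 :=
  ⟨EuclideanSpace.single 0 1, by simp⟩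

/-! ### Coefficient functions of the metric and Christoffel symbols. -/

namespace SphSpacetime
variable (M : SphSpacetime)

/-- The coefficient `e^{2β} (1 - 2m/r)` of `-dv²`. -/
noncomputable def lapse (q : ℝ × ℝ) : ℝ :=
  Real.exp (2 * M.β q.1 q.2) * (1 - 2 * M.m q.1 q.2 / q.2)

/-- The coefficient `e^β`. -/
noncomputable def expβ (q : ℝ × ℝ) : ℝ := Real.exp (M.β q.1 q.2)

/-- The function `1 - 2m/r`. -/
noncomputable def fval (q : ℝ × ℝ) : ℝ := 1 - 2 * M.m q.1 q.2 / q.2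

lemma expβ_pos (q : ℝ × ℝ) : 0 < M.expβ q := Real.exp_pos _

lemma lapse_eq (q : ℝ × ℝ) : M.lapse q = M.expβ q ^ 2 * M.fval q := by
  simp only [lapse, expβ, fval, ← Real.exp_nat_mul]; norm_num

lemma g_eq (p X Y : Event) : M.g p X Y = -M.lapse (vr p) * dv p X * dv p Y
    + M.expβ (vr p) * (dv p X * dr p Y + dv p Y * dr p X) + sig p X Y := by
  simp only [g, efMetric, lapse, expβ, vr, sig]; ring

lemma g_comm (p X Y : Event) : M.g p X Y = M.g p Y X := by
  rw [g_eq, g_eq, sig_comm]; ring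

lemma g_add_right (p X Y Z : Event) : M.g p X (Y + Z) = M.g p X Y + M.g p X Z := by
  simp only [g_eq, dv_add, dr_add, sig_add_right]; ring

lemma g_smul_right (p X Y : Event) (c : ℝ) : M.g p X (c • Y) = c * M.g p X Y := by
  simp only [g_eq, dv_smul, dr_smul, sig_smul_right]; ring

variable {M}

lemma mem_carrier_of_norm_eq {p p' : Event} (hp : p ∈ M.carrier) (h1 : p'.1 = p.1)
    (h2 : ‖p'.2‖ = ‖p.2‖) : p' ∈ M.carrier := by
  have := M.rotation_mem p hp p'.2 h2
  rwa [← h1] at this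

lemma mem_spheres_iff {e : EuclideanSpace ℝ (Fin 3)} (he : ‖e‖ = 1) {q : ℝ × ℝ} :
    q ∈ M.spheres ↔ 0 < q.2 ∧ ray e q ∈ M.carrier := by
  constructor
  · rintro ⟨h0, x, hx, hm⟩
    refine ⟨h0, mem_carrier_of_norm_eq hm rfl ?_⟩
    simp [ray, norm_smul, he, hx, abs_of_pos h0]
  · rintro ⟨h0, hm⟩
    exact ⟨h0, _, by simp [norm_smul, he, abs_of_pos h0], hm⟩

lemma vr_mem_spheres {p : Event} (hp : 0 < radius p) : vr p ∈ M.spheres ↔ p ∈ M.carrier := by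
  have h := radius_pos.1 hp
  rw [mem_spheres_iff (e := ‖p.2‖⁻¹ • p.2) (by simp [norm_smul, h]), ray_vr h]
  exact and_iff_right hp

lemma isOpen_spheres : IsOpen M.spheres := by
  obtain ⟨e, he⟩ := exists_unit
  have : M.spheres = {q | 0 < q.2} ∩ ray e ⁻¹' M.carrier := by
    ext q; exact mem_spheres_iff he
  rw [this]
  exact (isOpen_lt continuous_const continuous_snd).inter
    (M.isOpen_carrier.preimage (continuous_ray e))

lemma contDiff_ray (e : EuclideanSpace ℝ (Fin 3)) : ContDiff ℝ 1 (ray e) := by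
  unfold ray; fun_prop

lemma contDiffAt_g_ray {e : EuclideanSpace ℝ (Fin 3)} {q : ℝ × ℝ} (X Y : Event)
    (hq : ray e q ∈ M.carrier) : ContDiffAt ℝ 1 (fun q => M.g (ray e q) X Y) q :=
  ((M.contDiffOn_metric X Y).contDiffAt (M.isOpen_carrier.mem_nhds hq)).comp q
    (contDiff_ray e).contDiffAt

lemma g_time_time (p : Event) : M.g p (1, 0) (1, 0) = -M.lapse (vr p) := by
  simp [g_eq, dv, dr, sig]

lemma g_time_ray {e : EuclideanSpace ℝ (Fin 3)} (he : ‖e‖ = 1) {q : ℝ × ℝ} (hq : 0 < q.2) :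
    M.g (ray e q) (1, 0) (0, e) = M.expβ q - M.lapse q := by
  have h1 : dr (ray e q) (0, e) = 1 := by
    simp [dr, ray, norm_smul, he, abs_of_pos hq, inner_smul_left, hq.ne']
  have h2 : dr (ray e q) (1, 0) = 0 := by simp [dr]
  simp only [g_eq, dv, sig, h1, h2, vr_ray he hq.le]
  simp; ring

/-- Nothing is assumed about `β` and `m` themselves. Regularity of the coefficients is read off from
metric components along a fixed ray: `-g(∂_t, ∂_t)` is the lapse coefficient, and adding `g(∂_t, e)`
gives `e^β`. -/
lemma contDiffAt_lapse {q : ℝ × ℝ} (hq : q ∈ M.spheres) : ContDiffAt ℝ 1 M.lapse q := by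
  obtain ⟨e, he⟩ := exists_unit
  have h := (contDiffAt_g_ray (1, 0) (1, 0) ((mem_spheres_iff he).1 hq).2).neg
  refine h.congr_of_eventuallyEq ?_
  filter_upwards [isOpen_spheres.mem_nhds hq] with q' hq'
  rw [g_time_time, vr_ray he hq'.1.le, neg_neg]

lemma contDiffAt_expβ {q : ℝ × ℝ} (hq : q ∈ M.spheres) : ContDiffAt ℝ 1 M.expβ q := by
  obtain ⟨e, he⟩ := exists_unit
  have h := (contDiffAt_g_ray (1, 0) (0, e) ((mem_spheres_iff he).1 hq).2).add
    (contDiffAt_lapse hq)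
  refine h.congr_of_eventuallyEq ?_
  filter_upwards [isOpen_spheres.mem_nhds hq] with q' hq'
  rw [g_time_ray he hq'.1]; ring

lemma fval_eq (q : ℝ × ℝ) : M.fval q = M.lapse q / M.expβ q ^ 2 := by
  rw [lapse_eq]; field_simp [(M.expβ_pos q).ne']

lemma contDiffAt_fval {q : ℝ × ℝ} (hq : q ∈ M.spheres) : ContDiffAt ℝ 1 M.fval q := by
  have h : M.fval = fun q => M.lapse q / M.expβ q ^ 2 := funext fval_eq
  rw [h]
  exact (contDiffAt_lapse hq).div ((contDiffAt_expβ hq).pow 2) (by have := M.expβ_pos q; positivity)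

/-- The derivative of the metric in the direction `X`. -/
lemma fderiv_g {p : Event} (hp : p ∈ M.carrier) (h0 : p.2 ≠ 0) {A' E' : ℝ × ℝ →L[ℝ] ℝ}
    (hA : HasFDerivAt M.lapse A' (vr p)) (hE : HasFDerivAt M.expβ E' (vr p)) (X Y Z : Event) :
    fderiv ℝ (fun q => M.g q Y Z) p X =
      -A' (dv p X, dr p X) * dv p Y * dv p Z
      - M.lapse (vr p) * (sig p X Y * dv p Z + dv p Y * sig p X Z) / radius p
      + E' (dv p X, dr p X) * (dv p Y * dr p Z + dv p Z * dr p Y)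
      + M.expβ (vr p) * (sig p X Y * (dv p Z + dr p Z) + sig p X Z * (dv p Y + dr p Y)) / radius p
      - (dr p Y * sig p X Z + dr p Z * sig p X Y) / radius p := by
  -- The total derivative exists by the regularity of the metric, so its value on `X` can be
  -- computed along a straight line.
  have hd : HasFDerivAt (fun q => M.g q Y Z) (fderiv ℝ (fun q => M.g q Y Z) p) p :=
    (((M.contDiffOn_metric Y Z).contDiffAt (M.isOpen_carrier.mem_nhds hp)).differentiableAt
      (by norm_num)).hasFDerivAt
  have hl : HasDerivAt (fun s : ℝ => p + s • X) X 0 := by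
    simpa using ((hasDerivAt_id (0 : ℝ)).smul_const X).const_add p
  have e0 : p + (0 : ℝ) • X = p := by simp
  have h0' : (p + (0 : ℝ) • X).2 ≠ 0 := by rwa [e0]
  have hd' : HasDerivAt (fun s : ℝ => M.g (p + s • X) Y Z) _ 0 :=
    hasDerivAt_comp_of_eq e0 hd hl
  have kA : HasDerivAt (fun s : ℝ => M.lapse (vr (p + s • X))) _ 0 :=
    hasDerivAt_comp_of_eq (by rw [e0]) hA (hasDerivAt_vr hl h0')
  have kE : HasDerivAt (fun s : ℝ => M.expβ (vr (p + s • X))) _ 0 :=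
    hasDerivAt_comp_of_eq (by rw [e0]) hE (hasDerivAt_vr hl h0')
  have c1 := hasDerivAt_dv hl (hasDerivAt_const (0 : ℝ) Y) h0'
  have c2 := hasDerivAt_dv hl (hasDerivAt_const (0 : ℝ) Z) h0'
  have c3 := hasDerivAt_dr hl (hasDerivAt_const (0 : ℝ) Y) h0'
  have c4 := hasDerivAt_dr hl (hasDerivAt_const (0 : ℝ) Z) h0'
  have key := (((kA.neg.mul c1).mul c2).add (kE.mul ((c1.mul c4).add (c2.mul c3)))).add
    ((c3.mul c4).const_sub (inner ℝ Y.2 Z.2))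
  rw [hd'.unique (key.congr_of_eventuallyEq (Eventually.of_forall fun s => M.g_eq _ Y Z))]
  simp only [e0, dr_zero, dv, Prod.fst_zero, Pi.neg_apply, Pi.mul_apply, Pi.add_apply]
  ring

/-- The polarized Christoffel symbol in terms of the coefficient functions. -/
lemma christoffel_eq {p : Event} (hp : p ∈ M.carrier) (h0 : p.2 ≠ 0) {A' E' : ℝ × ℝ →L[ℝ] ℝ}
    (hA : HasFDerivAt M.lapse A' (vr p)) (hE : HasFDerivAt M.expβ E' (vr p)) (X Y k : Event) :
    M.christoffel p X Y k =
      -(A' (dv p X, dr p X) * dv p Y + A' (dv p Y, dr p Y) * dv p X) * dv p k / 2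
      + (E' (dv p X, dr p X) * (dv p Y * dr p k + dr p Y * dv p k)
        + E' (dv p Y, dr p Y) * (dv p X * dr p k + dr p X * dv p k)) / 2
      + A' (dv p k, dr p k) * dv p X * dv p Y / 2
      - E' (dv p k, dr p k) * (dv p X * dr p Y + dv p Y * dr p X) / 2
      + sig p X Y / radius p * (-M.lapse (vr p) * dv p k + M.expβ (vr p) * dr p k
        + M.expβ (vr p) * dv p k - dr p k) := by
  rw [christoffel, fderiv_g hp h0 hA hE, fderiv_g hp h0 hA hE, fderiv_g hp h0 hA hE,
    sig_comm p Y X, sig_comm p k X, sig_comm p k Y]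
  ring

end SphSpacetime

/-! ### Orthonormal frames and traces of forms in two dimensions. -/

lemma posDef_fin_two {γ : Matrix (Fin 2) (Fin 2) ℝ} (h : γ.PosDef) (ξ : Fin 2 → ℝ)
    (hξ : ξ ≠ 0) : 0 < ξ 0 * γ 0 0 * ξ 0 + ξ 0 * γ 0 1 * ξ 1 + ξ 1 * γ 1 0 * ξ 0
      + ξ 1 * γ 1 1 * ξ 1 := by
  have := h.dotProduct_mulVec_pos hξ
  simp only [Matrix.mulVec, dotProduct, Fin.sum_univ_two, Pi.star_apply, star_trivial] at this
  linarith

/-- The bilinear form of a `2 × 2` matrix. -/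
def bil (K : Fin 2 → Fin 2 → ℝ) (ξ η : Fin 2 → ℝ) : ℝ :=
  ξ 0 * η 0 * K 0 0 + ξ 0 * η 1 * K 0 1 + ξ 1 * η 0 * K 1 0 + ξ 1 * η 1 * K 1 1

/-- An orthonormal frame whose first vector is annihilated by a given linear functional. -/
lemma exists_frame {γ : Matrix (Fin 2) (Fin 2) ℝ} (h : γ.PosDef) (l : Fin 2 → ℝ) :
    ∃ ξ η : Fin 2 → ℝ, bil γ ξ ξ = 1 ∧ bil γ η η = 1 ∧ bil γ ξ η = 0 ∧
      l 0 * ξ 0 + l 1 * ξ 1 = 0 := by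
  have hpos : ∀ ξ : Fin 2 → ℝ, ξ ≠ 0 → 0 < bil γ ξ ξ := fun ξ hξ => by
    have := posDef_fin_two h ξ hξ
    unfold bil; linarith
  have hs : γ 0 1 = γ 1 0 := by
    have := h.1.apply 0 1
    simpa using this.symm
  have hnorm : ∀ ξ : Fin 2 → ℝ, ξ ≠ 0 → ∃ c : ℝ, c ≠ 0 ∧ bil γ (c • ξ) (c • ξ) = 1 := by
    intro ξ hξ
    have hp := hpos ξ hξ
    have hsq : √(bil γ ξ ξ) ≠ 0 := (Real.sqrt_pos.2 hp).ne'
    refine ⟨(√(bil γ ξ ξ))⁻¹, inv_ne_zero hsq, ?_⟩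
    have h2 : bil γ ((√(bil γ ξ ξ))⁻¹ • ξ) ((√(bil γ ξ ξ))⁻¹ • ξ)
        = (√(bil γ ξ ξ))⁻¹ ^ 2 * bil γ ξ ξ := by
      simp only [bil, Pi.smul_apply, smul_eq_mul]; ring
    rw [h2, inv_pow, Real.sq_sqrt hp.le, inv_mul_cancel₀ hp.ne']
  obtain ⟨ξ₀, hξ₀, hl⟩ : ∃ ξ : Fin 2 → ℝ, ξ ≠ 0 ∧ l 0 * ξ 0 + l 1 * ξ 1 = 0 := by
    by_cases hl : l = 0
    · exact ⟨![1, 0], fun h => by simpa using congrFun h 0, by simp [hl]⟩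
    · refine ⟨![l 1, -l 0], fun h => hl ?_, by simp; ring⟩
      have h0 := congrFun h 0
      have h1 := congrFun h 1
      funext i
      fin_cases i <;> simp_all
  obtain ⟨c, hc, hn⟩ := hnorm ξ₀ hξ₀
  have hp0 := hpos ξ₀ hξ₀
  -- This is the covector `γ ξ₀` turned by a right angle, hence `γ`-orthogonal to `ξ₀`.
  set η₀ : Fin 2 → ℝ := ![-(ξ₀ 0 * γ 0 1 + ξ₀ 1 * γ 1 1), ξ₀ 0 * γ 0 0 + ξ₀ 1 * γ 1 0] with hη
  have hη₀ : η₀ ≠ 0 := by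
    intro h
    have h0 := congrFun h 0
    have h1 := congrFun h 1
    simp only [hη, Matrix.cons_val_zero, Matrix.cons_val_one, Pi.zero_apply] at h0 h1
    unfold bil at hp0
    have : ξ₀ 0 * ξ₀ 0 * γ 0 0 + ξ₀ 0 * ξ₀ 1 * γ 0 1 + ξ₀ 1 * ξ₀ 0 * γ 1 0
      + ξ₀ 1 * ξ₀ 1 * γ 1 1 = 0 := by linear_combination ξ₀ 0 * h1 - ξ₀ 1 * h0
    linarith
  obtain ⟨d, hd, hn'⟩ := hnorm η₀ hη₀
  refine ⟨c • ξ₀, d • η₀, hn, hn', ?_, ?_⟩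
  · simp only [bil, Pi.smul_apply, smul_eq_mul, hη, Matrix.cons_val_zero, Matrix.cons_val_one]
    ring
  · simp only [Pi.smul_apply, smul_eq_mul]
    linear_combination c * hl

/-- With the frame as the columns of `N`, orthonormality says `Nᵀ γ N = 1`, so `γ⁻¹ = N Nᵀ`. -/
lemma trace_eq_of_frame {γ : Matrix (Fin 2) (Fin 2) ℝ} {ξ η : Fin 2 → ℝ}
    (h1 : bil γ ξ ξ = 1) (h2 : bil γ η η = 1) (h3 : bil γ ξ η = 0) (hs : γ 0 1 = γ 1 0)
    (K : Fin 2 → Fin 2 → ℝ) :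
    ∑ A : Fin 2, ∑ B : Fin 2, γ⁻¹ A B * K A B = bil K ξ ξ + bil K η η := by
  set N : Matrix (Fin 2) (Fin 2) ℝ := !![ξ 0, η 0; ξ 1, η 1] with hN
  have hNN : (N.transpose * γ) * N = 1 := by
    simp only [bil, ← hs] at h1 h2 h3
    ext i j
    fin_cases i <;> fin_cases j <;>
      simp only [hN, Matrix.mul_apply, Fin.sum_univ_two, Matrix.transpose_apply] <;>
      simp [← hs] <;>
      first
        | linear_combination h1
        | linear_combination h2
        | linear_combination h3
  have h4 : N * (N.transpose * γ) = 1 := mul_eq_one_comm.1 hNN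
  rw [← Matrix.mul_assoc] at h4
  rw [Matrix.inv_eq_left_inv h4]
  simp [hN, Matrix.mul_apply, Fin.sum_univ_two, bil]
  ring

/-! ### Expansions expressed through accelerations of coordinate lines. -/

/-- The tangent vector with components `ξ`. -/
noncomputable def dirVec (φ : Param → Event) (u : Param) (ξ : Fin 2 → ℝ) : Event :=
  ξ 0 • tangent φ u 0 + ξ 1 • tangent φ u 1

/-- The acceleration of the coordinate line in the direction `ξ`. -/
noncomputable def accVec (φ : Param → Event) (u : Param) (ξ : Fin 2 → ℝ) : Event :=
  (ξ 0 * ξ 0) • secondDeriv φ u 0 0 + (ξ 0 * ξ 1) • secondDeriv φ u 0 1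
    + (ξ 1 * ξ 0) • secondDeriv φ u 1 0 + (ξ 1 * ξ 1) • secondDeriv φ u 1 1

lemma toLp_eq (ξ : Fin 2 → ℝ) : (WithLp.toLp 2 ξ : Param) =
    ξ 0 • EuclideanSpace.single 0 1 + ξ 1 • EuclideanSpace.single 1 1 := by
  ext i; fin_cases i <;> simp

lemma fderiv_toLp (φ : Param → Event) (u : Param) (ξ : Fin 2 → ℝ) :
    fderiv ℝ φ u (WithLp.toLp 2 ξ) = dirVec φ u ξ := by
  rw [toLp_eq, map_add, map_smul, map_smul]; rfl

lemma hasDerivAt_line (u ξ : Param) (s : ℝ) : HasDerivAt (fun s : ℝ => u + s • ξ) ξ s := by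
  simpa using ((hasDerivAt_id s).smul_const ξ).const_add u

section curve
variable {φ : Param → Event} {U : Set Param} {u : Param}

lemma contDiffAt_tangent (hU : IsOpen U) (hφ : ContDiffOn ℝ 3 φ U) (hu : u ∈ U) (A : Fin 2) :
    ContDiffAt ℝ 2 (fun w => tangent φ w A) u :=
  ((hφ.contDiffAt (hU.mem_nhds hu)).fderiv_right (m := 2) (by norm_num)).clm_apply
    contDiffAt_const

lemma eventually_mem_line (hU : IsOpen U) (hu : u ∈ U) (ξ : Param) :
    ∀ᶠ s : ℝ in 𝓝 0, u + s • ξ ∈ U := by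
  have : Tendsto (fun s : ℝ => u + s • ξ) (𝓝 0) (𝓝 u) := by
    simpa using (hasDerivAt_line u ξ 0).continuousAt.tendsto
  exact this (hU.mem_nhds hu)

lemma hasDerivAt_curve (hU : IsOpen U) (hφ : ContDiffOn ℝ 3 φ U) (hu : u ∈ U) (ξ : Fin 2 → ℝ) :
    ∀ᶠ s : ℝ in 𝓝 0, HasDerivAt (fun s : ℝ => φ (u + s • WithLp.toLp 2 ξ))
      (dirVec φ (u + s • WithLp.toLp 2 ξ) ξ) s := by
  filter_upwards [eventually_mem_line hU hu (WithLp.toLp 2 ξ)] with s hs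
  have h := ((hφ.contDiffAt (hU.mem_nhds hs)).differentiableAt (by norm_num)).hasFDerivAt
  have h2 := h.comp_hasDerivAt s (hasDerivAt_line u (WithLp.toLp 2 ξ) s)
  rw [fderiv_toLp] at h2
  exact h2

lemma hasDerivAt_dirVec (hU : IsOpen U) (hφ : ContDiffOn ℝ 3 φ U) (hu : u ∈ U) (ξ : Fin 2 → ℝ) :
    HasDerivAt (fun s : ℝ => dirVec φ (u + s • WithLp.toLp 2 ξ) ξ) (accVec φ u ξ) 0 := by
  have key : ∀ B : Fin 2, HasDerivAt (fun s : ℝ => tangent φ (u + s • WithLp.toLp 2 ξ) B)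
      (ξ 0 • secondDeriv φ u 0 B + ξ 1 • secondDeriv φ u 1 B) 0 := by
    intro B
    have h := ((contDiffAt_tangent hU hφ hu B).differentiableAt (by norm_num)).hasFDerivAt
    have h2 := HasFDerivAt.comp_hasDerivAt_of_eq (0 : ℝ) h
      (hasDerivAt_line u (WithLp.toLp 2 ξ) 0) (by simp)
    rw [toLp_eq, map_add, map_smul, map_smul] at h2
    rw [toLp_eq]
    exact h2
  refine (((key 0).const_smul (ξ 0)).add ((key 1).const_smul (ξ 1))).congr_deriv ?_
  simp only [accVec, smul_add, smul_smul, mul_comm]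
  module

end curve

namespace SphSpacetime
variable {M : SphSpacetime} {φ : Param → Event} {u : Param}

lemma g_add_left (p X Y Z : Event) : M.g p (X + Y) Z = M.g p X Z + M.g p Y Z := by
  rw [g_comm, g_add_right, M.g_comm p Z, M.g_comm p Z]

lemma g_smul_left (p X Y : Event) (c : ℝ) : M.g p (c • X) Y = c * M.g p X Y := by
  rw [g_comm, g_smul_right, g_comm]

lemma bil_firstForm (ξ η : Fin 2 → ℝ) :
    bil (M.firstForm φ u) ξ η = M.g (φ u) (dirVec φ u ξ) (dirVec φ u η) := by
  simp only [bil, firstForm, Matrix.of_apply, dirVec, g_add_right, g_smul_right, g_add_left,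
    g_smul_left]
  ring

lemma firstForm_symm : M.firstForm φ u 0 1 = M.firstForm φ u 1 0 := by
  simp [firstForm, M.g_comm]

lemma g_self_pos (h : (M.firstForm φ u).PosDef) {ξ : Fin 2 → ℝ} (hξ : ξ ≠ 0) :
    0 < M.g (φ u) (dirVec φ u ξ) (dirVec φ u ξ) := by
  rw [← bil_firstForm]
  have := posDef_fin_two h ξ hξ
  unfold bil; linarith

lemma posDef_of_pos (h : ∀ ξ : Fin 2 → ℝ, ξ ≠ 0 → 0 < M.g (φ u) (dirVec φ u ξ) (dirVec φ u ξ)) :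
    (M.firstForm φ u).PosDef := by
  refine Matrix.PosDef.of_dotProduct_mulVec_pos ?_ fun ξ hξ => ?_
  · ext i j
    simp [firstForm, M.g_comm]
  · have := h ξ hξ
    rw [← bil_firstForm] at this
    simp only [Matrix.mulVec, dotProduct, Fin.sum_univ_two, Pi.star_apply, star_trivial]
    unfold bil at this; linarith

/-- The second fundamental form in the direction `ξ`. -/
noncomputable def normalCurv (M : SphSpacetime) (φ : Param → Event) (u : Param) (k : Event)
    (ξ : Fin 2 → ℝ) : ℝ :=
  -(M.g (φ u) k (accVec φ u ξ) + M.christoffel (φ u) (dirVec φ u ξ) (dirVec φ u ξ) k)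

/-- The explicit formula for the Christoffel symbol is bilinear in the tangent vectors, so matrix
entries may be replaced by a single direction; along it the second derivatives combine into the
acceleration of a line. -/
lemma bil_secondForm {A' E' : ℝ × ℝ →L[ℝ] ℝ} (hp : φ u ∈ M.carrier) (h0 : (φ u).2 ≠ 0)
    (hA : HasFDerivAt M.lapse A' (vr (φ u))) (hE : HasFDerivAt M.expβ E' (vr (φ u)))
    (k : Event) (ξ : Fin 2 → ℝ) :
    bil (M.secondForm φ u k) ξ ξ = M.normalCurv φ u k ξ := by
  have hlin : ∀ (T : ℝ × ℝ →L[ℝ] ℝ) (a b : ℝ), T (a, b) = a * T (1, 0) + b * T (0, 1) := by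
    intro T a b
    have : ((a, b) : ℝ × ℝ) = a • (1, 0) + b • (0, 1) := by simp
    rw [this, map_add, map_smul, map_smul]; rfl
  simp only [bil, secondForm, normalCurv, christoffel_eq hp h0 hA hE, accVec, dirVec, g_add_right,
    g_smul_right, dr_add, dr_smul, dv_add, dv_smul, sig_add_right, sig_smul_right, sig_add_left,
    sig_smul_left]
  simp only [hlin A' (_ + _), hlin E' (_ + _), hlin A' (dv _ _), hlin E' (dv _ _)]
  ring

lemma expansion_eq {A' E' : ℝ × ℝ →L[ℝ] ℝ} (hp : φ u ∈ M.carrier) (h0 : (φ u).2 ≠ 0)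
    (hA : HasFDerivAt M.lapse A' (vr (φ u))) (hE : HasFDerivAt M.expβ E' (vr (φ u)))
    (k : Event) {ξ η : Fin 2 → ℝ} (h1 : M.g (φ u) (dirVec φ u ξ) (dirVec φ u ξ) = 1)
    (h2 : M.g (φ u) (dirVec φ u η) (dirVec φ u η) = 1)
    (h3 : M.g (φ u) (dirVec φ u ξ) (dirVec φ u η) = 0) :
    M.expansion φ u k = M.normalCurv φ u k ξ + M.normalCurv φ u k η := by
  rw [← bil_firstForm] at h1 h2 h3
  rw [expansion, trace_eq_of_frame h1 h2 h3 firstForm_symm, bil_secondForm hp h0 hA hE,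
    bil_secondForm hp h0 hA hE]

end SphSpacetime

/-! ### Analytic tools: lowest supporting solution, cut-off, second derivative test. -/

/-- Among the solutions of `R' = G(v, R)` there is one that supports a given compact set from
above. -/
lemma exists_supporting_solution {G : ℝ × ℝ → ℝ} (hG : ContDiff ℝ 1 G) (hc : HasCompactSupport G)
    {K : Set (ℝ × ℝ)} (hK : IsCompact K) (hne : K.Nonempty) :
    ∃ (R : ℝ → ℝ) (T : ℝ), (∀ q ∈ K, |q.1| < T) ∧
      (∀ v ∈ Ioo (-T) T, HasDerivAt R (G (v, R v)) v) ∧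
      (∀ q ∈ K, q.2 ≤ R q.1) ∧ ∃ q ∈ K, q.2 = R q.1 := by
  obtain ⟨b, hb⟩ := hK.isBounded.exists_norm_le
  obtain ⟨B, hB⟩ := hc.exists_bound_of_continuous hG.continuous
  obtain ⟨C, hC⟩ := ContDiff.lipschitzWith_of_hasCompactSupport hc hG one_ne_zero
  have hB0 : 0 ≤ B := (norm_nonneg _).trans (hB 0)
  have hb0 : 0 ≤ b := (norm_nonneg _).trans (hb _ hne.some_mem)
  set T := b + 1 with hT
  have hK1 : ∀ q ∈ K, |q.1| < T := fun q hq => by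
    have h1 : ‖q.1‖ ≤ ‖q‖ := norm_fst_le q
    rw [Real.norm_eq_abs] at h1
    linarith [hb q hq]
  have hK2 : ∀ q ∈ K, |q.2| ≤ b := fun q hq => (norm_snd_le q).trans (hb q hq)
  -- A solution moves by at most `B * T` on `[-T, T]`, so the one starting at `r` stays above `K`
  -- and the one starting at `-r` stays below.
  set r : ℝ := b + B * T + 1 with hr
  have hr0 : 0 ≤ r := by positivity
  have hT0 : 0 < T := by positivity
  have hPL : IsPicardLindelof (fun v x => G (v, x)) (tmin := -T) (tmax := T)
      ⟨0, by constructor <;> linarith⟩ (0 : ℝ)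
      (NNReal.mk (r + B * T) (by positivity)) (NNReal.mk r hr0) (NNReal.mk B hB0) C := by
    refine ⟨fun t _ => ?_, fun x _ => ?_, fun t _ x _ => hB _, ?_⟩
    · refine LipschitzWith.lipschitzOnWith ?_
      have : LipschitzWith 1 (fun x : ℝ => (t, x)) := LipschitzWith.prodMk_left t
      simpa [Function.comp_def] using hC.comp this
    · exact (hG.continuous.comp (by fun_prop)).continuousOn
    · simp
  obtain ⟨α, hα, L', hL⟩ := hPL.exists_forall_mem_closedBall_eq_hasDerivWithinAt_lipschitzOnWith
  have hball : Metric.closedBall (0 : ℝ) (NNReal.mk r hr0 : ℝ) = Icc (-r) r := by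
    rw [Real.closedBall_eq_Icc]; simp
  rw [hball] at hα hL
  have hI : ∀ q ∈ K, q.1 ∈ Icc (-T) T := fun q hq => abs_le.1 (hK1 q hq).le
  have hdev : ∀ c ∈ Icc (-r) r, ∀ v ∈ Icc (-T) T, |α c v - c| ≤ B * T := by
    intro c hcr v hv
    have h0 : (0 : ℝ) ∈ Icc (-T) T := ⟨by linarith, by linarith⟩
    have := Convex.norm_image_sub_le_of_norm_hasDerivWithin_le (hα c hcr).2
      (fun t _ => hB _) (convex_Icc _ _) h0 hv
    rw [(hα c hcr).1, sub_zero] at this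
    exact this.trans (mul_le_mul_of_nonneg_left (abs_le.2 hv) hB0)
  -- Initial values whose solutions lie above `K`. Lipschitz dependence on the initial value makes
  -- this set closed, and its least element gives the touching solution.
  set D : Set ℝ := {c ∈ Icc (-r) r | ∀ q ∈ K, q.2 ≤ α c q.1} with hD
  have hDc : IsClosed D := by
    have : D = ⋂ q ∈ K, {c ∈ Icc (-r) r | q.2 ≤ α c q.1} := by
      ext c
      simp only [hD, mem_iInter, mem_ofPred_eq]
      exact ⟨fun h q hq => ⟨h.1, h.2 q hq⟩, fun h => ⟨(h _ hne.some_mem).1, fun q hq => (h q hq).2⟩⟩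
    rw [this]
    refine isClosed_biInter fun q hq => ?_
    exact isClosed_Icc.isClosed_le continuousOn_const (hL q.1 (hI q hq)).continuousOn
  have hDr : r ∈ D := by
    refine ⟨⟨by linarith, le_rfl⟩, fun q hq => ?_⟩
    have h1 := hdev r ⟨by linarith, le_rfl⟩ q.1 (hI q hq)
    have h2 := abs_le.1 (hK2 q hq)
    have h3 := abs_le.1 h1
    linarith
  have hDb : BddBelow D := ⟨-r, fun c hc => hc.1.1⟩
  have hcD : sInf D ∈ D := hDc.csInf_mem ⟨r, hDr⟩ hDb
  set c := sInf D with hcdef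
  have hcont : ContinuousOn (α c) (Icc (-T) T) := fun v hv => ((hα c hcD.1).2 v hv).continuousWithinAt
  refine ⟨α c, T, hK1, fun v hv => ?_, hcD.2, ?_⟩
  · exact ((hα c hcD.1).2 v (Ioo_subset_Icc_self hv)).hasDerivAt (Icc_mem_nhds hv.1 hv.2)
  -- Without contact, compactness leaves a positive gap `d`; lowering the initial value by `t` moves
  -- the solution by at most `L' * t ≤ d`, so it stays above `K`, against minimality.
  by_contra! hno
  obtain ⟨q₀, hq₀, hmin⟩ := hK.exists_isMinOn hne
    (f := fun q => α c q.1 - q.2)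
    ((hcont.comp continuousOn_fst hI).sub continuousOn_snd)
  have hgap : 0 < α c q₀.1 - q₀.2 := sub_pos.2 (lt_of_le_of_ne (hcD.2 q₀ hq₀) (hno q₀ hq₀))
  set d := α c q₀.1 - q₀.2 with hd
  have hcr : -r < c := by
    refine lt_of_le_of_ne hcD.1.1 fun h => ?_
    have h1 := abs_le.1 (hdev c hcD.1 q₀.1 (hI q₀ hq₀))
    have h2 := abs_le.1 (hK2 q₀ hq₀)
    have h3 := hcD.2 q₀ hq₀
    linarith
  set t := min (c + r) (d / (L' + 1)) with ht
  have ht0 : 0 < t := lt_min (by linarith) (by positivity)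
  have htL : L' * t ≤ d := by
    have h1 : t ≤ d / (L' + 1) := min_le_right _ _
    rw [le_div_iff₀ (by positivity)] at h1
    nlinarith
  have hmem : c - t ∈ Icc (-r) r :=
    ⟨by linarith [min_le_left (c + r) (d / (L' + 1))], by linarith [hcD.1.2]⟩
  have : c - t ∈ D := by
    refine ⟨hmem, fun q hq => ?_⟩
    have h1 := (hL q.1 (hI q hq)).dist_le_mul (c - t) hmem c hcD.1
    rw [Real.dist_eq, Real.dist_eq, sub_sub_cancel_left, abs_neg, abs_of_pos ht0] at h1
    have h2 := abs_le.1 h1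
    have h3 : d ≤ α c q.1 - q.2 := hmin hq
    linarith
  linarith [csInf_le hDb this]

/-- Multiplication of a function on an open set by a cut-off. -/
lemma exists_cutoff {F : ℝ × ℝ → ℝ} {O K : Set (ℝ × ℝ)} (hO : IsOpen O) (hF : ContDiffOn ℝ 1 F O)
    (hK : IsCompact K) (hKO : K ⊆ O) :
    ∃ χ : ℝ × ℝ → ℝ, ContDiff ℝ 1 (fun q => χ q * F q) ∧ HasCompactSupport (fun q => χ q * F q) ∧
      (∀ q, 0 ≤ χ q) ∧ (∀ q ∉ O, χ q = 0) ∧ ∀ q ∈ K, χ =ᶠ[𝓝 q] 1 := by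
  obtain ⟨b, hb⟩ := hK.isBounded.exists_norm_le
  -- Intersecting with a ball makes the support of the cut-off bounded.
  set O' := O ∩ Metric.ball 0 (b + 1) with hO'
  have hO'o : IsOpen O' := hO.inter Metric.isOpen_ball
  have hKO' : K ⊆ O' := fun q hq => ⟨hKO hq, by simpa using (hb q hq).trans_lt (by linarith)⟩
  obtain ⟨χ, h0, h1, hI⟩ := exists_contMDiffMap_zero_one_nhds_of_isClosed (n := 1)
    (modelWithCornersSelf ℝ (ℝ × ℝ)) hO'o.isClosed_compl hK.isClosed
    (disjoint_compl_left_iff_subset.2 hKO')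
  have hχ : ContDiff ℝ 1 χ := χ.contMDiff.contDiff
  have h0' : ∀ q ∉ O', χ =ᶠ[𝓝 q] 0 := fun q hq => (eventually_nhdsSet_iff_forall.1 h0) q hq
  refine ⟨χ, contDiff_iff_contDiffAt.2 fun q => ?_, ?_, fun q => (hI q).1, fun q hq => ?_,
    fun q hq => (eventually_nhdsSet_iff_forall.1 h1) q hq⟩
  · by_cases hq : q ∈ O'
    · exact hχ.contDiffAt.mul (hF.contDiffAt (hO.mem_nhds hq.1))
    · refine (contDiffAt_const (c := (0 : ℝ))).congr_of_eventuallyEq ?_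
      filter_upwards [h0' q hq] with x hx
      simp [hx]
  · refine HasCompactSupport.intro (isCompact_closedBall (0 : ℝ × ℝ) (b + 1)) fun q hq => ?_
    have : q ∉ O' := fun h => hq (Metric.ball_subset_closedBall h.2)
    simp [(h0' q this).self_of_nhds]
  · exact (h0' q fun h => hq h.1).self_of_nhds

/-- The second derivative test at a maximum along a curve. -/
lemma second_deriv_nonpos {f f' : ℝ → ℝ} {a : ℝ} (h1 : ∀ᶠ s in 𝓝 0, HasDerivAt f (f' s) s)
    (h2 : HasDerivAt f' a 0) (hmax : IsLocalMax f 0) : f' 0 = 0 ∧ a ≤ 0 := by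
  have hf0 : f' 0 = 0 := hmax.hasDerivAt_eq_zero h1.self_of_nhds
  refine ⟨hf0, ?_⟩
  -- A positive second derivative would make the point a local minimum too, so `f` would be locally
  -- constant and its second derivative zero.
  by_contra! ha
  have hd : deriv f =ᶠ[𝓝 0] f' := h1.mono fun s hs => hs.deriv
  have hdd : deriv (deriv f) 0 = a := by rw [hd.deriv_eq, h2.deriv]
  have hmin : IsLocalMin f 0 := isLocalMin_of_deriv_deriv_pos (by rw [hdd]; exact ha)
    (by rw [hd.self_of_nhds, hf0]) h1.self_of_nhds.continuousAt
  have hconst : f =ᶠ[𝓝 0] fun _ => f 0 := by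
    filter_upwards [hmin, hmax] with s h3 h4 using le_antisymm h4 h3
  have : deriv (deriv f) 0 = 0 := by
    have h3 : deriv f =ᶠ[𝓝 0] deriv fun _ => f 0 := hconst.deriv
    rw [h3.deriv_eq]; simp
  linarith

/-! ### Contact of a trapped surface with an outgoing light cone. -/

lemma clm_prod_apply (T : ℝ × ℝ →L[ℝ] ℝ) (a b : ℝ) : T (a, b) = a * T (1, 0) + b * T (0, 1) := by
  have : ((a, b) : ℝ × ℝ) = a • (1, 0) + b • (0, 1) := by simp
  rw [this, map_add, map_smul, map_smul]; rfl

/-- The vector at `p` in the radial plane with components `a = dv`, `b = dr`. -/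
noncomputable def radialVec (p : Event) (a b : ℝ) : Event := (a - b, (b / ‖p.2‖) • p.2)

lemma dr_radialVec {p : Event} (h0 : p.2 ≠ 0) (a b : ℝ) : dr p (radialVec p a b) = b := by
  have : ‖p.2‖ ≠ 0 := by simpa using h0
  simp only [dr, radialVec, inner_smul_right, real_inner_self_eq_norm_sq]
  field_simp

lemma dv_radialVec {p : Event} (h0 : p.2 ≠ 0) (a b : ℝ) : dv p (radialVec p a b) = a := by
  rw [dv, dr_radialVec h0]; simp [radialVec]

lemma sig_radialVec {p : Event} (h0 : p.2 ≠ 0) (a b : ℝ) (X : Event) :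
    sig p (radialVec p a b) X = 0 := by
  have : ‖p.2‖ ≠ 0 := by simpa using h0
  rw [sig, dr_radialVec h0]
  simp only [dr, radialVec, inner_smul_left]
  simp; field_simp; ring

namespace SphSpacetime
variable {M : SphSpacetime} {φ : Param → Event} {U : Set Param} {u : Param}

/-- The slope `dr/dv` of the outgoing radial null rays. -/
noncomputable def slope (M : SphSpacetime) (q : ℝ × ℝ) : ℝ := M.lapse q / (2 * M.expβ q)

lemma mem_Z_iff {p : Event} : p ∈ M.Z ↔ p ∈ M.carrier ∧ 0 < radius p ∧ M.fval (vr p) ≤ 0 := by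
  simp only [Z, mem_ofPred_eq, fval, vr]
  refine and_congr_right fun _ => and_congr_right fun h => ?_
  rw [sub_nonpos, one_le_div h]

lemma hasFDerivAt_lapse {q : ℝ × ℝ} (hq : q ∈ M.spheres) :
    HasFDerivAt M.lapse (fderiv ℝ M.lapse q) q :=
  ((contDiffAt_lapse hq).differentiableAt one_ne_zero).hasFDerivAt

lemma hasFDerivAt_expβ {q : ℝ × ℝ} (hq : q ∈ M.spheres) :
    HasFDerivAt M.expβ (fderiv ℝ M.expβ q) q :=
  ((contDiffAt_expβ hq).differentiableAt one_ne_zero).hasFDerivAt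

/-- Where an outgoing radial light cone supports an f-trapped surface from above,
`1 - 2m/r` is negative. -/
lemma fval_neg_of_supported (hU : IsOpen U) (hφ : ContDiffOn ℝ 3 φ U) (hu : u ∈ U)
    (hp : φ u ∈ M.carrier) (h0 : (φ u).2 ≠ 0) (htr : M.IsFTrappedAt φ u) {R : ℝ → ℝ}
    (hR : ∀ᶠ v in 𝓝 (advTime (φ u)), HasDerivAt R (M.slope (v, R v)) v)
    (hR0 : radius (φ u) = R (advTime (φ u)))
    (hsup : ∀ w ∈ U, radius (φ w) ≤ R (advTime (φ w))) : M.fval (vr (φ u)) < 0 := by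
  have hr : 0 < radius (φ u) := radius_pos.2 h0
  have hq : vr (φ u) ∈ M.spheres := (vr_mem_spheres hr).2 hp
  have hA := hasFDerivAt_lapse hq
  have hE := hasFDerivAt_expβ hq
  set A' := fderiv ℝ M.lapse (vr (φ u))
  set E' := fderiv ℝ M.expβ (vr (φ u))
  set A := M.lapse (vr (φ u)) with hAdef
  set E := M.expβ (vr (φ u)) with hEdef
  have hEpos : 0 < E := M.expβ_pos _
  set ρ := A / (2 * E) with hρ
  have hq' : (advTime (φ u), R (advTime (φ u))) = vr (φ u) := by rw [← hR0]; rfl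
  have hRd : HasDerivAt R ρ (advTime (φ u)) := by
    have := hR.self_of_nhds
    rwa [hq'] at this
  have hslope : HasDerivAt (fun v => M.slope (v, R v))
      ((A' (1, ρ) * (2 * E) - A * (2 * E' (1, ρ))) / (2 * E) ^ 2) (advTime (φ u)) := by
    have hc : HasDerivAt (fun v => (v, R v)) ((1 : ℝ), ρ) (advTime (φ u)) :=
      (hasDerivAt_id _).prodMk hRd
    have h1 := hasDerivAt_comp_of_eq (Y := fun v => (v, R v)) hq' hA hc
    have h2 := (hasDerivAt_comp_of_eq (Y := fun v => (v, R v)) hq' hE hc).const_mul 2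
    refine (h1.div h2 ?_).congr_deriv ?_
    · have := M.expβ_pos (advTime (φ u), R (advTime (φ u))); positivity
    · rw [hq']
  -- First and second derivative tests for `r - R(v)` along every coordinate line through `u`: this
  -- function vanishes at `u` and is nonpositive on `U`.
  have key : ∀ ξ : Fin 2 → ℝ, dr (φ u) (dirVec φ u ξ) = ρ * dv (φ u) (dirVec φ u ξ) ∧
      dr (φ u) (accVec φ u ξ) + sig (φ u) (dirVec φ u ξ) (dirVec φ u ξ) / radius (φ u) -
      ((A' (1, ρ) * (2 * E) - A * (2 * E' (1, ρ))) / (2 * E) ^ 2 * dv (φ u) (dirVec φ u ξ) ^ 2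
        + ρ * (dv (φ u) (accVec φ u ξ)
          + sig (φ u) (dirVec φ u ξ) (dirVec φ u ξ) / radius (φ u))) ≤ 0 := by
    intro ξ
    set Y : ℝ → Event := fun s => φ (u + s • WithLp.toLp 2 ξ) with hY
    set Y' : ℝ → Event := fun s => dirVec φ (u + s • WithLp.toLp 2 ξ) ξ with hY'
    have e0 : u + (0 : ℝ) • WithLp.toLp 2 ξ = u := by simp
    have eY : Y 0 = φ u := by simp only [hY, e0]
    have eY' : Y' 0 = dirVec φ u ξ := by simp only [hY', e0]
    have d1 : ∀ᶠ s in 𝓝 0, HasDerivAt Y (Y' s) s := hasDerivAt_curve hU hφ hu ξ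
    have d2 : HasDerivAt Y' (accVec φ u ξ) 0 := hasDerivAt_dirVec hU hφ hu ξ
    have hYc : ContinuousAt Y 0 := d1.self_of_nhds.continuousAt
    have h0Y : (Y 0).2 ≠ 0 := by rwa [eY]
    have n0 : ∀ᶠ s in 𝓝 0, (Y s).2 ≠ 0 :=
      (continuous_snd.continuousAt.comp hYc).eventually_ne h0Y
    have hRY : ∀ᶠ s in 𝓝 0, HasDerivAt R (M.slope (advTime (Y s), R (advTime (Y s))))
        (advTime (Y s)) := by
      refine (continuous_advTime.continuousAt.comp hYc).tendsto.eventually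
        (p := fun v => HasDerivAt R (M.slope (v, R v)) v) ?_
      simpa [eY] using hR
    have D1 : ∀ᶠ s in 𝓝 0, HasDerivAt (fun s => radius (Y s) - R (advTime (Y s)))
        (dr (Y s) (Y' s) - M.slope (advTime (Y s), R (advTime (Y s))) * dv (Y s) (Y' s)) s := by
      filter_upwards [d1, n0, hRY] with s a1 a2 a3
      exact (hasDerivAt_radius a1 a2).sub (a3.comp s (hasDerivAt_advTime a1 a2))
    have c1 := hasDerivAt_dr d1.self_of_nhds d2 h0Y
    have c2 := hasDerivAt_dv d1.self_of_nhds d2 h0Y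
    have c3 := HasDerivAt.comp_of_eq (0 : ℝ) hslope (hasDerivAt_advTime d1.self_of_nhds h0Y)
      (by rw [eY])
    have D2 := c1.sub (c3.mul c2)
    have hmax : IsLocalMax (fun s => radius (Y s) - R (advTime (Y s))) 0 := by
      filter_upwards [eventually_mem_line hU hu (WithLp.toLp 2 ξ)] with s hs
      have := hsup _ hs
      simp only [eY, hR0, sub_self]
      linarith
    obtain ⟨r1, r2⟩ := second_deriv_nonpos D1 D2 hmax
    simp only [eY, eY', hq', Function.comp_apply] at r1 r2
    have hsl : M.slope (vr (φ u)) = ρ := rfl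
    rw [hsl] at r1 r2
    refine ⟨by linarith, le_trans (le_of_eq ?_) r2⟩
    ring
  -- The null normal of the cone, scaled so that `g(k, ·) = dr - ρ dv`.
  set k := radialVec (φ u) (1 / E) (A / (2 * E ^ 2)) with hk
  have kv : dv (φ u) k = 1 / E := dv_radialVec h0 _ _
  have kr : dr (φ u) k = A / (2 * E ^ 2) := dr_radialVec h0 _ _
  have ks : ∀ X, sig (φ u) k X = 0 := sig_radialVec h0 _ _
  have gk : ∀ X, M.g (φ u) k X = dr (φ u) X - ρ * dv (φ u) X := by
    intro X
    rw [g_eq, ks, kv, kr, ← hAdef, ← hEdef, hρ]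
    field_simp
    ring
  have hnull : M.IsFutureNull (φ u) k := by
    refine ⟨?_, Or.inl (by rw [kv]; positivity)⟩
    rw [gk, kv, kr, hρ]; field_simp; ring
  have hnorm : ∀ B : Fin 2, M.g (φ u) k (tangent φ u B) = 0 := by
    intro B
    have h1 : ∀ ξ, M.g (φ u) k (dirVec φ u ξ) = 0 := fun ξ => by
      rw [gk, (key ξ).1]; ring
    fin_cases B
    · simpa [dirVec] using h1 ![1, 0]
    · simpa [dirVec] using h1 ![0, 1]
  have hθ := htr.2 k hnull hnorm
  obtain ⟨ξ, η, f1, f2, f3, -⟩ := exists_frame htr.1 0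
  rw [bil_firstForm] at f1 f2 f3
  rw [expansion_eq hp h0 hA hE k f1 f2 f3] at hθ
  -- The bound `dr(k) / r` is the contribution of one unit direction to the expansion of the round
  -- cone itself. The difference of the two sides is exactly the second derivative controlled by
  -- `key`.
  have low : ∀ ξ, M.g (φ u) (dirVec φ u ξ) (dirVec φ u ξ) = 1 →
      A / (2 * E ^ 2) / radius (φ u) ≤ M.normalCurv φ u k ξ := by
    intro ξ hξ
    obtain ⟨k1, k2⟩ := key ξ
    have hσ : sig (φ u) (dirVec φ u ξ) (dirVec φ u ξ) = 1 := by
      rw [g_eq, k1, ← hAdef, ← hEdef, hρ] at hξ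
      rw [← hξ]; field_simp; ring
    rw [normalCurv, gk, christoffel_eq hp h0 hA hE, kv, kr, k1, hσ, ← hAdef, ← hEdef]
    rw [hσ] at k2
    simp only [clm_prod_apply A' 1 ρ, clm_prod_apply E' 1 ρ] at k2
    rw [clm_prod_apply A' _ (ρ * _), clm_prod_apply E' _ (ρ * _),
      clm_prod_apply A' (1 / E), clm_prod_apply E' (1 / E)]
    refine le_of_sub_nonneg (le_trans (neg_nonneg.2 k2) (le_of_eq ?_))
    rw [hρ]
    field_simp
    ring
  have l1 := low ξ f1
  have l2 := low η f2
  have : A / (2 * E ^ 2) / radius (φ u) < 0 := by linarith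
  rw [fval_eq, ← hAdef, ← hEdef]
  by_contra! hcon
  have h5 : 0 ≤ A / (2 * E ^ 2) / radius (φ u) := by
    have : A / (2 * E ^ 2) / radius (φ u) = A / E ^ 2 / (2 * radius (φ u)) := by field_simp
    rw [this]; positivity
  linarith

end SphSpacetime

/-! ### Light cones through a regular centre and the supporting curve. -/

namespace SphSpacetime
variable {M : SphSpacetime} {φ : Param → Event} {U : Set Param} {u : Param}

/-- The slope of the outgoing radial null rays, continued through the axis along the direction
`e`. -/
noncomputable def extSlope (M : SphSpacetime) (e : EuclideanSpace ℝ (Fin 3)) (q : ℝ × ℝ) : ℝ :=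
  -M.g (ray e q) (1, 0) (1, 0) /
    (2 * (-M.g (ray e q) (1, 0) (1, 0) + M.g (ray e q) (1, 0) (0, e)))

/-- The domain of regularity of `extSlope`. -/
def extDomain (M : SphSpacetime) (e : EuclideanSpace ℝ (Fin 3)) : Set (ℝ × ℝ) :=
  {q | ray e q ∈ M.carrier ∧
    0 < -M.g (ray e q) (1, 0) (1, 0) + M.g (ray e q) (1, 0) (0, e)}

lemma isOpen_extDomain (e : EuclideanSpace ℝ (Fin 3)) : IsOpen (M.extDomain e) := by
  have h1 : IsOpen (ray e ⁻¹' M.carrier) := M.isOpen_carrier.preimage (continuous_ray e)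
  have h2 : ContinuousOn (fun q => -M.g (ray e q) (1, 0) (1, 0) + M.g (ray e q) (1, 0) (0, e))
      (ray e ⁻¹' M.carrier) := fun q hq =>
    ((contDiffAt_g_ray (1, 0) (1, 0) hq).neg.add
      (contDiffAt_g_ray (1, 0) (0, e) hq)).continuousAt.continuousWithinAt
  exact h2.isOpen_inter_preimage h1 isOpen_Ioi

lemma contDiffOn_extSlope (e : EuclideanSpace ℝ (Fin 3)) :
    ContDiffOn ℝ 1 (M.extSlope e) (M.extDomain e) := by
  intro q hq
  have h1 := (contDiffAt_g_ray (M := M) (1, 0) (1, 0) hq.1).neg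
  have h2 := contDiffAt_g_ray (M := M) (1, 0) (0, e) hq.1
  exact (h1.div (contDiffAt_const.mul (h1.add h2)) (by have := hq.2; positivity)).contDiffWithinAt

lemma extSlope_eq {e : EuclideanSpace ℝ (Fin 3)} (he : ‖e‖ = 1) {q : ℝ × ℝ} (hq : 0 < q.2) :
    M.extSlope e q = M.slope q := by
  rw [extSlope, slope, g_time_time, g_time_ray he hq, vr_ray he hq.le]
  have h : - -M.lapse q + (M.expβ q - M.lapse q) = M.expβ q := by ring
  rw [h, neg_neg]

/-- At `r = 0` the quotient `2m/r` is zero by convention, which leaves `e^{2β}`. -/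
lemma lapse_axis (v : ℝ) : 0 < M.lapse (v, 0) := by simp [lapse, Real.exp_pos]

/-- At a regular centre the coefficient of `-dv²` is `1`. -/
lemma lapse_axis_eq_one {e : EuclideanSpace ℝ (Fin 3)} (he : ‖e‖ = 1) {v : ℝ}
    (hv : ray e (v, 0) ∈ M.carrier) : M.lapse (v, 0) = 1 := by
  have hc : ∀ X Y : Event, Tendsto (fun r : ℝ => M.g (ray e (v, r)) X Y) (𝓝[>] 0)
      (𝓝 (M.g (ray e (v, 0)) X Y)) := fun X Y => by
    have h1 := (contDiffAt_g_ray (M := M) X Y hv).continuousAt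
    have h2 : ContinuousAt (fun r : ℝ => (v, r)) 0 := by fun_prop
    exact (ContinuousAt.comp (g := fun q => M.g (ray e q) X Y) h1 h2).tendsto.mono_left
      nhdsWithin_le_nhds
  have l1 := (hc (1, 0) (1, 0)).neg
  have l2 := hc (1, 0) (0, e)
  have l3 := hc (0, e) (0, e)
  have a1 : M.g (ray e (v, 0)) (1, 0) (1, 0) = -M.lapse (v, 0) := by
    rw [g_time_time, vr_ray he le_rfl]
  have a2 : M.g (ray e (v, 0)) (1, 0) (0, e) = 0 := by simp [g_eq, dv, dr, sig, ray]
  have a3 : M.g (ray e (v, 0)) (0, e) (0, e) = 1 := by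
    simp [g_eq, dv, dr, sig, ray, he]
  rw [a1, neg_neg] at l1
  rw [a2] at l2
  rw [a3] at l3
  -- Off the axis `g(e, e) = 2E - A = A + 2(E - A)`, that is `-g(∂_t, ∂_t) + 2 g(∂_t, e)`; the axis
  -- values of the three components then force `A = 1`.
  have l4 := (l1.add (l2.const_mul 2)).add_const 0
  have l5 : Tendsto (fun r : ℝ => M.g (ray e (v, r)) (0, e) (0, e)) (𝓝[>] 0)
      (𝓝 (M.lapse (v, 0) + 2 * 0 + 0)) := by
    refine l4.congr' ?_
    filter_upwards [self_mem_nhdsWithin] with r hr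
    have hr : 0 < r := hr
    have h1 : dr (ray e (v, r)) (0, e) = 1 := by
      simp [dr, ray, norm_smul, he, abs_of_pos hr, inner_smul_left, hr.ne']
    rw [g_time_time, g_time_ray he hr, vr_ray he hr.le, g_eq, dv, sig, h1, vr_ray he hr.le]
    simp [he]; ring
  have := tendsto_nhds_unique l3 l5
  linarith

/-- Light has unit coordinate speed at the centre, so `r = t` and `v = t + r` give `dr/dv = 1/2`. -/
lemma extSlope_axis {e : EuclideanSpace ℝ (Fin 3)} (he : ‖e‖ = 1) {v : ℝ}
    (hv : ray e (v, 0) ∈ M.carrier) : M.extSlope e (v, 0) = 1 / 2 := by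
  have a1 : M.g (ray e (v, 0)) (1, 0) (1, 0) = -M.lapse (v, 0) := by
    rw [g_time_time, vr_ray he le_rfl]
  have a2 : M.g (ray e (v, 0)) (1, 0) (0, e) = 0 := by simp [g_eq, dv, dr, sig, ray]
  rw [extSlope, a1, a2, lapse_axis_eq_one he hv]; norm_num

/-- A spacelike surface is not supported from above by a light cone at its vertex. -/
lemma false_of_supported_axis (hU : IsOpen U) (hφ : ContDiffOn ℝ 3 φ U) (hu : u ∈ U)
    (h0 : (φ u).2 = 0) (hpd : (M.firstForm φ u).PosDef) {R : ℝ → ℝ}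
    (hR : HasDerivAt R (1 / 2) (advTime (φ u))) (hR0 : R (advTime (φ u)) = 0)
    (hsup : ∀ w ∈ U, radius (φ w) ≤ R (advTime (φ w))) : False := by
  set X := dirVec φ u ![1, 0] with hX
  have hg : 0 < M.g (φ u) X X := g_self_pos hpd (fun h => by simpa using congrFun h 0)
  have hdr : ∀ Y, dr (φ u) Y = 0 := fun Y => by simp [dr, h0]
  have hX2 : 0 < ‖X.2‖ := by
    rw [g_eq, dv, sig, hdr] at hg
    have hl : 0 < M.lapse (vr (φ u)) := by
      have : vr (φ u) = ((φ u).1, 0) := by simp [vr, advTime, radius, h0]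
      rw [this]; exact lapse_axis _
    by_contra! h
    have hx0 : X.2 = 0 := by simpa using h
    simp only [hx0, inner_zero_left] at hg
    nlinarith [mul_nonneg hl.le (mul_self_nonneg X.1)]
  set Y : ℝ → Event := fun s => φ (u + s • WithLp.toLp 2 ![1, 0]) with hY
  have eY : Y 0 = φ u := by simp [hY]
  have d1 : HasDerivAt Y X 0 := by
    have := (hasDerivAt_curve hU hφ hu ![1, 0]).self_of_nhds
    simpa [hX] using this
  have hx : HasDerivAt (fun s => (Y s).2) X.2 0 := hasDerivAt_snd d1
  -- One-sided derivatives of `r ≤ R(v)` in the directions `X` and `-X`: at the vertex `r` grows at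
  -- rate `‖X.2‖` both ways, so the inequality amounts to `‖X.2‖ ≤ σ * X.1`. The two signs together
  -- give `X.2 = 0`.
  have hfirst : ∀ σ : ℝ, |σ| = 1 → 1 * ‖X.2‖ ≤ 1 / 2 * (σ * X.1 + 1 * ‖X.2‖) := by
    intro σ hσ
    have hline : HasDerivAt (fun s : ℝ => σ * s) σ 0 := by
      simpa using (hasDerivAt_id (0 : ℝ)).const_mul σ
    have dσ : HasDerivAt (fun s => Y (σ * s)) (σ • X) 0 := by
      have := HasDerivAt.scomp_of_eq (0 : ℝ) d1 hline (by simp)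
      simpa [Function.comp_def] using this
    have t1 : Tendsto (fun s : ℝ => s⁻¹ • Y (σ * s) - s⁻¹ • Y 0) (𝓝[>] 0) (𝓝 (σ • X)) := by
      have := (hasDerivAt_iff_tendsto_slope_zero.1 dσ).mono_left
        (nhdsWithin_mono 0 (t := {0}ᶜ) (s := Ioi (0 : ℝ)) fun s hs => ne_of_gt hs)
      simpa [smul_sub] using this
    have t2 : Tendsto (fun s : ℝ => s⁻¹ * radius (Y (σ * s))) (𝓝[>] 0) (𝓝 (1 * ‖X.2‖)) := by
      have h1 := ((continuous_snd.tendsto _).comp t1).norm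
      have h2 : ‖(σ • X).2‖ = 1 * ‖X.2‖ := by simp [norm_smul, hσ]
      rw [h2] at h1
      refine h1.congr' ?_
      filter_upwards [self_mem_nhdsWithin] with s hs
      have hs : 0 < s := hs
      simp [eY, h0, radius, norm_smul, abs_of_pos hs]
    have t3 : Tendsto (fun s : ℝ => s⁻¹ * (advTime (Y (σ * s)) - advTime (φ u))) (𝓝[>] 0)
        (𝓝 (σ * X.1 + 1 * ‖X.2‖)) := by
      have h1 := ((continuous_fst.tendsto _).comp t1).add t2
      refine h1.congr fun s => ?_
      simp [eY, advTime, radius, h0]; ring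
    have cY : Tendsto (fun s : ℝ => Y (σ * s)) (𝓝[>] 0) (𝓝 (φ u)) := by
      have := dσ.continuousAt.tendsto
      simp only [mul_zero, eY] at this
      exact this.mono_left nhdsWithin_le_nhds
    have t4 : Tendsto (fun s : ℝ => s⁻¹ * R (advTime (Y (σ * s)))) (𝓝[>] 0)
        (𝓝 (1 / 2 * (σ * X.1 + 1 * ‖X.2‖))) := by
      have h1 : Tendsto (fun s => dslope R (advTime (φ u)) (advTime (Y (σ * s)))) (𝓝[>] 0)
          (𝓝 (1 / 2)) := by
        have hc : ContinuousAt (dslope R (advTime (φ u))) (advTime (φ u)) :=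
          continuousAt_dslope_same.2 hR.differentiableAt
        have h2 := hc.tendsto.comp ((continuous_advTime.tendsto _).comp cY)
        rw [dslope_same, hR.deriv] at h2
        exact h2
      refine (h1.mul t3).congr fun s => ?_
      have := sub_smul_dslope R (advTime (φ u)) (advTime (Y (σ * s)))
      rw [hR0, sub_zero, smul_eq_mul] at this
      rw [← this]; ring
    refine le_of_tendsto_of_tendsto t2 t4 ?_
    have hev : ∀ᶠ s : ℝ in 𝓝 0, u + s • WithLp.toLp 2 ![(1 : ℝ), 0] ∈ U :=
      eventually_mem_line hU hu _
    have hev2 : ∀ᶠ s : ℝ in 𝓝 0, u + (σ * s) • WithLp.toLp 2 ![(1 : ℝ), 0] ∈ U := by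
      have : Tendsto (fun s : ℝ => σ * s) (𝓝 0) (𝓝 0) := by
        simpa using hline.continuousAt.tendsto
      exact this.eventually hev
    filter_upwards [self_mem_nhdsWithin, nhdsWithin_le_nhds hev2] with s hs hsU
    have hs : 0 < s := hs
    exact mul_le_mul_of_nonneg_left (hsup _ hsU) (inv_nonneg.2 hs.le)
  have b1 := hfirst 1 (by simp)
  have b2 := hfirst (-1) (by simp)
  linarith

/-- Every closed f-trapped surface is supported from above by a curve `r = R(v)` in such a way
that it touches this curve in the region `r ≤ 2m`; the curve is an outgoing radial null ray, up
to a change of its slope by a nonnegative factor. -/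
theorem exists_supporting_curve {S : Set Event} (hS : M.IsClosedFTrapped S) :
    ∃ (R : ℝ → ℝ) (T : ℝ) (G : ℝ × ℝ → ℝ), (∀ p ∈ S, |advTime p| < T) ∧
      (∀ v ∈ Ioo (-T) T, HasDerivAt R (G (v, R v)) v) ∧
      (∀ p ∈ S, radius p ≤ R (advTime p)) ∧
      (∀ q : ℝ × ℝ, 0 < q.2 → (q ∈ M.spheres → 0 ≤ M.fval q) → 0 ≤ G q) ∧
      ∃ p ∈ S, p ∈ M.Z ∧ radius p = R (advTime p) := by
  obtain ⟨hSc, hcomp, hconn, hch⟩ := hS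
  obtain ⟨e, he⟩ := exists_unit
  have hray : ∀ p ∈ S, ray e (vr p) ∈ M.carrier := fun p hp =>
    mem_carrier_of_norm_eq (hSc hp) (by simp [ray, vr, advTime, radius])
      (by simp [ray, vr, radius, norm_smul, he])
  have hr0 : ∀ p : Event, 0 ≤ radius p := fun p => norm_nonneg _
  have hKO : vr '' S ⊆ M.extDomain e := by
    rintro _ ⟨p, hp, rfl⟩
    refine ⟨hray p hp, ?_⟩
    rcases (hr0 p).eq_or_lt with h | h
    · have hq : vr p = (advTime p, 0) := by rw [vr, ← h]
      rw [hq]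
      have a2 : M.g (ray e (advTime p, 0)) (1, 0) (0, e) = 0 := by simp [g_eq, dv, dr, sig, ray]
      rw [a2, g_time_time, vr_ray he le_rfl, neg_neg, add_zero]
      exact lapse_axis _
    · rw [g_time_time, g_time_ray he h, vr_ray he h.le]
      have := M.expβ_pos (vr p)
      linarith
  have hKc : IsCompact (vr '' S) := hcomp.image continuous_vr
  obtain ⟨χ, hG, hGc, hχ0, hχO, hχ1⟩ := exists_cutoff (isOpen_extDomain e)
    (contDiffOn_extSlope e) hKc hKO
  obtain ⟨R, T, hT, hR, hsup, q, ⟨p, hp, rfl⟩, hpR⟩ :=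
    exists_supporting_solution hG hGc hKc (hconn.nonempty.image _)
  have hpR : radius p = R (advTime p) := hpR
  refine ⟨R, T, fun q => χ q * M.extSlope e q, fun p hp => hT _ (mem_image_of_mem _ hp), hR,
    fun p hp => hsup _ (mem_image_of_mem _ hp), fun q hq hf => ?_, p, hp, ?_, hpR⟩
  · by_cases hqO : q ∈ M.extDomain e
    · refine mul_nonneg (hχ0 q) ?_
      rw [extSlope_eq he hq, slope, lapse_eq]
      have := hf ((mem_spheres_iff he).2 ⟨hq, hqO.1⟩)
      have := M.expβ_pos q
      positivity
    · simp [hχO q hqO]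
  obtain ⟨φ, U, u, hchart, hu, rfl, htr⟩ := hch p hp
  obtain ⟨hUo, hφ, -, -, W, -, hW⟩ := hchart
  have hsup' : ∀ w ∈ U, radius (φ w) ≤ R (advTime (φ w)) := fun w hw =>
    hsup _ (mem_image_of_mem _ (hW.subset (mem_image_of_mem φ hw)).1)
  have hTp : advTime (φ u) ∈ Ioo (-T) T := abs_lt.1 (hT _ (mem_image_of_mem _ hp))
  have hq : (advTime (φ u), R (advTime (φ u))) = vr (φ u) := by rw [← hpR]; rfl
  -- The cut-off is `1` near the contact point, so there the supporting curve is a genuine null ray.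
  have hχu := hχ1 _ (mem_image_of_mem vr hp)
  by_cases h0 : (φ u).2 = 0
  · exfalso
    have hvr : vr (φ u) = (advTime (φ u), 0) := by simp [vr, radius, h0]
    refine false_of_supported_axis hUo hφ hu h0 htr.1 (R := R) ?_ ?_ hsup'
    · have := hR _ hTp
      rw [hq, hχu.self_of_nhds, hvr, extSlope_axis he (by rw [← hvr]; exact hray _ hp)] at this
      simpa using this
    · rw [← hpR]; simp [radius, h0]
  · have hpos := radius_pos.2 h0
    refine mem_Z_iff.2 ⟨hSc hp, hpos, (fval_neg_of_supported hUo hφ hu (hSc hp) h0 htr (R := R)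
      ?_ hpR hsup').le⟩
    have hRc : ContinuousAt (fun v => (v, R v)) (advTime (φ u)) :=
      continuousAt_id.prodMk (hR _ hTp).continuousAt
    have e1 : ∀ᶠ v in 𝓝 (advTime (φ u)), χ (v, R v) = 1 :=
      hRc.tendsto.eventually (p := fun q => χ q = 1) (by rw [hq]; exact hχu)
    have e2 : ∀ᶠ v in 𝓝 (advTime (φ u)), 0 < R v :=
      (hR _ hTp).continuousAt.eventually (lt_mem_nhds (by rw [← hpR]; exact hpos))
    filter_upwards [e1, e2, Ioo_mem_nhds hTp.1 hTp.2] with v h1 h2 h3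
    have := hR v h3
    rwa [h1, one_mul, extSlope_eq he h2] at this

end SphSpacetime

/-! ### Null expansions of axially symmetric graphs. -/

/-- The cosine of the angle between `e` and the position vector of an event. -/
noncomputable def cosE (e : E3) (p : Event) : ℝ := inner ℝ e p.2 / ‖p.2‖

/-- The differential of `cosE`. -/
noncomputable def dcos (e : E3) (p X : Event) : ℝ := (inner ℝ e X.2 - cosE e p * dr p X) / ‖p.2‖

lemma dcos_add (e : E3) (p X Y : Event) : dcos e p (X + Y) = dcos e p X + dcos e p Y := by
  simp only [dcos, dr_add, Prod.snd_add, inner_add_right]; ring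

lemma dcos_smul (e : E3) (p X : Event) (c : ℝ) : dcos e p (c • X) = c * dcos e p X := by
  simp only [dcos, dr_smul, Prod.smul_snd, inner_smul_right]; ring

lemma hasDerivAt_cosE (e : E3) {Y : ℝ → Event} {X : Event} {s : ℝ} (hY : HasDerivAt Y X s)
    (h0 : (Y s).2 ≠ 0) : HasDerivAt (fun t => cosE e (Y t)) (dcos e (Y s) X) s := by
  have h1 : HasDerivAt (fun t => inner ℝ e (Y t).2) _ s :=
    (hasDerivAt_const s e).inner ℝ (hasDerivAt_snd hY)
  have hn : ‖(Y s).2‖ ≠ 0 := by simpa using h0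
  refine (h1.div (hasDerivAt_radius hY h0) hn).congr_deriv ?_
  simp only [dcos, cosE, radius, inner_zero_left]
  field_simp
  ring

lemma hasDerivAt_dcos (e : E3) {Y Y' : ℝ → Event} {X' : Event} {s : ℝ}
    (hY : HasDerivAt Y (Y' s) s) (hY' : HasDerivAt Y' X' s) (h0 : (Y s).2 ≠ 0) :
    HasDerivAt (fun t => dcos e (Y t) (Y' t))
      (dcos e (Y s) X' - 2 * dcos e (Y s) (Y' s) * dr (Y s) (Y' s) / radius (Y s)
        - cosE e (Y s) * sig (Y s) (Y' s) (Y' s) / radius (Y s) ^ 2) s := by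
  have h1 : HasDerivAt (fun t => inner ℝ e (Y' t).2) _ s :=
    (hasDerivAt_const s e).inner ℝ (hasDerivAt_snd hY')
  have hn : ‖(Y s).2‖ ≠ 0 := by simpa using h0
  have h2 := (h1.sub ((hasDerivAt_cosE e hY h0).mul (hasDerivAt_dr hY hY' h0))).div
    (hasDerivAt_radius hY h0) hn
  refine h2.congr_deriv ?_
  simp only [dcos, radius, inner_zero_left, Pi.sub_apply, Pi.mul_apply]
  field_simp
  ring

/-- A unit vector spanning the orthogonal complement of two orthonormal vectors. -/
lemma exists_third {n a : E3} (hn : ‖n‖ = 1) (ha : ‖a‖ = 1) (hna : inner ℝ n a = 0) :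
    ∃ m : E3, ‖m‖ = 1 ∧ inner ℝ n m = 0 ∧ inner ℝ a m = 0 ∧
      ∀ z : E3, inner ℝ n z = 0 → inner ℝ a z = 0 → z = (inner ℝ m z : ℝ) • m := by
  have ho : Orthonormal ℝ (({0, 1} : Set (Fin 3)).domRestrict ![n, a, 0]) := by
    constructor
    · rintro ⟨i, hi | hi⟩ <;> subst hi <;> simp [hn, ha]
    · rintro ⟨i, hi | hi⟩ ⟨j, hj | hj⟩ hij <;> subst hi <;> subst hj <;>
        simp_all [real_inner_comm]
  obtain ⟨b, hb⟩ := ho.exists_orthonormalBasis_extension_of_card_eq (by simp)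
  have b0 : b 0 = n := by simpa using hb 0 (by simp)
  have b1 : b 1 = a := by simpa using hb 1 (by simp)
  have hno := b.orthonormal
  refine ⟨b 2, hno.1 2, ?_, ?_, fun z h1 h2 => ?_⟩
  · rw [← b0]; exact hno.2 (by decide)
  · rw [← b1]; exact hno.2 (by decide)
  · have := b.sum_repr' z
    rw [Fin.sum_univ_three, b0, b1, h1, h2] at this
    simpa using this.symm

/-- The factor by which the graph deviates from being isometric to a round sphere. -/
noncomputable def graphStretch (A E r c h1 y1 : ℝ) : ℝ :=
  (1 - c ^ 2) / r ^ 2 * (2 * E * y1 * h1 - A * y1 ^ 2)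

/-- The coefficient of the outgoing part of the null expansion of a graph. -/
noncomputable def outCoef (A E Av Ar Ev Er r c h1 h2 y1 y2 : ℝ) : ℝ :=
  A * (2 + graphStretch A E r c h1 y1) / (2 * E * r)
    + (-A * y1 / 2 + E * h1) * c * (2 + graphStretch A E r c h1 y1) / r ^ 2
    - (-A * y2 / 2 + E * h2) * (1 - c ^ 2) / r ^ 2
    + 2 * (-A * y1 / 2 + E * h1) * (1 - c ^ 2) * h1 / r ^ 3
    + (1 - c ^ 2) / r ^ 2 * ((Av * y1 + Ar * h1) * y1 - (Ev * y1 + Er * h1) * h1 - Av * y1 ^ 2 / 2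
      + Ev * y1 * h1 + (-(Ev * y1 + Er * h1) * y1 - Ar * y1 ^ 2 / 2 + Er * y1 * h1) * A / (2 * E))

/-- The coefficient of the ingoing part of the null expansion of a graph. -/
noncomputable def inCoef (A E Ar Ev Er r c h1 y1 y2 : ℝ) : ℝ :=
  (2 + graphStretch A E r c h1 y1) / r
    + E * y1 * c * (2 + graphStretch A E r c h1 y1) / r ^ 2 - E * y2 * (1 - c ^ 2) / r ^ 2
    + 2 * E * y1 * (1 - c ^ 2) * h1 / r ^ 3
    + (1 - c ^ 2) / r ^ 2 * (-(Ev * y1 + Er * h1) * y1 - Ar * y1 ^ 2 / 2 + Er * y1 * h1)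

lemma norm_sub_cos_sq {e : E3} (he : ‖e‖ = 1) {p : Event} (h0 : p.2 ≠ 0) :
    ‖e - (cosE e p / ‖p.2‖) • p.2‖ ^ 2 = 1 - cosE e p ^ 2 := by
  have hn : ‖p.2‖ ≠ 0 := by simpa using h0
  rw [norm_sub_sq_real, he, inner_smul_right, norm_smul, norm_div, norm_norm, Real.norm_eq_abs,
    mul_pow, div_pow, sq_abs]
  simp only [cosE]
  field_simp
  ring

/-- The angular part of a vector. -/
noncomputable def angPart (p X : Event) : E3 := X.2 - (dr p X / ‖p.2‖) • p.2

lemma inner_angPart {p : Event} (h0 : p.2 ≠ 0) (X Y : Event) :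
    inner ℝ (angPart p X) Y.2 = sig p X Y := by
  have hn : ‖p.2‖ ≠ 0 := by simpa using h0
  rw [angPart, inner_sub_left, inner_smul_left, sig]
  simp only [dr]
  simp
  ring

lemma inner_radial_angPart {p : Event} (h0 : p.2 ≠ 0) (X : Event) :
    inner ℝ p.2 (angPart p X) = 0 := by
  have hn : ‖p.2‖ ≠ 0 := by simpa using h0
  rw [angPart, inner_sub_right, inner_smul_right, real_inner_self_eq_norm_sq]
  simp only [dr]
  field_simp
  ring

lemma inner_angPart_angPart {p : Event} (h0 : p.2 ≠ 0) (X Y : Event) :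
    inner ℝ (angPart p X) (angPart p Y) = sig p X Y := by
  conv_lhs => rw [angPart.eq_def p Y]
  rw [inner_sub_right, inner_angPart h0, inner_smul_right, real_inner_comm,
    inner_radial_angPart h0, mul_zero, sub_zero]

lemma inner_cos_right {e : E3} {p : Event} (X : Event) :
    inner ℝ (e - (cosE e p / ‖p.2‖) • p.2) X.2 = inner ℝ e X.2 - cosE e p * dr p X := by
  rw [inner_sub_left, inner_smul_left]
  simp only [dr]
  simp
  ring

lemma inner_cos_radial {e : E3} {p : Event} (h0 : p.2 ≠ 0) :
    inner ℝ p.2 (e - (cosE e p / ‖p.2‖) • p.2) = 0 := by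
  have hn : ‖p.2‖ ≠ 0 := by simpa using h0
  rw [inner_sub_right, inner_smul_right, real_inner_self_eq_norm_sq, real_inner_comm]
  simp only [cosE]
  field_simp
  ring

/-- Cauchy–Schwarz between the angular part of `X` and the projection of `e` orthogonal to the
radius, whose squared length is `1 - c²`. -/
lemma dcos_sq_le {e : E3} (he : ‖e‖ = 1) {p : Event} (h0 : p.2 ≠ 0) (X : Event) :
    dcos e p X ^ 2 ≤ (1 - cosE e p ^ 2) / radius p ^ 2 * sig p X X := by
  have hn : 0 < ‖p.2‖ := by simpa using h0
  set τ := e - (cosE e p / ‖p.2‖) • p.2 with hτ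
  have h1 : dcos e p X = inner ℝ τ (angPart p X) / ‖p.2‖ := by
    rw [dcos, angPart, inner_sub_right, inner_cos_right, inner_smul_right,
      real_inner_comm p.2 τ, inner_cos_radial h0]
    simp
  have h2 := real_inner_mul_inner_self_le τ (angPart p X)
  rw [real_inner_self_eq_norm_sq, norm_sub_cos_sq he h0, inner_angPart_angPart h0] at h2
  rw [h1, div_pow, radius, div_mul_eq_mul_div]
  gcongr
  linarith

lemma sig_self {p : Event} (h0 : p.2 ≠ 0) (X : Event) : sig p X X = ‖angPart p X‖ ^ 2 := by
  rw [← inner_angPart_angPart h0, real_inner_self_eq_norm_sq]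

lemma eq_zero_of_components {p : Event} (h0 : p.2 ≠ 0) {X : Event} (h1 : dv p X = 0)
    (h2 : dr p X = 0) (h3 : sig p X X = 0) : X = 0 := by
  rw [sig_self h0] at h3
  have h4 : angPart p X = 0 := by simpa using h3
  rw [angPart, h2] at h4
  rw [dv, h2] at h1
  ext1
  · simpa using h1
  · simpa using h4

namespace SphSpacetime
variable {M : SphSpacetime} {φ : Param → Event} {U : Set Param} {u : Param}

/-- First and second derivatives of the coordinates along the graph `r = h(c)`, `v = y(c)`. -/
lemma graph_derivs (hU : IsOpen U) (hφ : ContDiffOn ℝ 3 φ U) (hu : u ∈ U)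
    (h0 : (φ u).2 ≠ 0) {e : E3} {F : Event → ℝ} {DF : Event → Event → ℝ} {h h' h'' : ℝ → ℝ}
    (hh : ∀ x, HasDerivAt h (h' x) x) (hh' : ∀ x, HasDerivAt h' (h'' x) x)
    (hF : ∀ (Y : ℝ → Event) (X : Event) (s : ℝ), HasDerivAt Y X s → (Y s).2 ≠ 0 →
      HasDerivAt (fun t => F (Y t)) (DF (Y s) X) s)
    (hDF : ∀ (Y Y' : ℝ → Event) (X X' : Event) (s : ℝ), HasDerivAt Y X s → HasDerivAt Y' X' s →
      (Y s).2 ≠ 0 → HasDerivAt (fun t => DF (Y t) (Y' t))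
        (DF (Y s) X' + sig (Y s) X (Y' s) / radius (Y s)) s)
    (hgr : ∀ w ∈ U, F (φ w) = h (cosE e (φ w))) (ξ : Fin 2 → ℝ) :
    DF (φ u) (dirVec φ u ξ) = h' (cosE e (φ u)) * dcos e (φ u) (dirVec φ u ξ) ∧
    DF (φ u) (accVec φ u ξ) + sig (φ u) (dirVec φ u ξ) (dirVec φ u ξ) / radius (φ u) =
      h'' (cosE e (φ u)) * dcos e (φ u) (dirVec φ u ξ) ^ 2 + h' (cosE e (φ u)) *
      (dcos e (φ u) (accVec φ u ξ)
        - 2 * dcos e (φ u) (dirVec φ u ξ) * dr (φ u) (dirVec φ u ξ) / radius (φ u)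
        - cosE e (φ u) * sig (φ u) (dirVec φ u ξ) (dirVec φ u ξ) / radius (φ u) ^ 2) := by
  set Y : ℝ → Event := fun s => φ (u + s • WithLp.toLp 2 ξ) with hY
  set Y' : ℝ → Event := fun s => dirVec φ (u + s • WithLp.toLp 2 ξ) ξ with hY'
  have e0 : u + (0 : ℝ) • WithLp.toLp 2 ξ = u := by simp
  have eY : Y 0 = φ u := by simp only [hY, e0]
  have eY' : Y' 0 = dirVec φ u ξ := by simp only [hY', e0]
  have d1 : ∀ᶠ s in 𝓝 0, HasDerivAt Y (Y' s) s := hasDerivAt_curve hU hφ hu ξ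
  have d2 : HasDerivAt Y' (accVec φ u ξ) 0 := hasDerivAt_dirVec hU hφ hu ξ
  have h0Y : (Y 0).2 ≠ 0 := by rwa [eY]
  have n0 : ∀ᶠ s in 𝓝 0, (Y s).2 ≠ 0 :=
    (continuous_snd.continuousAt.comp d1.self_of_nhds.continuousAt).eventually_ne h0Y
  have hUs : ∀ᶠ s : ℝ in 𝓝 0, u + s • WithLp.toLp 2 ξ ∈ U := eventually_mem_line hU hu _
  -- The first order relation holds at all nearby parameters, so it can be differentiated once more.
  have first : ∀ᶠ s in 𝓝 0, DF (Y s) (Y' s) = h' (cosE e (Y s)) * dcos e (Y s) (Y' s) := by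
    filter_upwards [d1, n0, hUs.eventually_nhds] with s a1 a2 a3
    have b1 := hF Y (Y' s) s a1 a2
    have b2 := (hh (cosE e (Y s))).comp s (hasDerivAt_cosE e a1 a2)
    refine b1.unique (b2.congr_of_eventuallyEq ?_)
    filter_upwards [a3] with t ht using hgr _ ht
  have c1 := hDF Y Y' _ _ 0 d1.self_of_nhds d2 h0Y
  have c2 := ((hh' (cosE e (Y 0))).comp (0 : ℝ) (hasDerivAt_cosE e d1.self_of_nhds h0Y)).mul
    (hasDerivAt_dcos e d1.self_of_nhds d2 h0Y)
  have second := c1.unique (c2.congr_of_eventuallyEq first)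
  have first0 := first.self_of_nhds
  simp only [eY, eY', Function.comp_apply] at first0 second
  exact ⟨first0, by rw [second]; ring⟩

set_option maxHeartbeats 2000000 in
/-- A criterion for a rotationally symmetric graph `r = h(c)`, `v = y(c)` to be f-trapped. -/
theorem isFTrappedAt_of_graph (hU : IsOpen U) (hφ : ContDiffOn ℝ 3 φ U) (hu : u ∈ U)
    (hinj : Function.Injective (fderiv ℝ φ u))
    (hp : φ u ∈ M.carrier) (h0 : (φ u).2 ≠ 0) {e : E3} (he : ‖e‖ = 1)
    {h h' h'' y y' y'' : ℝ → ℝ}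
    (hh : ∀ x, HasDerivAt h (h' x) x) (hh' : ∀ x, HasDerivAt h' (h'' x) x)
    (hy : ∀ x, HasDerivAt y (y' x) x) (hy' : ∀ x, HasDerivAt y' (y'' x) x)
    (hgr : ∀ w ∈ U, radius (φ w) = h (cosE e (φ w)))
    (hgv : ∀ w ∈ U, advTime (φ w) = y (cosE e (φ w)))
    {q : ℝ × ℝ} (hq : vr (φ u) = q) {c : ℝ} (hc : cosE e (φ u) = c)
    (hstretch : 0 < 1 + graphStretch (M.lapse q) (M.expβ q) q.2 c (h' c) (y' c))
    (hout : outCoef (M.lapse q) (M.expβ q) (fderiv ℝ M.lapse q (1, 0)) (fderiv ℝ M.lapse q (0, 1))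
      (fderiv ℝ M.expβ q (1, 0)) (fderiv ℝ M.expβ q (0, 1)) q.2 c (h' c) (h'' c) (y' c) (y'' c) < 0)
    (hin : 0 < inCoef (M.lapse q) (M.expβ q) (fderiv ℝ M.lapse q (0, 1))
      (fderiv ℝ M.expβ q (1, 0)) (fderiv ℝ M.expβ q (0, 1)) q.2 c (h' c) (y' c) (y'' c)) :
    M.IsFTrappedAt φ u := by
  have hr : 0 < radius (φ u) := radius_pos.2 h0
  have hsph : vr (φ u) ∈ M.spheres := (vr_mem_spheres hr).2 hp
  have hA := hasFDerivAt_lapse hsph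
  have hE := hasFDerivAt_expβ hsph
  have hEpos := M.expβ_pos (vr (φ u))
  have K1 := graph_derivs hU hφ hu h0 hh hh' (F := radius) (DF := dr)
    (fun _ _ _ a b => hasDerivAt_radius a b) (fun _ _ _ _ _ a b d => hasDerivAt_dr a b d) hgr
  have K2 := graph_derivs hU hφ hu h0 hy hy' (F := advTime) (DF := dv)
    (fun _ _ _ a b => hasDerivAt_advTime a b) (fun _ _ _ _ _ a b d => hasDerivAt_dv a b d) hgv
  rw [hc] at K1 K2
  have hq2 : radius (φ u) = q.2 := by rw [← hq]; rfl
  rw [hq] at hA hE hEpos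
  rw [hq2] at hr K1 K2
  set A := M.lapse q with hAdef
  set E := M.expβ q with hEdef
  set A' := fderiv ℝ M.lapse q
  set E' := fderiv ℝ M.expβ q
  set r := q.2
  set h1 := h' c
  set h2 := h'' c
  set y1 := y' c
  set y2 := y'' c
  have hgX : ∀ ξ, M.g (φ u) (dirVec φ u ξ) (dirVec φ u ξ) =
      sig (φ u) (dirVec φ u ξ) (dirVec φ u ξ) +
      (2 * E * y1 * h1 - A * y1 ^ 2) * dcos e (φ u) (dirVec φ u ξ) ^ 2 := by
    intro ξ
    rw [g_eq, hq, (K1 ξ).1, (K2 ξ).1]; ring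
  have hpd : (M.firstForm φ u).PosDef := by
    refine posDef_of_pos fun ξ hξ => ?_
    have hX : dirVec φ u ξ ≠ 0 := by
      intro hX0
      rw [← fderiv_toLp] at hX0
      have := hinj (hX0.trans (map_zero _).symm)
      exact hξ (by simpa using this)
    have hσ0 : 0 ≤ sig (φ u) (dirVec φ u ξ) (dirVec φ u ξ) := by
      rw [sig_self h0]; positivity
    have hle := dcos_sq_le he h0 (dirVec φ u ξ)
    rw [hc, hq2] at hle
    have hσ : 0 < sig (φ u) (dirVec φ u ξ) (dirVec φ u ξ) := by
      refine lt_of_le_of_ne hσ0 fun hz => hX ?_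
      rw [← hz, mul_zero] at hle
      have hz' : dcos e (φ u) (dirVec φ u ξ) = 0 := by
        have := le_antisymm hle (sq_nonneg _); simpa using this
      refine eq_zero_of_components h0 ?_ ?_ hz.symm
      · rw [(K2 ξ).1, hz', mul_zero]
      · rw [(K1 ξ).1, hz', mul_zero]
    rw [hgX]
    rcases le_total 0 (2 * E * y1 * h1 - A * y1 ^ 2) with hB | hB
    · positivity
    · have h3 := mul_le_mul_of_nonpos_left hle hB
      have h4 := mul_pos hσ hstretch
      rw [graphStretch] at h4
      refine lt_of_lt_of_le h4 ?_
      linarith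
  refine ⟨hpd, fun k hk hkn => ?_⟩
  -- The first frame vector is tangent to a circle of latitude: `c`, and with it `r` and `v`, is
  -- stationary along it.
  obtain ⟨ξ, η, f1, f2, f3, f4⟩ := exists_frame hpd (fun B => dcos e (φ u) (tangent φ u B))
  rw [bil_firstForm] at f1 f2 f3
  rw [expansion_eq hp h0 (hq ▸ hA) (hq ▸ hE) k f1 f2 f3]
  have hkX : ∀ ξ, M.g (φ u) k (dirVec φ u ξ) = 0 := fun ξ => by
    rw [dirVec, g_add_right, g_smul_right, g_smul_right, hkn, hkn]; ring
  have hcX1 : dcos e (φ u) (dirVec φ u ξ) = 0 := by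
    rw [dirVec, dcos_add, dcos_smul, dcos_smul]; linarith
  obtain ⟨p1, p2⟩ := K1 ξ
  obtain ⟨p3, p4⟩ := K2 ξ
  obtain ⟨p5, p6⟩ := K1 η
  obtain ⟨p7, p8⟩ := K2 η
  have gX1 := hgX ξ
  have gX2 := hgX η
  have kX1 := hkX ξ
  have kX2 := hkX η
  rw [hcX1, mul_zero] at p1 p3
  rw [f1, hcX1] at gX1
  rw [f2] at gX2
  set X1 := dirVec φ u ξ
  set X2 := dirVec φ u η
  set c2 := dcos e (φ u) X2 with hc2
  set kv := dv (φ u) k with hkv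
  set kr := dr (φ u) k with hkr
  have σ1 : sig (φ u) X1 X1 = 1 := by linarith
  have σ12 : sig (φ u) X1 X2 = 0 := by
    rw [g_eq, p1, p3] at f3; linarith
  have σk1 : sig (φ u) X1 k = 0 := by
    rw [g_eq, p1, p3] at kX1; rw [sig_comm]; linarith
  have hn : ‖(φ u).2‖ ≠ 0 := by simpa using h0
  have hnr : ‖(φ u).2‖ = r := hq2
  -- The meridian direction `m`: the angular parts of `X2` and `k`, and the projection `τ` of `e`,
  -- are all multiples of it.
  obtain ⟨m, m1, m2, m3, m4⟩ := exists_third (n := ‖(φ u).2‖⁻¹ • (φ u).2)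
    (a := angPart (φ u) X1) (by simp [norm_smul, hn])
    (by
      have := sig_self h0 X1
      rw [σ1] at this
      nlinarith [norm_nonneg (angPart (φ u) X1)])
    (by rw [inner_smul_left, inner_radial_angPart h0, mul_zero])
  have hang : ∀ X : Event, sig (φ u) X1 X = 0 →
      angPart (φ u) X = (inner ℝ m (angPart (φ u) X) : ℝ) • m := fun X hX =>
    m4 _ (by rw [inner_smul_left, inner_radial_angPart h0, mul_zero])
      (by rw [inner_angPart_angPart h0, hX])
  set τ := e - (cosE e (φ u) / ‖(φ u).2‖) • (φ u).2 with hτ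
  have hτ1 : inner ℝ (angPart (φ u) X1) τ = 0 := by
    rw [angPart, p1, zero_div, zero_smul, sub_zero, real_inner_comm, hτ, inner_cos_right]
    have := hcX1
    rw [dcos, div_eq_zero_iff] at this
    exact this.resolve_right hn
  have hτm := m4 τ (by rw [inner_smul_left, inner_cos_radial h0, mul_zero]) hτ1
  set t := (inner ℝ m τ : ℝ) with ht
  set x := (inner ℝ m (angPart (φ u) X2) : ℝ) with hx
  set κ := (inner ℝ m (angPart (φ u) k) : ℝ) with hκ
  have hX2m := hang X2 σ12
  have hkm := hang k σk1
  have hmm : inner ℝ m m = (1 : ℝ) := by rw [real_inner_self_eq_norm_sq, m1]; norm_num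
  have ht2 : t ^ 2 = 1 - c ^ 2 := by
    rw [← hc, ← norm_sub_cos_sq he h0, ← hτ, hτm, norm_smul, m1]; simp
  have σ2 : sig (φ u) X2 X2 = x ^ 2 := by
    rw [← inner_angPart_angPart h0, hX2m, inner_smul_left, inner_smul_right, hmm]; simp; ring
  have σk : ∀ Z, sig (φ u) k Z = κ * inner ℝ m Z.2 := fun Z => by
    rw [← inner_angPart h0, hkm, inner_smul_left, conj_trivial]
  have σkk : sig (φ u) k k = κ ^ 2 := by
    rw [← inner_angPart_angPart h0, hkm, inner_smul_left, inner_smul_right, hmm]; simp; ring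
  have dcosm : ∀ Z, dcos e (φ u) Z = t * inner ℝ m Z.2 / r := fun Z => by
    rw [dcos, ← inner_cos_right, ← hτ, hτm, inner_smul_left, hnr]; simp
  have mX2 : inner ℝ m X2.2 = x := by
    rw [hx, angPart, inner_sub_right, inner_smul_right]
    have : inner ℝ m (φ u).2 = (0 : ℝ) := by
      rw [inner_smul_left] at m2
      rw [real_inner_comm]
      rcases mul_eq_zero.1 m2 with h | h
      · simp [h0] at h
      · exact h
    rw [this]; ring
  have hc2' : c2 = t * x / r := by rw [hc2, dcosm, mX2]
  set a := -A * kv + E * kr with ha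
  set b := E * kv with hb
  have hgk : ∀ Z, M.g (φ u) k Z = a * dv (φ u) Z + b * dr (φ u) Z + sig (φ u) k Z := fun Z => by
    rw [g_eq, hq]; ring
  have hx0 : x ≠ 0 := by
    intro hx0
    rw [σ2, hc2', hx0] at gX2
    norm_num at gX2
  have hnorm : (a * y1 + b * h1) * t / r + κ = 0 := by
    have h3 := kX2
    rw [hgk, p5, p7, σk, mX2, hc2'] at h3
    have h4 : x * ((a * y1 + b * h1) * t / r + κ) = 0 := by rw [← h3]; ring
    exact (mul_eq_zero.1 h4).resolve_left hx0
  -- Both terms depend on `Z` only through `⟨m, Z.2⟩`, so normality to the surface gives the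
  -- identity for every vector. Applied to the accelerations, it removes the parts of them that the
  -- graph equations do not determine.
  have hN : ∀ Z, (a * y1 + b * h1) * dcos e (φ u) Z + sig (φ u) k Z = 0 := fun Z => by
    rw [dcosm, σk]
    linear_combination (inner ℝ m Z.2 : ℝ) * hnorm
  have hnull : -A * kv ^ 2 + 2 * E * kv * kr + κ ^ 2 = 0 := by
    have h3 := hk.1
    rw [hgk, σkk] at h3
    linear_combination h3
  set μ := graphStretch A E r c h1 y1 with hμ
  have hx2 : x ^ 2 * (1 + μ) = 1 := by
    rw [σ2, hc2'] at gX2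
    rw [hμ, graphStretch, ← ht2]
    linear_combination -gX2
  have n1 : M.normalCurv φ u k ξ = kr / r + (a * y1 + b * h1) * c / r ^ 2 := by
    have h3 := hN (accVec φ u ξ)
    rw [normalCurv, hgk, christoffel_eq hp h0 (hq ▸ hA) (hq ▸ hE), hq, hq2, p1, p3, σ1]
    rw [σ1, hcX1, p1] at p2 p4
    have z0 : A' (0, 0) = 0 := map_zero A'
    have z0' : E' (0, 0) = 0 := map_zero E'
    rw [z0, z0']
    linear_combination (-a) * p4 - b * p2 - h3
  have n2 : M.normalCurv φ u k η = x ^ 2 * (kr / r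
      - (a * y2 + b * h2) * t ^ 2 / r ^ 2
      + (a * y1 + b * h1) * (c + 2 * t ^ 2 * h1 / r) / r ^ 2
      + t ^ 2 / r ^ 2 * (kv * ((A' (1, 0) * y1 + A' (0, 1) * h1) * y1
        - (E' (1, 0) * y1 + E' (0, 1) * h1) * h1 - A' (1, 0) * y1 ^ 2 / 2
        + E' (1, 0) * y1 * h1) + kr * (-(E' (1, 0) * y1 + E' (0, 1) * h1) * y1
          - A' (0, 1) * y1 ^ 2 / 2 + E' (0, 1) * y1 * h1))) := by
    have h3 := hN (accVec φ u η)
    rw [normalCurv, hgk, christoffel_eq hp h0 (hq ▸ hA) (hq ▸ hE), hq, hq2, p5, p7, σ2]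
    rw [σ2, p5] at p6 p8
    rw [clm_prod_apply A' (_ * _), clm_prod_apply E' (_ * _), clm_prod_apply A' (dv _ _),
      clm_prod_apply E' (dv _ _)]
    have e1 := p6
    have e2 := p8
    rw [hc2'] at e1 e2 ⊢
    linear_combination (-a) * e2 - b * e1 - h3
  have hx2pos : 0 < x ^ 2 := by positivity
  set α := outCoef A E (A' (1, 0)) (A' (0, 1)) (E' (1, 0)) (E' (0, 1)) r c h1 h2 y1 y2 with hα
  set β := inCoef A E (A' (0, 1)) (E' (1, 0)) (E' (0, 1)) r c h1 y1 y2 with hβ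
  -- The radial part of `k` is `kv` times the outgoing null vector `∂_v + A/(2E) ∂_r` plus `δ` times
  -- the ingoing `-∂_r`. Nullity and the time orientation make both weights nonnegative and not both
  -- zero.
  set δ := A * kv / (2 * E) - kr with hδ
  have hμx : μ = 1 / x ^ 2 - 1 := by field_simp; linarith
  have total : M.normalCurv φ u k ξ + M.normalCurv φ u k η = x ^ 2 * (kv * α - δ * β) := by
    rw [n1, n2, hα, hβ, outCoef, inCoef, ← hμ, hμx, ← ht2, ha, hb, hδ]
    field_simp
    ring
  rw [total]
  refine mul_neg_of_pos_of_neg hx2pos ?_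
  rcases hk.2 with hkpos | ⟨hk0, hkneg⟩
  · have hδ0 : 0 ≤ δ := by
      have : δ = κ ^ 2 / (2 * E * kv) := by
        rw [hδ]
        have hkv0 : kv ≠ 0 := hkpos.ne'
        field_simp
        linear_combination -hnull
      rw [this]
      have : 0 < kv := hkpos
      positivity
    have := mul_neg_of_pos_of_neg hkpos hout
    have := mul_nonneg hδ0 hin.le
    linarith
  · have hkv0 : kv = 0 := hk0
    have hδ0 : 0 < δ := by
      rw [hδ, hkv0]
      have : kr < 0 := hkneg
      simpa using this
    have := mul_pos hδ0 hin
    rw [hkv0]; linarith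

end SphSpacetime

/-! ### Graphs over the sphere of directions as closed imbedded surfaces. -/

/-- The cosine of the angle between `e` and `x`. -/
noncomputable def cosAng (e x : E3) : ℝ := inner ℝ e x / ‖x‖

/-- The event of the graph `r = h(c)`, `v = y(c)` in the direction of `x`. -/
noncomputable def graphMap (e : E3) (h y : ℝ → ℝ) (x : E3) : Event :=
  (y (cosAng e x) - h (cosAng e x), (h (cosAng e x) / ‖x‖) • x)

/-- The rotationally symmetric graph `r = h(c)`, `v = y(c)`. -/
def graphSurf (e : E3) (h y : ℝ → ℝ) : Set Event := graphMap e h y '' {0}ᶜ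

section graph
variable {e : E3} {h y : ℝ → ℝ}

lemma cosAng_mem (he : ‖e‖ = 1) (x : E3) : cosAng e x ∈ Icc (-1 : ℝ) 1 := by
  have h1 := abs_real_inner_div_norm_mul_norm_le_one e x
  rw [he, one_mul] at h1
  exact abs_le.1 h1

lemma cosAng_smul {a : ℝ} (ha : 0 < a) (x : E3) : cosAng e (a • x) = cosAng e x := by
  rw [cosAng, cosAng, inner_smul_right, norm_smul, Real.norm_eq_abs, abs_of_pos ha,
    mul_div_mul_left _ _ ha.ne']

/-- The map depends only on the direction of `x`. The surface is thus an image both of the compact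
unit sphere and of the connected punctured space, and any representative of a direction may be used
in a chart. -/
lemma graphMap_smul {a : ℝ} (ha : 0 < a) (x : E3) :
    graphMap e h y (a • x) = graphMap e h y x := by
  rw [graphMap, graphMap, cosAng_smul ha, smul_smul, norm_smul, Real.norm_eq_abs, abs_of_pos ha]
  congr 2
  field_simp

lemma radius_graphMap {x : E3} (hx : x ≠ 0) (hpos : 0 < h (cosAng e x)) :
    radius (graphMap e h y x) = h (cosAng e x) := by
  have : ‖x‖ ≠ 0 := by simpa using hx
  simp [radius, graphMap, norm_smul, abs_of_pos hpos, this]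

lemma advTime_graphMap {x : E3} (hx : x ≠ 0) (hpos : 0 < h (cosAng e x)) :
    advTime (graphMap e h y x) = y (cosAng e x) := by
  have := radius_graphMap (y := y) hx hpos
  rw [radius] at this
  rw [advTime, this, graphMap]; ring

lemma cosE_graphMap {x : E3} (hx : x ≠ 0) (hpos : 0 < h (cosAng e x)) :
    cosE e (graphMap e h y x) = cosAng e x := by
  have : 0 < ‖x‖ := by simpa using hx
  exact cosAng_smul (a := h (cosAng e x) / ‖x‖) (by positivity) x

lemma contDiffAt_cosAng {x : E3} (hx : x ≠ 0) : ContDiffAt ℝ 3 (cosAng e) x := by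
  unfold cosAng
  exact (contDiffAt_const.inner ℝ contDiffAt_id).div (contDiffAt_norm ℝ hx) (by simpa using hx)

lemma contDiffAt_graphMap (hh : ContDiff ℝ 3 h) (hy : ContDiff ℝ 3 y) {x : E3} (hx : x ≠ 0) :
    ContDiffAt ℝ 3 (graphMap e h y) x := by
  have h1 := hh.contDiffAt.comp x (contDiffAt_cosAng (e := e) hx)
  have h2 := hy.contDiffAt.comp x (contDiffAt_cosAng (e := e) hx)
  exact (h2.sub h1).prodMk
    ((h1.div (contDiffAt_norm ℝ hx) (by simpa using hx)).smul contDiffAt_id)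

lemma continuousOn_graphMap (hh : ContDiff ℝ 3 h) (hy : ContDiff ℝ 3 y) :
    ContinuousOn (graphMap e h y) {0}ᶜ := fun _ hx =>
  (contDiffAt_graphMap hh hy hx).continuousAt.continuousWithinAt

lemma isCompact_graphSurf (hh : ContDiff ℝ 3 h) (hy : ContDiff ℝ 3 y) :
    IsCompact (graphSurf e h y) := by
  have : graphSurf e h y = graphMap e h y '' Metric.sphere 0 1 := by
    apply Subset.antisymm
    · rintro _ ⟨x, hx, rfl⟩
      have hn : 0 < ‖x‖ := by simpa using hx
      refine ⟨‖x‖⁻¹ • x, ?_, graphMap_smul (inv_pos.2 hn) x⟩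
      simp [norm_smul, hn.ne']
    · refine image_mono fun x hx => ?_
      rintro rfl
      simp at hx
  rw [this]
  refine (isCompact_sphere 0 1).image_of_continuousOn ((continuousOn_graphMap hh hy).mono ?_)
  rintro x hx rfl
  simp at hx

lemma isConnected_graphSurf (hh : ContDiff ℝ 3 h) (hy : ContDiff ℝ 3 y) :
    IsConnected (graphSurf e h y) := by
  refine (isConnected_compl_singleton_of_one_lt_rank ?_ 0).image _ (continuousOn_graphMap hh hy)
  rw [← Module.finrank_eq_rank, finrank_euclideanSpace_fin]
  norm_num

/-- Two vectors completing a unit vector to an orthonormal basis. -/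
lemma exists_frame_of_unit {n : E3} (hn : ‖n‖ = 1) :
    ∃ a b : E3, ‖a‖ = 1 ∧ ‖b‖ = 1 ∧ inner ℝ n a = 0 ∧ inner ℝ n b = 0 ∧ inner ℝ a b = 0 ∧
      ∀ z : E3, z = (inner ℝ n z : ℝ) • n + (inner ℝ a z : ℝ) • a + (inner ℝ b z : ℝ) • b := by
  have ho : Orthonormal ℝ (({0} : Set (Fin 3)).domRestrict ![n, 0, 0]) := by
    constructor
    · rintro ⟨i, hi⟩; obtain rfl := hi; simp [hn]
    · rintro ⟨i, hi⟩ ⟨j, hj⟩ hij; obtain rfl := hi; obtain rfl := hj; simp at hij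
  obtain ⟨b, hb⟩ := ho.exists_orthonormalBasis_extension_of_card_eq (by simp)
  have b0 : b 0 = n := by simpa using hb 0 (by simp)
  have hno := b.orthonormal
  refine ⟨b 1, b 2, hno.1 1, hno.1 2, ?_, ?_, hno.2 (by decide), fun z => ?_⟩
  · rw [← b0]; exact hno.2 (by decide)
  · rw [← b0]; exact hno.2 (by decide)
  · have := b.sum_repr' z
    rw [Fin.sum_univ_three, b0] at this
    exact this.symm

/-- The central projection chart of the sphere of directions around `n`. -/
noncomputable def centralPt (n a b : E3) (u : Param) : E3 := n + u 0 • a + u 1 • b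

/-- The inverse of the central projection chart. -/
noncomputable def centralInv (n a b : E3) (p : Event) : Param :=
  WithLp.toLp 2 ![inner ℝ a p.2 / inner ℝ n p.2, inner ℝ b p.2 / inner ℝ n p.2]

/-- Central projection onto the plane tangent at `n = x₀/|x₀|` parametrizes the hemisphere `⟨n, x⟩ >
0`. Its inverse extends to a differentiable map on the half-space `W`; this left inverse gives at
once injectivity of the differential and the imbedding property. -/
lemma exists_chart_graphSurf (hh : ContDiff ℝ 3 h) (hy : ContDiff ℝ 3 y)
    (hpos : ∀ x : E3, 0 < h (cosAng e x)) {p : Event} (hp : p ∈ graphSurf e h y) :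
    ∃ φ : Param → Event, IsSurfaceChart (graphSurf e h y) φ univ ∧ φ 0 = p ∧
      ∀ u, ∃ x : E3, x ≠ 0 ∧ φ u = graphMap e h y x := by
  obtain ⟨x₀, hx₀, rfl⟩ := hp
  have hn₀ : 0 < ‖x₀‖ := by simpa using hx₀
  set n : E3 := ‖x₀‖⁻¹ • x₀ with hn
  have hn1 : ‖n‖ = 1 := by simp [hn, norm_smul, hn₀.ne']
  obtain ⟨a, b, ha, hb, hna, hnb, hab, hexp⟩ := exists_frame_of_unit hn1
  have hnn : inner ℝ n n = (1 : ℝ) := by rw [real_inner_self_eq_norm_sq, hn1]; norm_num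
  have haa : inner ℝ a a = (1 : ℝ) := by rw [real_inner_self_eq_norm_sq, ha]; norm_num
  have hbb : inner ℝ b b = (1 : ℝ) := by rw [real_inner_self_eq_norm_sq, hb]; norm_num
  have han : inner ℝ a n = (0 : ℝ) := by rw [real_inner_comm, hna]
  have hbn : inner ℝ b n = (0 : ℝ) := by rw [real_inner_comm, hnb]
  have hba : inner ℝ b a = (0 : ℝ) := by rw [real_inner_comm, hab]
  have i1 : ∀ u, inner ℝ n (centralPt n a b u) = (1 : ℝ) := fun u => by
    simp [centralPt, inner_add_right, inner_smul_right, hna, hnb, hn1]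
  have i2 : ∀ u, inner ℝ a (centralPt n a b u) = u 0 := fun u => by
    simp [centralPt, inner_add_right, inner_smul_right, han, hab, ha]
  have i3 : ∀ u, inner ℝ b (centralPt n a b u) = u 1 := fun u => by
    simp [centralPt, inner_add_right, inner_smul_right, hbn, hba, hb]
  have hne : ∀ u, centralPt n a b u ≠ 0 := fun u h0 => by
    have := i1 u
    rw [h0, inner_zero_right] at this
    norm_num at this
  have hcp : ContDiff ℝ 3 (centralPt n a b) := by unfold centralPt; fun_prop
  set φ : Param → Event := fun u => graphMap e h y (centralPt n a b u) with hφ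
  have hφs : ContDiff ℝ 3 φ := contDiff_iff_contDiffAt.2 fun u =>
    (contDiffAt_graphMap hh hy (hne u)).comp u hcp.contDiffAt
  set W : Set Event := {p | 0 < inner ℝ n p.2} with hW
  have hWo : IsOpen W := isOpen_lt continuous_const (by fun_prop)
  have hscale : ∀ x : E3, x ≠ 0 → 0 < h (cosAng e x) / ‖x‖ := fun x hx =>
    div_pos (hpos x) (by simpa using hx)
  have hφW : ∀ u, φ u ∈ W := fun u => by
    change 0 < inner ℝ n ((_ : ℝ) • centralPt n a b u)
    rw [inner_smul_right, i1, mul_one]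
    exact hscale _ (hne u)
  have hleft : ∀ u, centralInv n a b (φ u) = u := fun u => by
    have hs := (hscale _ (hne u)).ne'
    ext i
    fin_cases i
    · change inner ℝ a ((_ : ℝ) • centralPt n a b u) / inner ℝ n ((_ : ℝ) • centralPt n a b u) = u 0
      rw [inner_smul_right, inner_smul_right, i1, i2, mul_one, mul_div_cancel_left₀ _ hs]
    · change inner ℝ b ((_ : ℝ) • centralPt n a b u) / inner ℝ n ((_ : ℝ) • centralPt n a b u) = u 1
      rw [inner_smul_right, inner_smul_right, i1, i3, mul_one, mul_div_cancel_left₀ _ hs]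
  have hinvd : ∀ p ∈ W, DifferentiableAt ℝ (centralInv n a b) p := fun p hp => by
    have hp' : inner ℝ n p.2 ≠ (0 : ℝ) := ne_of_gt hp
    have d : ∀ z : E3, DifferentiableAt ℝ (fun p : Event => (inner ℝ z p.2 / inner ℝ n p.2 : ℝ)) p :=
      fun z => (((contDiffAt_const (n := 1)).inner ℝ contDiffAt_snd).div
        (contDiffAt_const.inner ℝ contDiffAt_snd) hp').differentiableAt one_ne_zero
    rw [differentiableAt_euclidean]
    intro i
    fin_cases i
    · exact d a
    · exact d b
  refine ⟨φ, ⟨isOpen_univ, hφs.contDiffOn, fun u _ => ?_, ?_, W, hWo, ?_⟩, ?_, fun u =>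
    ⟨_, hne u, rfl⟩⟩
  · have h1 := (hinvd _ (hφW u)).hasFDerivAt.comp u
      (hφs.differentiable (by norm_num) u).hasFDerivAt
    have h2 : centralInv n a b ∘ φ = id := funext hleft
    rw [h2] at h1
    have h3 := h1.unique (hasFDerivAt_id u)
    intro v w hvw
    have h4 := congrArg (fun T : Param →L[ℝ] Param => T v) h3
    have h5 := congrArg (fun T : Param →L[ℝ] Param => T w) h3
    simp only [ContinuousLinearMap.comp_apply, ContinuousLinearMap.id_apply] at h4 h5
    rw [← h4, ← h5, hvw]
  · set f : ↥(univ : Set Param) → W := fun u => ⟨φ u, hφW u⟩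
    set g : W → ↥(univ : Set Param) := fun p => ⟨centralInv n a b p, mem_univ _⟩
    have hgf : Function.LeftInverse g f := fun u => Subtype.ext (hleft u)
    have hfc : Continuous f := (hφs.continuous.comp continuous_subtype_val).subtype_mk _
    have hgc : Continuous g := by
      refine Continuous.subtype_mk ?_ _
      exact continuousOn_iff_continuous_domRestrict.1 fun p hp =>
        (hinvd p hp).continuousAt.continuousWithinAt
    exact IsEmbedding.subtypeVal.comp (hgf.isEmbedding hgc hfc)
  · apply Subset.antisymm
    · rintro _ ⟨u, -, rfl⟩
      exact ⟨⟨_, hne u, rfl⟩, hφW u⟩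
    · rintro _ ⟨⟨x, hx, rfl⟩, hxW⟩
      have hx0 : x ≠ 0 := hx
      have hix : 0 < inner ℝ n x := by
        have h1 : 0 < inner ℝ n ((h (cosAng e x) / ‖x‖ : ℝ) • x) := hxW
        rw [inner_smul_right] at h1
        exact (mul_pos_iff_of_pos_left (hscale x hx0)).1 h1
      set u : Param := WithLp.toLp 2 ![inner ℝ a x / inner ℝ n x, inner ℝ b x / inner ℝ n x]
      refine ⟨u, mem_univ _, ?_⟩
      have : centralPt n a b u = (inner ℝ n x)⁻¹ • x := by
        rw [congrArg (fun z => (inner ℝ n x : ℝ)⁻¹ • z) (hexp x)]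
        simp only [centralPt, u, smul_add, smul_smul, inv_mul_cancel₀ hix.ne', one_smul]
        simp [div_eq_inv_mul]
      change graphMap e h y (centralPt n a b u) = _
      rw [this, graphMap_smul (inv_pos.2 hix)]
  · have : centralPt n a b 0 = ‖x₀‖⁻¹ • x₀ := by simp [centralPt, hn]
    change graphMap e h y (centralPt n a b 0) = _
    rw [this, graphMap_smul (inv_pos.2 hn₀)]

end graph

namespace SphSpacetime
variable {M : SphSpacetime}

lemma graphMap_mem_carrier {e : E3} {h y : ℝ → ℝ} {x : E3} (hx : x ≠ 0)
    (hs : (y (cosAng e x), h (cosAng e x)) ∈ M.spheres) : graphMap e h y x ∈ M.carrier := by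
  have hpos : 0 < h (cosAng e x) := hs.1
  rw [← vr_mem_spheres (by rw [radius_graphMap hx hpos]; exact hpos), vr,
    radius_graphMap hx hpos, advTime_graphMap hx hpos]
  exact hs

theorem isClosedFTrapped_graphSurf {e : E3} (he : ‖e‖ = 1) {h h' h'' y y' y'' : ℝ → ℝ}
    (hh3 : ContDiff ℝ 3 h) (hy3 : ContDiff ℝ 3 y)
    (hh : ∀ x, HasDerivAt h (h' x) x) (hh' : ∀ x, HasDerivAt h' (h'' x) x)
    (hy : ∀ x, HasDerivAt y (y' x) x) (hy' : ∀ x, HasDerivAt y' (y'' x) x)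
    (hs : ∀ c ∈ Icc (-1 : ℝ) 1, (y c, h c) ∈ M.spheres)
    (hcond : ∀ c ∈ Icc (-1 : ℝ) 1, ∀ q : ℝ × ℝ, q = (y c, h c) →
      0 < 1 + graphStretch (M.lapse q) (M.expβ q) q.2 c (h' c) (y' c) ∧
      outCoef (M.lapse q) (M.expβ q) (fderiv ℝ M.lapse q (1, 0)) (fderiv ℝ M.lapse q (0, 1))
        (fderiv ℝ M.expβ q (1, 0)) (fderiv ℝ M.expβ q (0, 1)) q.2 c (h' c) (h'' c) (y' c) (y'' c)
        < 0 ∧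
      0 < inCoef (M.lapse q) (M.expβ q) (fderiv ℝ M.lapse q (0, 1))
        (fderiv ℝ M.expβ q (1, 0)) (fderiv ℝ M.expβ q (0, 1)) q.2 c (h' c) (y' c) (y'' c)) :
    M.IsClosedFTrapped (graphSurf e h y) := by
  have hpos : ∀ x : E3, 0 < h (cosAng e x) := fun x => (hs _ (cosAng_mem he x)).1
  refine ⟨?_, isCompact_graphSurf hh3 hy3, isConnected_graphSurf hh3 hy3, fun p hp => ?_⟩
  · rintro _ ⟨x, hx, rfl⟩
    exact graphMap_mem_carrier hx (hs _ (cosAng_mem he x))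
  obtain ⟨φ, hφ, h0, hrep⟩ := exists_chart_graphSurf hh3 hy3 hpos hp
  refine ⟨φ, univ, 0, hφ, mem_univ _, h0, ?_⟩
  obtain ⟨x, hx, hφx⟩ := hrep 0
  have hc := cosAng_mem he x
  have hq : vr (φ 0) = (y (cosAng e x), h (cosAng e x)) := by
    rw [hφx, vr, radius_graphMap hx (hpos x), advTime_graphMap hx (hpos x)]
  obtain ⟨k1, k2, k3⟩ := hcond _ hc _ rfl
  refine isFTrappedAt_of_graph isOpen_univ hφ.2.1 (mem_univ _) (hφ.2.2.1 0 (mem_univ _)) ?_ ?_ he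
    hh hh' hy hy' (fun w _ => ?_) (fun w _ => ?_) hq (c := cosAng e x) ?_ k1 k2 k3
  · rw [hφx]; exact graphMap_mem_carrier hx (hs _ hc)
  · rw [← radius_pos, hφx, radius_graphMap hx (hpos x)]; exact hpos x
  · obtain ⟨x', hx', e'⟩ := hrep w
    rw [e', radius_graphMap hx' (hpos x'), cosE_graphMap hx' (hpos x')]
  · obtain ⟨x', hx', e'⟩ := hrep w
    rw [e', advTime_graphMap hx' (hpos x'), cosE_graphMap hx' (hpos x')]
  · rw [hφx, cosE_graphMap hx (hpos x)]

end SphSpacetime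

/-! ### Small deformations of a marginally trapped round sphere. -/

lemma exists_bound_on_box {n : ℕ} {f : (Fin n → ℝ) → ℝ} (hf : Continuous f) (C : ℝ) :
    ∃ B : ℝ, ∀ x : Fin n → ℝ, (∀ i, |x i| ≤ C) → |f x| ≤ B := by
  have hK : IsCompact (Set.pi univ fun _ : Fin n => Icc (-C) C) :=
    isCompact_univ_pi fun _ => isCompact_Icc
  obtain ⟨B, hB⟩ := hK.exists_bound_of_continuousOn hf.continuousOn
  exact ⟨B, fun x hx => hB x fun i _ => abs_le.1 (hx i)⟩

/-- The remainder of `graphStretch` for a small graph, divided by `ε²`. -/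
noncomputable def stretchRem (ε a E ι c h1 y1 : ℝ) : ℝ :=
  (1 - c ^ 2) * ι ^ 2 * (2 * E * y1 * h1 - ε * a * y1 ^ 2)

/-- The remainder of `outCoef` for a small graph, divided by `ε²`. -/
noncomputable def outRem (ε a E i ι c h1 y1 y2 Av Ar Ev Er : ℝ) : ℝ :=
  ε * a * stretchRem ε a E ι c h1 y1 * ι * i / 2
    - a * y1 * c * (2 + ε ^ 2 * stretchRem ε a E ι c h1 y1) * ι ^ 2 / 2
    + ε * E * h1 * c * stretchRem ε a E ι c h1 y1 * ι ^ 2 + a * y2 * (1 - c ^ 2) * ι ^ 2 / 2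
    + 2 * (-ε * a * y1 / 2 + E * h1) * (1 - c ^ 2) * h1 * ι ^ 3
    + (1 - c ^ 2) * ι ^ 2 * ((Av * y1 + Ar * h1) * y1 - (Ev * y1 + Er * h1) * h1
      - Av * y1 ^ 2 / 2 + Ev * y1 * h1
      + (-(Ev * y1 + Er * h1) * y1 - Ar * y1 ^ 2 / 2 + Er * y1 * h1) * (ε * a * i / 2))

/-- The remainder of `inCoef` for a small graph, divided by `ε`. -/
noncomputable def inRem (ε a E ι c h1 y1 y2 Ar Ev Er : ℝ) : ℝ :=
  ε * stretchRem ε a E ι c h1 y1 * ι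
    + E * y1 * c * (2 + ε ^ 2 * stretchRem ε a E ι c h1 y1) * ι ^ 2 - E * y2 * (1 - c ^ 2) * ι ^ 2
    + 2 * ε * E * y1 * (1 - c ^ 2) * h1 * ι ^ 3
    + ε * (1 - c ^ 2) * ι ^ 2 * (-(Ev * y1 + Er * h1) * y1 - Ar * y1 ^ 2 / 2 + Er * y1 * h1)

lemma graphStretch_scaled {ε a E r c h1 y1 : ℝ} (hr : r ≠ 0) :
    graphStretch (ε * a) E r c (ε * h1) (ε * y1) = ε ^ 2 * stretchRem ε a E r⁻¹ c h1 y1 := by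
  simp only [graphStretch, stretchRem]
  field_simp

/-- Near a marginally trapped sphere the lapse coefficient is itself of order `ε`, hence written `ε
* a`. The leading term then compares `a / E² = f / ε` with the spherical Laplacian `(1 - c²) h2 - 2
c h1` of the profile, divided by `r`. -/
lemma outCoef_scaled {ε a E Av Ar Ev Er r c h1 h2 y1 y2 : ℝ} (hr : r ≠ 0) (hE : E ≠ 0) :
    outCoef (ε * a) E Av Ar Ev Er r c (ε * h1) (ε * h2) (ε * y1) (ε * y2) =
      E / r * ε * (a / E ^ 2 - ((1 - c ^ 2) * h2 - 2 * c * h1) / r)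
        + ε ^ 2 * outRem ε a E E⁻¹ r⁻¹ c h1 y1 y2 Av Ar Ev Er := by
  simp only [outCoef, outRem, graphStretch_scaled hr]
  generalize stretchRem ε a E r⁻¹ c h1 y1 = s
  field_simp
  ring

lemma inCoef_scaled {ε a E Ar Ev Er r c h1 y1 y2 : ℝ} (hr : r ≠ 0) :
    inCoef (ε * a) E Ar Ev Er r c (ε * h1) (ε * y1) (ε * y2) =
      2 / r + ε * inRem ε a E r⁻¹ c h1 y1 y2 Ar Ev Er := by
  simp only [inCoef, inRem, graphStretch_scaled hr]
  generalize stretchRem ε a E r⁻¹ c h1 y1 = s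
  field_simp
  ring

/-- With `1/E` and `1/r` as separate variables the remainders are polynomials, hence bounded on
boxes. -/
lemma exists_rem_bound (C : ℝ) : ∃ B : ℝ, 0 < B ∧
    ∀ ε a E i ι c h1 y1 y2 Av Ar Ev Er : ℝ, |ε| ≤ C → |a| ≤ C → |E| ≤ C → |i| ≤ C → |ι| ≤ C →
      |c| ≤ C → |h1| ≤ C → |y1| ≤ C → |y2| ≤ C → |Av| ≤ C → |Ar| ≤ C → |Ev| ≤ C →
      |Er| ≤ C → |stretchRem ε a E ι c h1 y1| ≤ B ∧
        |outRem ε a E i ι c h1 y1 y2 Av Ar Ev Er| ≤ B ∧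
        |inRem ε a E ι c h1 y1 y2 Ar Ev Er| ≤ B := by
  obtain ⟨B1, hB1⟩ := exists_bound_on_box (n := 13)
    (f := fun x => stretchRem (x 0) (x 1) (x 2) (x 4) (x 5) (x 6) (x 7))
    (by unfold stretchRem; fun_prop) C
  obtain ⟨B2, hB2⟩ := exists_bound_on_box (n := 13)
    (f := fun x => outRem (x 0) (x 1) (x 2) (x 3) (x 4) (x 5) (x 6) (x 7) (x 8) (x 9) (x 10)
      (x 11) (x 12)) (by unfold outRem stretchRem; fun_prop) C
  obtain ⟨B3, hB3⟩ := exists_bound_on_box (n := 13)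
    (f := fun x => inRem (x 0) (x 1) (x 2) (x 4) (x 5) (x 6) (x 7) (x 8) (x 10)
      (x 11) (x 12)) (by unfold inRem stretchRem; fun_prop) C
  refine ⟨max (max B1 B2) (max B3 1), by positivity, ?_⟩
  intro ε a E i ι c h1 y1 y2 Av Ar Ev Er k0 k1 k2 k3 k4 k5 k6 k7 k8 k9 k10 k11 k12
  have hx : ∀ j, |(![ε, a, E, i, ι, c, h1, y1, y2, Av, Ar, Ev, Er] : Fin 13 → ℝ) j| ≤ C := by
    intro j
    fin_cases j <;> assumption
  exact ⟨(hB1 _ hx).trans (by simp), (hB2 _ hx).trans (by simp), (hB3 _ hx).trans (by simp)⟩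

lemma eventually_abs_le {g : ℝ × ℝ → ℝ} {q : ℝ × ℝ} (hg : ContinuousAt g q) :
    ∀ᶠ p in 𝓝 q, |g p| ≤ |g q| + 1 :=
  (hg.abs.eventually (gt_mem_nhds (lt_add_one _))).mono fun _ h => h.le

lemma exists_bound_Icc {g : ℝ → ℝ} (hg : Continuous g) :
    ∃ B : ℝ, 0 ≤ B ∧ ∀ c ∈ Icc (-1 : ℝ) 1, |g c| ≤ B := by
  obtain ⟨B, hB⟩ := isCompact_Icc.exists_bound_of_continuousOn (s := Icc (-1 : ℝ) 1)
    hg.continuousOn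
  exact ⟨B, (abs_nonneg _).trans (hB 0 (by norm_num)), hB⟩

namespace SphSpacetime
variable {M : SphSpacetime}

set_option maxHeartbeats 1000000 in
/-- Small deformations of a marginally trapped round sphere are f-trapped if the first order
change of their outgoing null expansion is negative. -/
theorem exists_trapped_deformation {q : ℝ × ℝ} (hq : q ∈ M.spheres) (hf : M.fval q = 0)
    {H H' H'' y y' y'' : ℝ → ℝ} (hH3 : ContDiff ℝ 3 H) (hy3 : ContDiff ℝ 3 y)
    (hH : ∀ x, HasDerivAt H (H' x) x) (hH' : ∀ x, HasDerivAt H' (H'' x) x)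
    (hy : ∀ x, HasDerivAt y (y' x) x) (hy' : ∀ x, HasDerivAt y' (y'' x) x)
    (cH' : Continuous H') (cH'' : Continuous H'') (cy' : Continuous y') (cy'' : Continuous y'')
    {κ : ℝ} (hκ : 0 < κ)
    (hineq : ∀ c ∈ Icc (-1 : ℝ) 1, fderiv ℝ M.fval q (y c, H c) + κ ≤
      ((1 - c ^ 2) * H'' c - 2 * c * H' c) / q.2) :
    ∃ ε₀ > 0, ∀ ε : ℝ, 0 < ε → ε < ε₀ → ∀ᶠ q₀ in 𝓝 q, ∀ e : E3, ‖e‖ = 1 →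
      M.IsClosedFTrapped (graphSurf e (fun c => q₀.2 + ε * H c) (fun c => q₀.1 + ε * y c)) ∧
      ∀ c ∈ Icc (-1 : ℝ) 1, ε * (fderiv ℝ M.fval q (y c, H c) - κ) <
        M.fval (q₀.1 + ε * y c, q₀.2 + ε * H c) := by
  have hr : 0 < q.2 := hq.1
  have cL : ∀ d, ContinuousAt (fun p => fderiv ℝ M.lapse p d) q := fun d =>
    (((contDiffAt_lapse hq).fderiv_right (m := 0) (by norm_num)).continuousAt).clm_apply
      continuousAt_const
  have cE : ∀ d, ContinuousAt (fun p => fderiv ℝ M.expβ p d) q := fun d =>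
    (((contDiffAt_expβ hq).fderiv_right (m := 0) (by norm_num)).continuousAt).clm_apply
      continuousAt_const
  have cE0 : ContinuousAt M.expβ q := (contDiffAt_expβ hq).continuousAt
  have cEi : ContinuousAt (fun p => (M.expβ p)⁻¹) q := cE0.inv₀ (M.expβ_pos q).ne'
  have cr : ContinuousAt (fun p : ℝ × ℝ => p.2) q := continuousAt_snd
  have cri : ContinuousAt (fun p : ℝ × ℝ => p.2⁻¹) q := cr.inv₀ hr.ne'
  obtain ⟨b1, b1p, hb1⟩ := exists_bound_Icc cH'
  obtain ⟨b3, b3p, hb3⟩ := exists_bound_Icc cy'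
  obtain ⟨b4, b4p, hb4⟩ := exists_bound_Icc cy''
  obtain ⟨b5, b5p, hb5⟩ := exists_bound_Icc (g := fun c => ‖(y c, H c)‖)
    (hy3.continuous.prodMk hH3.continuous).norm
  obtain ⟨b6, b6p, hb6⟩ := exists_bound_Icc (g := fun c => fderiv ℝ M.fval q (y c, H c))
    ((fderiv ℝ M.fval q).continuous.comp (hy3.continuous.prodMk hH3.continuous))
  obtain ⟨b7, b7p, hb7⟩ := exists_bound_Icc (g := fun c => (1 - c ^ 2) * H'' c - 2 * c * H' c)
    (by fun_prop)
  set ω := κ / (8 * (b5 + 1)) with hω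
  have hω0 : 0 < ω := by positivity
  -- Strict differentiability is needed because the base point `q₀` of the deformation varies in a
  -- neighbourhood of `q`.
  have hstrict : ∀ᶠ p in 𝓝 q ×ˢ 𝓝 q,
      ‖M.fval p.1 - M.fval p.2 - fderiv ℝ M.fval q (p.1 - p.2)‖ ≤ ω * ‖p.1 - p.2‖ := by
    have := ((contDiffAt_fval hq).hasStrictFDerivAt one_ne_zero).isLittleO.def hω0
    rwa [nhds_prod_eq] at this
  obtain ⟨s, hs, hstr⟩ := eventually_prod_self_iff
    (r := fun a b => ‖M.fval a - M.fval b - fderiv ℝ M.fval q (a - b)‖ ≤ ω * ‖a - b‖) |>.1 hstrict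
  -- One constant bounding all thirteen arguments of the remainders near `q`; the last summand takes
  -- care of `a`.
  set C := 1 + |M.expβ q| + 1 + (|(M.expβ q)⁻¹| + 1) + (|q.2| + 1) + (|q.2⁻¹| + 1)
    + (|fderiv ℝ M.lapse q (1, 0)| + 1) + (|fderiv ℝ M.lapse q (0, 1)| + 1)
    + (|fderiv ℝ M.expβ q (1, 0)| + 1) + (|fderiv ℝ M.expβ q (0, 1)| + 1)
    + b1 + b3 + b4 + (|M.expβ q| + 1) ^ 2 * (b6 + κ) with hC
  have t1 := abs_nonneg (M.expβ q)
  have t2 := abs_nonneg (M.expβ q)⁻¹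
  have t3 := abs_nonneg q.2
  have t4 := abs_nonneg q.2⁻¹
  have t5 := abs_nonneg (fderiv ℝ M.lapse q (1, 0))
  have t6 := abs_nonneg (fderiv ℝ M.lapse q (0, 1))
  have t7 := abs_nonneg (fderiv ℝ M.expβ q (1, 0))
  have t8 := abs_nonneg (fderiv ℝ M.expβ q (0, 1))
  have t9 : 0 ≤ (|M.expβ q| + 1) ^ 2 * (b6 + κ) := by positivity
  have hC0 : 0 < C := by positivity
  have hinv : ∀ᶠ p in 𝓝 q, |p.2⁻¹ - q.2⁻¹| < κ / (8 * (b7 + 1)) := by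
    have := cri.eventually (Metric.ball_mem_nhds _ (by positivity : 0 < κ / (8 * (b7 + 1))))
    simpa [Real.dist_eq] using this
  have hV : ∀ᶠ p in 𝓝 q, p ∈ M.spheres ∧ p ∈ s ∧ |p.2⁻¹ - q.2⁻¹| < κ / (8 * (b7 + 1)) ∧
      |M.expβ p| ≤ |M.expβ q| + 1 ∧ |(M.expβ p)⁻¹| ≤ |(M.expβ q)⁻¹| + 1 ∧ |p.2| ≤ |q.2| + 1 ∧
      |p.2⁻¹| ≤ |q.2⁻¹| + 1 ∧
      |fderiv ℝ M.lapse p (1, 0)| ≤ |fderiv ℝ M.lapse q (1, 0)| + 1 ∧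
      |fderiv ℝ M.lapse p (0, 1)| ≤ |fderiv ℝ M.lapse q (0, 1)| + 1 ∧
      |fderiv ℝ M.expβ p (1, 0)| ≤ |fderiv ℝ M.expβ q (1, 0)| + 1 ∧
      |fderiv ℝ M.expβ p (0, 1)| ≤ |fderiv ℝ M.expβ q (0, 1)| + 1 := by
    filter_upwards [isOpen_spheres.mem_nhds hq, hs, hinv, eventually_abs_le cE0,
      eventually_abs_le cEi, eventually_abs_le cr, eventually_abs_le cri,
      eventually_abs_le (cL (1, 0)), eventually_abs_le (cL (0, 1)), eventually_abs_le (cE (1, 0)),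
      eventually_abs_le (cE (0, 1))] with p a1 a2 a3 a4 a5 a6 a7 a8 a9 a10 a11
    exact ⟨a1, a2, a3, a4, a5, a6, a7, a8, a9, a10, a11⟩
  obtain ⟨ρ, hρ, hball⟩ := Metric.eventually_nhds_iff_ball.1 hV
  obtain ⟨B, hB0, hB⟩ := exists_rem_bound C
  -- The bounds on `ε` keep the graph in the good ball, the induced metric positive, the outgoing
  -- remainder below its margin `κ / (4 C²)`, and the ingoing one below `2 / r`.
  refine ⟨min (min 1 (ρ / (2 * (b5 + 1)))) (min (1 / (2 * B)) (min (κ / (4 * C ^ 2) / (2 * B))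
    (1 / (C * B)))), by positivity, fun ε hε hε₀ => ?_⟩
  simp only [lt_min_iff] at hε₀
  obtain ⟨⟨s1, s2⟩, s3, s4, s5⟩ := hε₀
  rw [lt_div_iff₀ (by positivity)] at s2 s3 s4 s5
  have cf : ContinuousAt M.fval q := (contDiffAt_fval hq).continuousAt
  -- The admissible neighbourhood of `q` depends on `ε`: the defect `f(q₀)` has to be small compared
  -- with `ε`.
  have hfsmall : ∀ᶠ p in 𝓝 q, |M.fval p| < κ * ε / 4 := by
    refine cf.abs.eventually (Iio_mem_nhds ?_)
    simp only [hf, abs_zero]; positivity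
  filter_upwards [hfsmall, Metric.ball_mem_nhds q (half_pos hρ)] with q₀ hq₀f hq₀b e he
  have hin : ∀ c ∈ Icc (-1 : ℝ) 1, (q₀.1 + ε * y c, q₀.2 + ε * H c) ∈ Metric.ball q ρ := by
    intro c hc
    have h1 : (q₀.1 + ε * y c, q₀.2 + ε * H c) = q₀ + ε • (y c, H c) := by ext <;> simp
    have h2 := hb5 c hc
    rw [abs_norm] at h2
    rw [h1, mem_ball_iff_norm, add_sub_right_comm]
    rw [mem_ball_iff_norm] at hq₀b
    calc ‖q₀ - q + ε • (y c, H c)‖ ≤ ‖q₀ - q‖ + ‖ε • (y c, H c)‖ := norm_add_le _ _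
      _ ≤ ‖q₀ - q‖ + ε * b5 := by
        rw [norm_smul, Real.norm_eq_abs, abs_of_pos hε]; gcongr
      _ < ρ := by linarith
  have hq₀s : q₀ ∈ s := (hball q₀ (Metric.ball_subset_ball (by linarith) hq₀b)).2.1
  have hfest : ∀ c ∈ Icc (-1 : ℝ) 1,
      |M.fval (q₀.1 + ε * y c, q₀.2 + ε * H c) - ε * fderiv ℝ M.fval q (y c, H c)|
        ≤ ε * (κ * 3 / 8) := by
    intro c hc
    have h1 : (q₀.1 + ε * y c, q₀.2 + ε * H c) - q₀ = ε • (y c, H c) := by ext <;> simp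
    have h2 := hb5 c hc
    rw [abs_norm] at h2
    have h3 := hstr _ (hball _ (hin c hc)).2.1 _ hq₀s
    simp only [h1, map_smul, smul_eq_mul, Real.norm_eq_abs] at h3
    rw [norm_smul, Real.norm_eq_abs, abs_of_pos hε] at h3
    have h4 : ω * (ε * ‖(y c, H c)‖) ≤ ε * (κ / 8) := by
      have : ω * b5 ≤ κ / 8 := by
        rw [hω, div_mul_eq_mul_div, div_le_div_iff₀ (by positivity) (by norm_num)]
        linarith only [hκ]
      calc ω * (ε * ‖(y c, H c)‖) = ε * (ω * ‖(y c, H c)‖) := by ring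
        _ ≤ ε * (ω * b5) := by gcongr
        _ ≤ ε * (κ / 8) := by gcongr
    have h5 := abs_le.1 (h3.trans h4)
    have h6 := abs_lt.1 hq₀f
    rw [abs_le]
    constructor <;> linarith
  refine ⟨?_, fun c hc => ?_⟩
  · refine isClosedFTrapped_graphSurf he (h' := fun c => ε * H' c) (h'' := fun c => ε * H'' c)
      (y' := fun c => ε * y' c) (y'' := fun c => ε * y'' c)
      (contDiff_const.add (contDiff_const.mul hH3)) (contDiff_const.add (contDiff_const.mul hy3))
      (fun x => ((hH x).const_mul ε).const_add _) (fun x => (hH' x).const_mul ε)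
      (fun x => ((hy x).const_mul ε).const_add _) (fun x => (hy' x).const_mul ε)
      (fun c hc => (hball _ (hin c hc)).1) ?_
    intro c hc p hp
    obtain ⟨a1, a2, a3, a4, a5, a6, a7, a8, a9, a10, a11⟩ := hball _ (hin c hc)
    have hfe := hfest c hc
    rw [← hp] at a1 a2 a3 a4 a5 a6 a7 a8 a9 a10 a11 hfe
    have hEp := M.expβ_pos p
    have hpr : 0 < p.2 := a1.1
    set a := M.expβ p ^ 2 * (M.fval p / ε) with ha
    have hlap : M.lapse p = ε * a := by
      rw [lapse_eq, ha]; field_simp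
    have hfe' : |M.fval p / ε - fderiv ℝ M.fval q (y c, H c)| ≤ κ * 3 / 8 := by
      have : M.fval p / ε - fderiv ℝ M.fval q (y c, H c)
          = (M.fval p - ε * fderiv ℝ M.fval q (y c, H c)) / ε := by field_simp
      rw [this, abs_div, abs_of_pos hε, div_le_iff₀ hε]
      linarith
    have haC : |a| ≤ (|M.expβ q| + 1) ^ 2 * (b6 + κ) := by
      rw [ha, abs_mul, abs_pow]
      have h1 := hb6 c hc
      have h2 : |M.fval p / ε| ≤ b6 + κ := by
        have h3 := abs_le.1 hfe'
        have h4 := abs_le.1 h1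
        rw [abs_le]; constructor <;> linarith
      gcongr
    have k1 := hb1 c hc
    have k3 := hb3 c hc
    have k4 := hb4 c hc
    have hc1 : |c| ≤ C := (abs_le.2 hc).trans (by linarith)
    have hε1 : |ε| ≤ C := by rw [abs_of_pos hε]; linarith
    obtain ⟨B1, B2, B3⟩ := hB ε a (M.expβ p) (M.expβ p)⁻¹ p.2⁻¹ c (H' c) (y' c) (y'' c)
      (fderiv ℝ M.lapse p (1, 0)) (fderiv ℝ M.lapse p (0, 1)) (fderiv ℝ M.expβ p (1, 0))
      (fderiv ℝ M.expβ p (0, 1)) hε1 (by linarith) (by linarith) (by linarith) (by linarith)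
      hc1 (by linarith) (by linarith) (by linarith) (by linarith) (by linarith) (by linarith)
      (by linarith)
    rw [hlap, graphStretch_scaled hpr.ne', outCoef_scaled hpr.ne' hEp.ne', inCoef_scaled hpr.ne']
    refine ⟨?_, ?_, ?_⟩
    · have h1 := (abs_le.1 B1).1
      have h2 : ε ^ 2 * (-B) ≤ ε ^ 2 * stretchRem ε a (M.expβ p) p.2⁻¹ c (H' c) (y' c) := by gcongr
      have h3 : ε * (ε * B) ≤ 1 * (ε * B) := by gcongr
      linarith only [h2, h3, s3]
    · have h1 := (abs_le.1 B2).2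
      have h2 : a / M.expβ p ^ 2 = M.fval p / ε := by rw [ha]; field_simp
      have h3 := hineq c hc
      have h4 : ((1 - c ^ 2) * H'' c - 2 * c * H' c) / q.2
          - ((1 - c ^ 2) * H'' c - 2 * c * H' c) / p.2 ≤ κ / 8 := by
        have e1 : ((1 - c ^ 2) * H'' c - 2 * c * H' c) / q.2
          - ((1 - c ^ 2) * H'' c - 2 * c * H' c) / p.2 =
          -(((1 - c ^ 2) * H'' c - 2 * c * H' c) * (p.2⁻¹ - q.2⁻¹)) := by
          rw [div_eq_mul_inv, div_eq_mul_inv]; ring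
        rw [e1]
        refine (neg_le_abs _).trans ?_
        rw [abs_mul]
        calc _ ≤ b7 * (κ / (8 * (b7 + 1))) := by
              have := hb7 c hc
              gcongr
          _ ≤ κ / 8 := by
            rw [mul_div_assoc', div_le_div_iff₀ (by positivity) (by norm_num)]
            linarith only [hκ]
      have h5 := (abs_le.1 hfe').2
      -- Of the margin `κ`, the linearization uses `3κ/8` and the change of radius `κ/8`; at least
      -- `κ/4` remains.
      have h6 : a / M.expβ p ^ 2 - ((1 - c ^ 2) * H'' c - 2 * c * H' c) / p.2 ≤ -(κ / 4) := by
        rw [h2]; linarith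
      have h7 : 1 / C ^ 2 ≤ M.expβ p / p.2 := by
        have e1 : 1 / C ≤ M.expβ p := by
          rw [div_le_iff₀ hC0]
          have e2 : (M.expβ p)⁻¹ ≤ C := (le_abs_self _).trans (by linarith)
          have := mul_le_mul_of_nonneg_left e2 hEp.le
          rwa [mul_inv_cancel₀ hEp.ne'] at this
        have e3 : p.2 ≤ C := (le_abs_self _).trans (by linarith)
        rw [le_div_iff₀ hpr]
        calc 1 / C ^ 2 * p.2 ≤ 1 / C ^ 2 * C := by gcongr
          _ = 1 / C := by field_simp
          _ ≤ _ := e1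
      have h8 : M.expβ p / p.2 * ε * (a / M.expβ p ^ 2
          - ((1 - c ^ 2) * H'' c - 2 * c * H' c) / p.2) ≤ 1 / C ^ 2 * ε * (-(κ / 4)) := by
        calc _ ≤ M.expβ p / p.2 * ε * (-(κ / 4)) := by gcongr
          _ ≤ _ := by
            have : 1 / C ^ 2 * ε * (κ / 4) ≤ M.expβ p / p.2 * ε * (κ / 4) := by gcongr
            linarith
      have h9 : ε ^ 2 * outRem ε a (M.expβ p) (M.expβ p)⁻¹ p.2⁻¹ c (H' c) (y' c) (y'' c)
          (fderiv ℝ M.lapse p (1, 0)) (fderiv ℝ M.lapse p (0, 1)) (fderiv ℝ M.expβ p (1, 0))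
          (fderiv ℝ M.expβ p (0, 1)) ≤ ε ^ 2 * B := by gcongr
      have h10 : ε * (ε * B) < ε * (κ / (4 * C ^ 2)) := by
        refine mul_lt_mul_of_pos_left ?_ hε
        linarith only [s4, mul_pos hε hB0]
      have h11 : 1 / C ^ 2 * ε * (-(κ / 4)) = -(ε * (κ / (4 * C ^ 2))) := by field_simp
      linarith only [h8, h9, h10, h11]
    · have h1 := (abs_le.1 B3).1
      have h2 : ε * (-B) ≤ ε * inRem ε a (M.expβ p) p.2⁻¹ c (H' c) (y' c) (y'' c)
          (fderiv ℝ M.lapse p (0, 1)) (fderiv ℝ M.expβ p (1, 0)) (fderiv ℝ M.expβ p (0, 1)) := by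
        gcongr
      have e3 : p.2 ≤ C := (le_abs_self _).trans (by linarith)
      have h3 : 2 / C ≤ 2 / p.2 := by gcongr
      have h4 : ε * B < 2 / C := by
        rw [lt_div_iff₀ hC0]; linarith only [s5]
      linarith only [h2, h3, h4]
  · have h1 := (abs_le.1 (hfest c hc)).1
    have : 0 < ε * κ := by positivity
    linarith only [h1, this]

end SphSpacetime

/-! ### The region `𝒵`, its boundary, and trapped neighbourhoods. -/

namespace SphSpacetime
variable {M : SphSpacetime}

lemma mem_AH_iff {p : Event} : p ∈ M.AH ↔ p ∈ M.carrier ∧ 0 < radius p ∧ M.fval (vr p) = 0 := by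
  simp only [AH, mem_ofPred_eq, fval, vr]
  refine and_congr_right fun _ => and_congr_right fun h => ?_
  rw [sub_eq_zero, eq_comm (a := (1 : ℝ)), div_eq_one_iff_eq h.ne', eq_comm]

lemma AH_subset_Z : M.AH ⊆ M.Z := fun _ hp =>
  mem_Z_iff.2 ⟨(mem_AH_iff.1 hp).1, (mem_AH_iff.1 hp).2.1, (mem_AH_iff.1 hp).2.2.le⟩

lemma hasFDerivAt_fval {q : ℝ × ℝ} (hq : q ∈ M.spheres) :
    HasFDerivAt M.fval (fderiv ℝ M.fval q) q :=
  ((contDiffAt_fval hq).differentiableAt one_ne_zero).hasFDerivAt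

lemma hasDerivAt_fval_line {q : ℝ × ℝ} (hq : q ∈ M.spheres) :
    HasDerivAt (fun w => M.fval (w, q.2)) (fderiv ℝ M.fval q (1, 0)) q.1 :=
  hasDerivAt_comp_of_eq (Y := fun w : ℝ => (w, q.2)) rfl (hasFDerivAt_fval hq)
    ((hasDerivAt_id q.1).prodMk (hasDerivAt_const q.1 q.2))

lemma massFlux_eq {q : ℝ × ℝ} (hq : q ∈ M.spheres) :
    M.massFlux q.1 q.2 = -(q.2 / 2) * fderiv ℝ M.fval q (1, 0) := by
  have hr : q.2 ≠ 0 := hq.1.ne'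
  have h1 : (fun w => M.m w q.2) = fun w => -(q.2 / 2) * (M.fval (w, q.2) - 1) := by
    funext w
    simp only [fval]
    field_simp
    ring
  rw [massFlux, h1]
  exact (((hasDerivAt_fval_line hq).sub_const 1).const_mul _).deriv

/-- The absence of isolated horizons acts only through this fact: translation in `v` changes `f` to
first order on `AH`. -/
lemma fderiv_fval_ne_zero (hiso : M.AHiso = ∅) {p : Event} (hp : p ∈ M.AH) :
    fderiv ℝ M.fval (vr p) (1, 0) ≠ 0 := by
  intro h0
  have h1 := mem_AH_iff.1 hp
  have : p ∈ M.AHiso := by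
    refine ⟨hp, ?_⟩
    have := massFlux_eq (M := M) ((vr_mem_spheres h1.2.1).2 h1.1)
    rw [h0, mul_zero] at this
    exact this
  rw [hiso] at this
  exact this

/-- The graph through an event `p` over its own direction. -/
lemma mem_graphSurf_of_apply_one {p : Event} (hp : p.2 ≠ 0) {h y : ℝ → ℝ} (hh : h 1 = radius p)
    (hy : y 1 = advTime p) : p ∈ graphSurf (‖p.2‖⁻¹ • p.2) h y := by
  have hn : ‖p.2‖ ≠ 0 := by simpa using hp
  refine ⟨p.2, hp, ?_⟩
  have hc : cosAng (‖p.2‖⁻¹ • p.2) p.2 = 1 := by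
    rw [cosAng, inner_smul_left, real_inner_self_eq_norm_sq]
    simp
    field_simp
  rw [graphMap, hc, hh, hy]
  ext1
  · simp [advTime, radius]
  · simp [radius, hn]

lemma mem_trapped_of_fval_neg {p : Event} (hp : p ∈ M.carrier) (h0 : 0 < radius p)
    (hf : M.fval (vr p) < 0) : p ∈ M.trapped := by
  have hp2 := radius_pos.1 h0
  have hn : ‖p.2‖ ≠ 0 := by simpa using hp2
  refine ⟨graphSurf (‖p.2‖⁻¹ • p.2) (fun _ => radius p) (fun _ => advTime p), ?_,
    mem_graphSurf_of_apply_one hp2 rfl rfl⟩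
  refine isClosedFTrapped_graphSurf (by simp [norm_smul, hn]) (h' := fun _ => 0)
    (h'' := fun _ => 0) (y' := fun _ => 0) (y'' := fun _ => 0) contDiff_const contDiff_const
    (fun x => hasDerivAt_const x _) (fun x => hasDerivAt_const x _)
    (fun x => hasDerivAt_const x _) (fun x => hasDerivAt_const x _)
    (fun c _ => (vr_mem_spheres h0).2 hp) ?_
  rintro c - q rfl
  have hE := M.expβ_pos (vr p)
  have hA : M.lapse (vr p) < 0 := by
    rw [lapse_eq]
    exact mul_neg_of_pos_of_neg (by positivity) hf
  change 0 < 1 + graphStretch (M.lapse (vr p)) (M.expβ (vr p)) (radius p) _ _ _ ∧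
    outCoef (M.lapse (vr p)) (M.expβ (vr p)) _ _ _ _ (radius p) _ _ _ _ _ < 0 ∧
    0 < inCoef (M.lapse (vr p)) (M.expβ (vr p)) _ _ _ (radius p) _ _ _ _
  simp only [graphStretch, outCoef, inCoef]
  refine ⟨by simp, ?_, ?_⟩
  · have : M.lapse (vr p) * 2 / (2 * M.expβ (vr p) * radius p) < 0 :=
      div_neg_of_neg_of_pos (by linarith) (by positivity)
    simpa using this
  · have : 0 < 2 / radius p := by positivity
    simpa using this

/-- The profiles `H = 1 - c` and `y = l (1 - c)` vanish at `c = 1`, so the deformed surface over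
`q₀` with axis `e` passes through the event with coordinates `q₀` in direction `e`. Varying `q₀` and
`e` covers a neighbourhood. -/
lemma eventually_mem_trapped (hiso : M.AHiso = ∅) {p : Event} (hp : p ∈ M.AH) :
    ∀ᶠ p' in 𝓝 p, p' ∈ M.trapped := by
  obtain ⟨hpc, hr, hf⟩ := mem_AH_iff.1 hp
  have hfv := fderiv_fval_ne_zero hiso hp
  have hq := (vr_mem_spheres hr).2 hpc
  set q := vr p with hqdef
  have hq2 : 0 < q.2 := hr
  -- With this `l` one has `df(y, H) = -(2/r)(1 - c)`. As `Δ(1 - c) = 2c`, the required inequality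
  -- holds with equality for `κ = 2/r`.
  set l := (-(2 / q.2) - fderiv ℝ M.fval q (0, 1)) / fderiv ℝ M.fval q (1, 0) with hl
  have hline : ∀ (a x : ℝ), HasDerivAt (fun c : ℝ => a * (1 - c)) (-a) x := fun a x => by
    simpa using ((hasDerivAt_id x).const_sub 1).const_mul a
  obtain ⟨ε₀, hε₀, H⟩ := exists_trapped_deformation hq hf (H := fun c => 1 * (1 - c))
    (H' := fun _ => -1) (H'' := fun _ => 0) (y := fun c => l * (1 - c)) (y' := fun _ => -l)
    (y'' := fun _ => 0) (by fun_prop) (by fun_prop) (hline 1) (fun x => hasDerivAt_const x _)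
    (hline l) (fun x => hasDerivAt_const x _) continuous_const continuous_const continuous_const
    continuous_const (κ := 2 / q.2) (by positivity) (by
      intro c _
      rw [clm_prod_apply]
      have h1 : l * fderiv ℝ M.fval q (1, 0) = -(2 / q.2) - fderiv ℝ M.fval q (0, 1) := by
        rw [hl]; field_simp
      refine le_of_eq ?_
      have : l * (1 - c) * fderiv ℝ M.fval q (1, 0) = (1 - c) * (l * fderiv ℝ M.fval q (1, 0)) := by
        ring
      rw [this, h1]
      field_simp
      ring)
  have h1 := H (ε₀ / 2) (by positivity) (by linarith)
  have h2 := continuous_vr.continuousAt.eventually h1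
  have h3 : ∀ᶠ p' in 𝓝 p, 0 < radius p' := continuous_radius.continuousAt.eventually
    (lt_mem_nhds hr)
  filter_upwards [h2, h3] with p' hp' hr'
  have h0 := radius_pos.1 hr'
  have hn : ‖p'.2‖ ≠ 0 := by simpa using h0
  exact ⟨_, (hp' (‖p'.2‖⁻¹ • p'.2) (by simp [norm_smul, hn])).1,
    mem_graphSurf_of_apply_one h0 (by simp [vr]) (by simp [vr])⟩

/-- As `-g(∂_t, ∂_t)`, this coefficient is continuous across the axis and positive on it. Described
by its sign, `𝒵`, `AH` and `ℛ₀` need no separate condition `r > 0`. -/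
lemma continuousOn_lapse_vr : ContinuousOn (fun p => M.lapse (vr p)) M.carrier := by
  have : (fun p => M.lapse (vr p)) = fun p => -M.g p (1, 0) (1, 0) := by
    funext p; rw [g_time_time, neg_neg]
  rw [this]
  exact (M.contDiffOn_metric (1, 0) (1, 0)).continuousOn.neg

lemma lapse_vr_pos_of_axis {p : Event} (h : ¬ 0 < radius p) : 0 < M.lapse (vr p) := by
  have h0 : radius p = 0 := le_antisymm (not_lt.1 h) (norm_nonneg _)
  rw [vr, h0]; exact lapse_axis _

lemma lapse_nonpos_iff (q : ℝ × ℝ) : M.lapse q ≤ 0 ↔ M.fval q ≤ 0 := by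
  have := M.expβ_pos q
  rw [lapse_eq, ← not_lt, mul_pos_iff_of_pos_left (by positivity), not_lt]

lemma mem_Z_iff_lapse {p : Event} : p ∈ M.Z ↔ p ∈ M.carrier ∧ M.lapse (vr p) ≤ 0 := by
  rw [mem_Z_iff, lapse_nonpos_iff]
  refine and_congr_right fun _ => and_iff_right_of_imp fun h => ?_
  by_contra hr
  have := lapse_vr_pos_of_axis (M := M) hr
  rw [← lapse_nonpos_iff] at h
  linarith

lemma mem_AH_iff_lapse {p : Event} : p ∈ M.AH ↔ p ∈ M.carrier ∧ M.lapse (vr p) = 0 := by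
  have hE := M.expβ_pos (vr p)
  have h1 : M.lapse (vr p) = 0 ↔ M.fval (vr p) = 0 := by
    rw [lapse_eq]; simp [hE.ne']
  rw [mem_AH_iff, h1]
  refine and_congr_right fun _ => and_iff_right_of_imp fun h => ?_
  by_contra hr
  have := lapse_vr_pos_of_axis (M := M) hr
  rw [← h1] at h
  linarith

lemma mem_R₀_iff_lapse {p : Event} : p ∈ M.R₀ ↔ p ∈ M.carrier ∧ 0 < M.lapse (vr p) := by
  rw [R₀, Set.mem_sdiff, mem_Z_iff_lapse]
  grind

lemma isOpen_R₀ : IsOpen M.R₀ := by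
  have : M.R₀ = M.carrier ∩ (fun p => M.lapse (vr p)) ⁻¹' Ioi 0 := by
    ext p; exact mem_R₀_iff_lapse
  rw [this]
  exact continuousOn_lapse_vr.isOpen_inter_preimage M.isOpen_carrier isOpen_Ioi

lemma isOpen_lapse_neg : IsOpen {p | p ∈ M.carrier ∧ M.lapse (vr p) < 0} :=
  continuousOn_lapse_vr.isOpen_inter_preimage M.isOpen_carrier isOpen_Iio

lemma Z_eq_inter : M.Z = M.R₀ᶜ ∩ M.carrier := by
  ext p
  rw [mem_inter_iff, mem_compl_iff, mem_R₀_iff_lapse, mem_Z_iff_lapse]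
  grind

lemma trapped_mem_nhds (hiso : M.AHiso = ∅) {p : Event} (hp : p ∈ M.Z) : M.trapped ∈ 𝓝 p := by
  obtain ⟨hc, hl⟩ := mem_Z_iff_lapse.1 hp
  rcases hl.eq_or_lt with h | h
  · exact eventually_mem_trapped hiso (mem_AH_iff_lapse.2 ⟨hc, h⟩)
  · filter_upwards [isOpen_lapse_neg.mem_nhds ⟨hc, h⟩] with p' hp'
    obtain ⟨h1, h2, h3⟩ := mem_Z_iff.1 (mem_Z_iff_lapse.2 ⟨hp'.1, hp'.2.le⟩)
    refine mem_trapped_of_fval_neg h1 h2 (lt_of_le_of_ne h3 fun h4 => ?_)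
    have h5 := hp'.2
    rw [lapse_eq, h4, mul_zero] at h5
    exact lt_irrefl _ h5

/-- From the apparent horizon one can move into `ℛ₀`. -/
lemma exists_escape (hiso : M.AHiso = ∅) {p : Event} (hp : p ∈ M.AH) :
    ∃ (γ : ℝ → Event) (s₀ : ℝ), Continuous γ ∧ γ 0 = p ∧ 0 < s₀ ∧ ∀ s ∈ Ioc 0 s₀, γ s ∈ M.R₀ := by
  obtain ⟨hpc, hr, hf⟩ := mem_AH_iff.1 hp
  have hfv := fderiv_fval_ne_zero hiso hp
  have hq := (vr_mem_spheres hr).2 hpc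
  set D := fderiv ℝ M.fval (vr p) (1, 0) with hD
  -- Motion in `t` at fixed `x` changes `v` only; with speed `D = ∂f/∂v` the derivative of `f` is
  -- `D² > 0`, whatever the sign of `D`.
  set γ : ℝ → Event := fun s => (p.1 + D * s, p.2) with hγ
  have hγc : Continuous γ := by fun_prop
  have hγ0 : γ 0 = p := by simp [hγ]
  have hvr : ∀ s, vr (γ s) = ((vr p).1 + D * s, (vr p).2) := fun s => by
    simp [hγ, vr, advTime, radius]; ring
  have hder : HasDerivAt (fun s => M.fval (vr (γ s))) (D * D) 0 := by
    have h1 : HasDerivAt (fun s : ℝ => (vr p).1 + D * s) D 0 := by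
      simpa using ((hasDerivAt_id (0 : ℝ)).const_mul D).const_add (vr p).1
    have h2 := HasDerivAt.comp_of_eq (0 : ℝ) (hasDerivAt_fval_line hq) h1 (by simp)
    refine h2.congr_of_eventuallyEq (Eventually.of_forall fun s => ?_)
    simp only [hvr, Function.comp_apply]
  have hpos : ∀ᶠ s in 𝓝[>] (0 : ℝ), 0 < M.fval (vr (γ s)) := by
    have h1 := (hasDerivAt_iff_tendsto_slope_zero.1 hder).mono_left
      (nhdsWithin_mono 0 (t := {0}ᶜ) (s := Ioi (0 : ℝ)) fun s hs => ne_of_gt hs)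
    have h2 : 0 < D * D := mul_self_pos.2 hfv
    filter_upwards [h1.eventually (lt_mem_nhds h2), self_mem_nhdsWithin] with s hs hs0
    rw [zero_add, hγ0, hf, sub_zero, smul_eq_mul] at hs
    exact (mul_pos_iff_of_pos_left (inv_pos.2 hs0)).1 hs
  have hcar : ∀ᶠ s in 𝓝[>] (0 : ℝ), γ s ∈ M.carrier := by
    have : ∀ᶠ s in 𝓝 (0 : ℝ), γ s ∈ M.carrier :=
      hγc.continuousAt.eventually (by rw [hγ0]; exact M.isOpen_carrier.mem_nhds hpc)
    exact nhdsWithin_le_nhds this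
  obtain ⟨s₀, hs₀, h⟩ := mem_nhdsGT_iff_exists_Ioc_subset.1 (hpos.and hcar)
  refine ⟨γ, s₀, hγc, hγ0, hs₀, fun s hs => mem_R₀_iff_lapse.2 ⟨(h hs).2, ?_⟩⟩
  rw [lapse_eq]
  have := M.expβ_pos (vr (γ s))
  have := (h hs).1
  positivity

lemma bdry_Z (hiso : M.AHiso = ∅) : M.bdry M.Z = M.AH := by
  ext p
  rw [bdry, frontier, mem_inter_iff, Set.mem_sdiff]
  constructor
  · rintro ⟨⟨h1, h2⟩, hc⟩
    have hZ : p ∈ M.Z := by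
      rw [Z_eq_inter]
      refine ⟨?_, hc⟩
      have h3 : closure M.Z ⊆ M.R₀ᶜ := by
        refine closure_minimal ?_ isOpen_R₀.isClosed_compl
        rw [Z_eq_inter]; exact inter_subset_left
      exact h3 h1
    obtain ⟨-, hl⟩ := mem_Z_iff_lapse.1 hZ
    refine mem_AH_iff_lapse.2 ⟨hc, hl.eq_of_not_lt fun hlt => h2 ?_⟩
    refine mem_interior.2 ⟨_, fun x hx => mem_Z_iff_lapse.2 ⟨hx.1, hx.2.le⟩, isOpen_lapse_neg, hc, hlt⟩
  · intro hp
    refine ⟨⟨subset_closure (AH_subset_Z hp), fun hint => ?_⟩, (mem_AH_iff.1 hp).1⟩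
    obtain ⟨γ, s₀, hγ, h0, hs₀, hR⟩ := exists_escape hiso hp
    have h1 : ∀ᶠ s in 𝓝[>] (0 : ℝ), γ s ∈ M.Z := nhdsWithin_le_nhds
      (hγ.continuousAt.eventually (by rw [h0]; exact mem_interior_iff_mem_nhds.1 hint))
    have h2 : ∀ᶠ s in 𝓝[>] (0 : ℝ), s ∈ Ioc 0 s₀ := Ioc_mem_nhdsGT hs₀
    obtain ⟨s, h3, h4⟩ := (h1.and h2).exists
    exact (hR s h4).2 h3

end SphSpacetime

/-! ### Trapped surfaces that meet `𝒵` only near a given horizon event. -/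

/-- The profile `∑_{j<n} z^{j+1} / ((j+1)(n+1))`, `z = (1+c)/2`. -/
noncomputable def capProfile (n : ℕ) (c : ℝ) : ℝ :=
  ∑ j ∈ Finset.range n, ((1 + c) / 2) ^ (j + 1) / ((j + 1) * (n + 1))

noncomputable def capProfile' (n : ℕ) (c : ℝ) : ℝ :=
  ∑ j ∈ Finset.range n, ((1 + c) / 2) ^ j / (2 * (n + 1))

noncomputable def capProfile'' (n : ℕ) (c : ℝ) : ℝ :=
  ∑ j ∈ Finset.range n, j * ((1 + c) / 2) ^ (j - 1) / (4 * (n + 1))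

lemma hasDerivAt_half (c : ℝ) : HasDerivAt (fun c : ℝ => (1 + c) / 2) (1 / 2) c :=
  ((hasDerivAt_id c).const_add 1).div_const 2

lemma hasDerivAt_capProfile (n : ℕ) (c : ℝ) :
    HasDerivAt (capProfile n) (capProfile' n c) c := by
  refine HasDerivAt.fun_sum fun j _ => ?_
  refine (((hasDerivAt_half c).fun_pow (j + 1)).div_const _).congr_deriv ?_
  have : (j : ℝ) + 1 ≠ 0 := by positivity
  simp
  field_simp

lemma hasDerivAt_capProfile' (n : ℕ) (c : ℝ) :
    HasDerivAt (capProfile' n) (capProfile'' n c) c := by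
  refine HasDerivAt.fun_sum fun j _ => ?_
  refine (((hasDerivAt_half c).fun_pow j).div_const _).congr_deriv ?_
  field_simp
  ring

/-- In `z = (1+c)/2` the Laplacian is `d/dz (z (1-z) d/dz)`, so it sends `z^(j+1)/(j+1)` to `(j+1)
z^j - (j+2) z^(j+1)`, and the sum telescopes. The constant `1/(n+1)` is the mean of `z^n` over the
sphere. -/
lemma capProfile_identity (n : ℕ) (c : ℝ) :
    (1 - c ^ 2) * capProfile'' n c - 2 * c * capProfile' n c =
      1 / (n + 1) - ((1 + c) / 2) ^ n := by
  set z := (1 + c) / 2 with hz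
  have hc : c = 2 * z - 1 := by rw [hz]; ring
  have key : ∀ k : ℕ, ∑ j ∈ Finset.range k, ((j + 1) * z ^ j - (j + 2) * z ^ (j + 1))
      = 1 - (k + 1) * z ^ k := by
    intro k
    induction k with
    | zero => simp
    | succ k ih => rw [Finset.sum_range_succ, ih]; push_cast; ring
  have h1 : (1 - c ^ 2) * capProfile'' n c - 2 * c * capProfile' n c =
      (∑ j ∈ Finset.range n, ((j + 1) * z ^ j - (j + 2) * z ^ (j + 1))) / (n + 1) := by
    rw [capProfile'', capProfile', Finset.mul_sum, Finset.mul_sum, ← Finset.sum_sub_distrib,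
      Finset.sum_div]
    refine Finset.sum_congr rfl fun j _ => ?_
    rw [← hz, hc]
    rcases j with _ | j
    · field_simp
      simp
      ring
    · have hn : (n : ℝ) + 1 ≠ 0 := by positivity
      simp only [Nat.add_sub_cancel]
      push_cast
      field_simp
      ring
  rw [h1, key, sub_div]
  field_simp

namespace SphSpacetime
variable {M : SphSpacetime}

/-- Every event of the apparent horizon is approached by closed f-trapped surfaces that meet `𝒵`
only nearby. -/
theorem exists_localized_surface (hiso : M.AHiso = ∅) {p : Event} (hp : p ∈ M.AH) {O : Set Event}
    (hO : O ∈ 𝓝 p) : ∃ S, M.IsClosedFTrapped S ∧ S ∩ M.Z ⊆ O ∧ (S ∩ O).Nonempty := by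
  obtain ⟨hpc, hr, hf⟩ := mem_AH_iff.1 hp
  have hfv := fderiv_fval_ne_zero hiso hp
  have hq := (vr_mem_spheres hr).2 hpc
  have hp2 := radius_pos.1 hr
  have hpn : ‖p.2‖ ≠ 0 := by simpa using hp2
  set q := vr p with hqdef
  have hq2 : 0 < q.2 := hr
  set e : E3 := ‖p.2‖⁻¹ • p.2 with he
  have hen : ‖e‖ = 1 := by simp [he, norm_smul, hpn]
  set Φ : (ℝ × ℝ) × E3 → Event := fun a => (a.1.1 - a.1.2, a.1.2 • a.2) with hΦ
  have hΦc : Continuous Φ := by fun_prop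
  have hΦp : Φ (q, e) = p := by
    ext1
    · simp [hΦ, hqdef, vr, advTime, radius]
    · simp [hΦ, hqdef, vr, radius, he, smul_smul, hpn]
  obtain ⟨η, hη, hηO⟩ := Metric.mem_nhds_iff.1
    (hΦc.continuousAt.preimage_mem_nhds (show O ∈ 𝓝 (Φ (q, e)) by rwa [hΦp]))
  -- Chosen so that `(1+c)/2 > 1 - δ` implies `‖x/|x| - e‖² = 2 - 2c < 4δ ≤ η²`.
  set δ := min (η ^ 2 / 4) (1 / 2) with hδ
  have hδ0 : 0 < δ := by positivity
  have hδ1 : δ ≤ 1 / 2 := min_le_right _ _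
  have hδη : 4 * δ ≤ η ^ 2 := by linarith [min_le_left (η ^ 2 / 4) (1 / 2)]
  obtain ⟨n, hn⟩ : ∃ n : ℕ, (1 - δ) ^ n * (4 * (n + 1)) ≤ 1 := by
    have h1 := tendsto_self_mul_const_pow_of_lt_one (r := 1 - δ) (by linarith) (by linarith)
    have h2 := tendsto_pow_atTop_nhds_zero_of_lt_one (r := 1 - δ) (by linarith) (by linarith)
    have h3 := (h1.const_mul 4).add (h2.const_mul 4)
    obtain ⟨n, hn⟩ := (h3.eventually (Iio_mem_nhds (show (4 * 0 + 4 * 0 : ℝ) < 1 by norm_num))).exists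
    have hn' : 4 * (n * (1 - δ) ^ n) + 4 * (1 - δ) ^ n < 1 := hn
    exact ⟨n, by linarith⟩
  have hn0 : (0 : ℝ) < n + 1 := by positivity
  set κ := 1 / (4 * (n + 1) * q.2) with hκ
  have hκ0 : 0 < κ := by positivity
  set fv := fderiv ℝ M.fval q (1, 0) with hfvd
  set fr := fderiv ℝ M.fval q (0, 1) with hfrd
  -- Solves `df(y, H) = (1/(2(n+1)) - z^n) / r`, which lies below `ΔH / r` by `2κ`.
  set y : ℝ → ℝ := fun c =>
    ((1 / (2 * (n + 1)) - ((1 + c) / 2) ^ n) / q.2 - capProfile n c * fr) / fv with hy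
  have hHd : ContDiff ℝ 3 (capProfile n) := by
    unfold capProfile
    fun_prop
  have hyd : ContDiff ℝ 4 y := by
    simp only [hy]
    unfold capProfile
    fun_prop
  have hyd1 : ContDiff ℝ 3 (deriv y) := ContDiff.deriv' hyd
  have hyd2 : ContDiff ℝ 2 (deriv (deriv y)) := ContDiff.deriv' hyd1
  have hval : ∀ c, fderiv ℝ M.fval q (y c, capProfile n c) =
      (1 / (2 * (n + 1)) - ((1 + c) / 2) ^ n) / q.2 := by
    intro c
    rw [clm_prod_apply, ← hfvd, ← hfrd, hy, div_mul_cancel₀ _ hfv]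
    ring
  obtain ⟨ε₀, hε₀, H⟩ := exists_trapped_deformation hq hf (H := capProfile n)
    (H' := capProfile' n) (H'' := capProfile'' n) (y := y) (y' := deriv y) (y'' := deriv (deriv y))
    hHd (hyd.of_le (by norm_num)) (hasDerivAt_capProfile n) (hasDerivAt_capProfile' n)
    (fun x => (hyd.differentiable (by norm_num) x).hasDerivAt)
    (fun x => (hyd1.differentiable (by norm_num) x).hasDerivAt)
    (by unfold capProfile'; fun_prop) (by unfold capProfile''; fun_prop)
    hyd1.continuous hyd2.continuous hκ0 (by
      intro c _
      rw [hval, capProfile_identity]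
      have h1 : 1 / (2 * ((n : ℝ) + 1)) = 1 / (n + 1) - 2 * (1 / (4 * (n + 1))) := by
        field_simp
        ring
      have h2 : κ = 1 / (4 * ((n : ℝ) + 1)) / q.2 := by rw [hκ, div_div]
      rw [h2, ← add_div]
      have h3 : 0 < 1 / (4 * ((n : ℝ) + 1)) := by positivity
      gcongr
      linarith)
  obtain ⟨B, hB0, hB⟩ := exists_bound_Icc (g := fun c => ‖(y c, capProfile n c)‖)
    (hyd.continuous.prodMk hHd.continuous).norm
  set ε := min (ε₀ / 2) (min (η / (2 * (B + 1))) (q.2 / (2 * (B + 1)))) with hε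
  have hε0 : 0 < ε := by positivity
  have hεB : ∀ a, ε ≤ a / (2 * (B + 1)) → 0 < a → ε * B < a := by
    intro a h1 h2
    rw [le_div_iff₀ (by positivity)] at h1
    nlinarith
  have hεη : ε * B < η := hεB _ ((min_le_right _ _).trans (min_le_left _ _)) hη
  have hεq : ε * B < q.2 := hεB _ ((min_le_right _ _).trans (min_le_right _ _)) hq2
  obtain ⟨hS, hlow⟩ := (H ε hε0 (by
    have := min_le_left (ε₀ / 2) (min (η / (2 * (B + 1))) (q.2 / (2 * (B + 1))))
    linarith)).self_of_nhds e hen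
  have hsmall : ∀ c ∈ Icc (-1 : ℝ) 1, ‖(ε * y c, ε * capProfile n c)‖ ≤ ε * B := by
    intro c hc
    have h1 : (ε * y c, ε * capProfile n c) = ε • (y c, capProfile n c) := rfl
    have h2 := hB c hc
    rw [abs_norm] at h2
    rw [h1, norm_smul, Real.norm_eq_abs, abs_of_pos hε0]
    gcongr
  have hpos : ∀ c ∈ Icc (-1 : ℝ) 1, 0 < q.2 + ε * capProfile n c := by
    intro c hc
    have h1 := (norm_snd_le (ε * y c, ε * capProfile n c)).trans (hsmall c hc)
    have h2 := (abs_le.1 h1).1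
    simp only at h2
    linarith
  set h : ℝ → ℝ := fun c => q.2 + ε * capProfile n c with hh
  set Y : ℝ → ℝ := fun c => q.1 + ε * y c with hY
  have hmem : ∀ x : E3, x ≠ 0 → ‖‖x‖⁻¹ • x - e‖ < η → graphMap e h Y x ∈ O := by
    intro x hx hxe
    have hc := cosAng_mem hen x
    have h1 : graphMap e h Y x = Φ ((Y (cosAng e x), h (cosAng e x)), ‖x‖⁻¹ • x) := by
      simp [graphMap, hΦ, smul_smul, div_eq_mul_inv]
    rw [h1]
    refine hηO ?_
    rw [Metric.mem_ball, Prod.dist_eq, max_lt_iff, dist_eq_norm, dist_eq_norm]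
    refine ⟨?_, hxe⟩
    have h2 : (Y (cosAng e x), h (cosAng e x)) - q =
        (ε * y (cosAng e x), ε * capProfile n (cosAng e x)) := by
      ext <;> simp [hY, hh]
    change ‖(Y (cosAng e x), h (cosAng e x)) - q‖ < η
    rw [h2]
    exact (hsmall _ hc).trans_lt hεη
  refine ⟨graphSurf e h Y, hS, ?_, ?_⟩
  · rintro _ ⟨⟨x, hx, rfl⟩, hZ⟩
    have hx0 : x ≠ 0 := hx
    have hxn : 0 < ‖x‖ := norm_pos_iff.2 hx0
    have hc := cosAng_mem hen x
    refine hmem x hx0 ?_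
    have hfl := hlow _ hc
    have hZf := (mem_Z_iff.1 hZ).2.2
    rw [vr, advTime_graphMap hx0 (hpos _ hc), radius_graphMap hx0 (hpos _ hc)] at hZf
    set c := cosAng e x with hcd
    have h1 : fderiv ℝ M.fval q (y c, capProfile n c) - κ < 0 := by
      by_contra hcon
      have := mul_nonneg hε0.le (not_lt.1 hcon)
      linarith
    -- On the surface `f` exceeds `ε (1/(4(n+1)) - z^n) / r`. Hence `f ≤ 0` forces `z^n` above the
    -- threshold, which the choice of `n` allows only near the pole.
    have h2 : 1 / (4 * (n + 1)) < ((1 + c) / 2) ^ n := by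
      rw [hval, hκ] at h1
      have h3 : (1 / (2 * (n + 1)) - ((1 + c) / 2) ^ n) / q.2 - 1 / (4 * (n + 1) * q.2)
          = (1 / (4 * (n + 1)) - ((1 + c) / 2) ^ n) / q.2 := by
        field_simp
        ring
      rw [h3, div_lt_iff₀ hq2, zero_mul] at h1
      linarith
    have h3 : 1 - δ < (1 + c) / 2 := by
      by_contra hcon
      have h4 : ((1 + c) / 2) ^ n ≤ (1 - δ) ^ n :=
        pow_le_pow_left₀ (by linarith [hc.1]) (not_lt.1 hcon) n
      have h5 : (1 - δ) ^ n ≤ 1 / (4 * (n + 1)) := by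
        rw [le_div_iff₀ (by positivity)]; exact hn
      linarith
    have h4 : ‖‖x‖⁻¹ • x - e‖ ^ 2 = 2 - 2 * c := by
      rw [norm_sub_sq_real, hen, real_inner_comm, inner_smul_right, norm_smul, hcd, cosAng]
      simp [hxn.ne']
      field_simp
      ring
    exact lt_of_pow_lt_pow_left₀ 2 hη.le (by linarith)
  · refine ⟨graphMap e h Y p.2, ⟨p.2, hp2, rfl⟩, hmem _ hp2 ?_⟩
    simpa [he] using hη

end SphSpacetime

/-! ### Removability and minimality of `𝒵 ∩ T₁`. -/

lemma inter_frontier_nonempty {X : Type*} [TopologicalSpace X] {s t : Set X}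
    (hs : IsPreconnected s) (h : (s ∩ t).Nonempty) (h' : (s ∩ tᶜ).Nonempty) :
    (s ∩ frontier t).Nonempty := by
  by_contra hcon
  have key : ∀ x ∈ s, x ∈ closure t → x ∈ interior t := fun x hx hc => by
    by_contra hi
    exact hcon ⟨x, hx, hc, hi⟩
  obtain ⟨x, hx, hxt⟩ := h
  obtain ⟨y, hy, hyt⟩ := h'
  obtain ⟨z, -, hz, hz'⟩ := hs (interior t) (closure t)ᶜ isOpen_interior isClosed_closure.isOpen_compl
    (fun z hz => (em (z ∈ closure t)).imp (key z hz) id) ⟨x, hx, key x hx (subset_closure hxt)⟩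
    ⟨y, hy, fun hc => hyt (interior_subset (key y hy hc))⟩
  exact hz' (subset_closure (interior_subset hz))

namespace SphSpacetime
variable {M : SphSpacetime}

lemma trapped_subset_carrier : M.trapped ⊆ M.carrier := fun _ ⟨_, hS, hp⟩ => hS.1 hp

lemma Z_subset_trapped (hiso : M.AHiso = ∅) : M.Z ⊆ M.trapped :=
  fun _ hp => mem_of_mem_nhds (trapped_mem_nhds hiso hp)

variable {T₁ : Set Event}

lemma IsTrappedComponent.subset_trapped (hT : M.IsTrappedComponent T₁) : T₁ ⊆ M.trapped := by
  obtain ⟨p, -, rfl⟩ := hT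
  exact connectedComponentIn_subset _ _

lemma IsTrappedComponent.eq_of_mem (hT : M.IsTrappedComponent T₁) {x : Event} (hx : x ∈ T₁) :
    T₁ = connectedComponentIn M.trapped x := by
  obtain ⟨p, -, rfl⟩ := hT
  exact connectedComponentIn_eq hx

lemma IsTrappedComponent.nonempty (hT : M.IsTrappedComponent T₁) : T₁.Nonempty := by
  obtain ⟨p, hp, rfl⟩ := hT
  exact ⟨p, mem_connectedComponentIn hp⟩

lemma IsTrappedComponent.subset_of_isPreconnected (hT : M.IsTrappedComponent T₁) {K : Set Event}
    (hK : IsPreconnected K) (hKt : K ⊆ M.trapped) (hm : (K ∩ T₁).Nonempty) : K ⊆ T₁ := by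
  obtain ⟨x, hxK, hxT⟩ := hm
  rw [hT.eq_of_mem hxT]
  exact hK.subset_connectedComponentIn hxK hKt

/-- Local connectedness passes the neighbourhood property from the trapped region to its component;
openness of the trapped region away from `𝒵` is not needed. -/
lemma IsTrappedComponent.mem_nhds (hT : M.IsTrappedComponent T₁) (hiso : M.AHiso = ∅) {x : Event}
    (hx : x ∈ M.Z ∩ T₁) : T₁ ∈ 𝓝 x := by
  rw [hT.eq_of_mem hx.2]
  exact connectedComponentIn_mem_nhds (trapped_mem_nhds hiso hx.1)

lemma IsTrappedComponent.mem_of_mem_closure (hT : M.IsTrappedComponent T₁) (hiso : M.AHiso = ∅)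
    {x : Event} (hx : x ∈ M.Z) (hcl : x ∈ closure T₁) : x ∈ T₁ := by
  have h1 := connectedComponentIn_mem_nhds (trapped_mem_nhds hiso hx)
  refine hT.subset_of_isPreconnected isPreconnected_connectedComponentIn
    (connectedComponentIn_subset _ _) (mem_closure_iff_nhds.1 hcl _ h1)
    (mem_connectedComponentIn (Z_subset_trapped hiso hx))

lemma IsTrappedComponent.Z_inter_eq (hT : M.IsTrappedComponent T₁) (hiso : M.AHiso = ∅) :
    M.Z ∩ T₁ = (M.R₀ᶜ ∩ closure T₁) ∩ M.carrier := by
  ext x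
  constructor
  · rintro ⟨h1, h2⟩
    rw [Z_eq_inter] at h1
    exact ⟨⟨h1.1, subset_closure h2⟩, h1.2⟩
  · rintro ⟨⟨h1, h2⟩, h3⟩
    have hZ : x ∈ M.Z := by rw [Z_eq_inter]; exact ⟨h1, h3⟩
    exact ⟨hZ, hT.mem_of_mem_closure hiso hZ h2⟩

lemma isClosed_compl_R₀_inter_closure : IsClosed (M.R₀ᶜ ∩ closure T₁) :=
  isOpen_R₀.isClosed_compl.inter isClosed_closure

lemma IsTrappedComponent.isOpen_excised (hT : M.IsTrappedComponent T₁) (hiso : M.AHiso = ∅) :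
    IsOpen (M.carrier \ (M.Z ∩ T₁)) := by
  have : M.carrier \ (M.Z ∩ T₁) = M.carrier ∩ (M.R₀ᶜ ∩ closure T₁)ᶜ := by
    rw [hT.Z_inter_eq hiso]
    ext x
    simp only [Set.mem_sdiff, mem_inter_iff, mem_compl_iff]
    grind
  rw [this]
  exact M.isOpen_carrier.inter isClosed_compl_R₀_inter_closure.isOpen_compl

lemma IsTrappedComponent.not_mem_bdry (hT : M.IsTrappedComponent T₁) (hiso : M.AHiso = ∅)
    {x : Event} (hx : x ∈ M.Z ∩ T₁) : x ∉ M.bdry T₁ := fun h =>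
  h.1.2 (mem_interior_iff_mem_nhds.2 (hT.mem_nhds hiso hx))

lemma IsTrappedComponent.bdry_Z_inter (hT : M.IsTrappedComponent T₁) (hiso : M.AHiso = ∅) :
    M.bdry (M.Z ∩ T₁) = M.AH ∩ T₁ := by
  ext x
  constructor
  · rintro ⟨⟨h1, h2⟩, hc⟩
    have hx : x ∈ M.Z ∩ T₁ := by
      rw [hT.Z_inter_eq hiso]
      refine ⟨closure_minimal ?_ isClosed_compl_R₀_inter_closure h1, hc⟩
      rw [hT.Z_inter_eq hiso]
      exact inter_subset_left
    refine ⟨?_, hx.2⟩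
    rw [← bdry_Z hiso]
    refine ⟨⟨subset_closure hx.1, fun h => h2 ?_⟩, hc⟩
    rw [interior_inter]
    exact ⟨h, mem_interior_iff_mem_nhds.2 (hT.mem_nhds hiso hx)⟩
  · rintro ⟨h1, h2⟩
    have h3 := h1
    rw [← bdry_Z hiso] at h3
    exact ⟨⟨subset_closure ⟨AH_subset_Z h1, h2⟩,
      fun h => h3.1.2 (interior_mono inter_subset_left h)⟩, h3.2⟩

/-- Every component of the excised spacetime reaches the boundary of `T₁`. -/
lemma IsTrappedComponent.component_inter_bdry (hT : M.IsTrappedComponent T₁)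
    (hroom : M.LeavesRoom T₁) (hiso : M.AHiso = ∅) {x : Event}
    (hx : x ∈ M.carrier \ (M.Z ∩ T₁)) :
    (connectedComponentIn (M.carrier \ (M.Z ∩ T₁)) x ∩ M.bdry T₁).Nonempty := by
  set W := M.carrier \ (M.Z ∩ T₁) with hW
  set C := connectedComponentIn W x with hC
  have hCW : C ⊆ W := connectedComponentIn_subset _ _
  have hCo : IsOpen C := (hT.isOpen_excised hiso).connectedComponentIn
  have hxC : x ∈ C := mem_connectedComponentIn hx
  have hCc : IsPreconnected C := isPreconnected_connectedComponentIn
  -- Otherwise `C` has a boundary point in the connected spacetime. Being outside `C`, it is outside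
  -- the excised spacetime, hence lies in `𝒵 ∩ T₁`, and `T₁` is a neighbourhood of it that meets
  -- `C`.
  have hmeet : (C ∩ T₁).Nonempty := by
    by_contra hdis
    obtain ⟨t, ht⟩ := hT.nonempty
    have htc := trapped_subset_carrier (hT.subset_trapped ht)
    have htC : t ∉ C := fun h => hdis ⟨t, h, ht⟩
    obtain ⟨y, hyV, hyf⟩ := inter_frontier_nonempty M.isConnected_carrier.isPreconnected
      ⟨x, hx.1, hxC⟩ ⟨t, htc, htC⟩
    have hyC : y ∉ C := fun h => hyf.2 (hCo.interior_eq.symm ▸ h)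
    have hyW : y ∉ W := by
      intro hyW
      refine hyC ?_
      have h1 : IsPreconnected (insert y C) := hCc.subset_closure (subset_insert _ _)
        (insert_subset hyf.1 subset_closure)
      exact h1.subset_connectedComponentIn (mem_insert_of_mem _ hxC)
        (insert_subset hyW hCW) (mem_insert _ _)
    have hyZ : y ∈ M.Z ∩ T₁ := by
      by_contra h
      exact hyW ⟨hyV, h⟩
    obtain ⟨z, hz⟩ := mem_closure_iff_nhds.1 hyf.1 _ (hT.mem_nhds hiso hyZ)
    exact hdis ⟨z, hz.2, hz.1⟩
  -- Otherwise `x` lies in `ℛ₀`, and its component there is contained in `C`, hence in `T₁`.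
  have hmeet' : (C ∩ T₁ᶜ).Nonempty := by
    by_contra hdis
    have hsub : C ⊆ T₁ := fun z hz => by
      by_contra h
      exact hdis ⟨z, hz, h⟩
    have hxR : x ∈ M.R₀ := ⟨hx.1, fun h => hx.2 ⟨h, hsub hxC⟩⟩
    refine hroom x hxR (Subset.trans ?_ hsub)
    refine isPreconnected_connectedComponentIn.subset_connectedComponentIn
      (mem_connectedComponentIn hxR) ((connectedComponentIn_subset _ _).trans ?_)
    exact fun z hz => ⟨hz.1, fun h => hz.2 h.1⟩
  obtain ⟨y, hyC, hyf⟩ := inter_frontier_nonempty hCc hmeet hmeet'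
  exact ⟨y, hyC, hyf, (hCW hyC).1⟩

lemma IsTrappedComponent.exists_path (hT : M.IsTrappedComponent T₁)
    (hroom : M.LeavesRoom T₁) (hiso : M.AHiso = ∅) {x : Event}
    (hx : x ∈ M.carrier \ (M.Z ∩ T₁)) :
    ∃ c : ℝ → Event, Continuous c ∧ c 0 = x ∧ c 1 ∈ M.bdry T₁ ∧
      ∀ s, c s ∈ M.carrier \ (M.Z ∩ T₁) := by
  obtain ⟨y, hyC, hyb⟩ := hT.component_inter_bdry hroom hiso hx
  have hCo := (hT.isOpen_excised hiso).connectedComponentIn (x := x)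
  have hcon : IsConnected (connectedComponentIn (M.carrier \ (M.Z ∩ T₁)) x) :=
    isConnected_connectedComponentIn_iff.2 hx
  have hpath := hCo.isConnected_iff_isPathConnected.1 hcon
  obtain ⟨P, hP⟩ := hpath.joinedIn x (mem_connectedComponentIn hx) y hyC
  refine ⟨P.extend, P.continuous_extend, P.extend_zero, by rw [P.extend_one]; exact hyb,
    fun s => connectedComponentIn_subset _ x ?_⟩
  exact hP _

lemma IsTrappedComponent.joinedToBdry (hT : M.IsTrappedComponent T₁)
    (hroom : M.LeavesRoom T₁) (hiso : M.AHiso = ∅) {x : Event}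
    (hx : x ∈ closure (M.carrier \ (M.Z ∩ T₁)) ∩ M.carrier) :
    M.JoinedToBdry T₁ (M.Z ∩ T₁) x := by
  refine Or.inr ?_
  -- A point of `𝒵 ∩ T₁` that is a limit of the excised spacetime lies on `AH`. A short curve into
  -- `ℛ₀` is then followed by a curve in the excised spacetime.
  by_cases hxZ : x ∈ M.Z ∩ T₁
  · have hAH : x ∈ M.AH := by
      have : x ∈ M.bdry (M.Z ∩ T₁) := by
        refine ⟨⟨subset_closure hxZ, fun hint => ?_⟩, hx.2⟩
        obtain ⟨z, hz1, hz2⟩ := mem_closure_iff_nhds.1 hx.1 _ (mem_interior_iff_mem_nhds.1 hint)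
        exact hz2.2 hz1
      rw [hT.bdry_Z_inter hiso] at this
      exact this.1
    obtain ⟨γ, s₀, hγ, hγ0, hs₀, hR⟩ := exists_escape hiso hAH
    have hRW : ∀ z ∈ M.R₀, z ∈ M.carrier \ (M.Z ∩ T₁) := fun z hz => ⟨hz.1, fun h => hz.2 h.1⟩
    obtain ⟨c, hc, hc0, hc1, hcW⟩ := hT.exists_path hroom hiso (hRW _ (hR s₀ ⟨hs₀, le_rfl⟩))
    refine ⟨fun s => if s ≤ 1 / 2 then γ (2 * s * s₀) else c (2 * s - 1), ?_, ?_, ?_, ?_⟩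
    · refine (Continuous.if_le (by fun_prop) (by fun_prop) continuous_id continuous_const
        ?_).continuousOn
      intro s hs
      have h1 : 2 * s * s₀ = s₀ := by
        have : s = 1 / 2 := hs
        rw [this]; ring
      have h2 : 2 * s - 1 = 0 := by
        have : s = 1 / 2 := hs
        rw [this]; ring
      rw [h1, h2, hc0]
    · simp [hγ0]
    · norm_num
      exact hc1
    · intro s hs
      by_cases h : s ≤ 1 / 2
      · simp only [h, if_true]
        refine hRW _ (hR _ ⟨by have := hs.1; positivity, ?_⟩)
        nlinarith
      · simp only [h, if_false]
        exact hcW _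
  · obtain ⟨c, hc, hc0, hc1, hcW⟩ := hT.exists_path hroom hiso ⟨hx.2, hxZ⟩
    exact ⟨c, hc.continuousOn, hc0, hc1, fun s _ => hcW s⟩

theorem IsTrappedComponent.isRemovable (hT : M.IsTrappedComponent T₁)
    (hroom : M.LeavesRoom T₁) (hiso : M.AHiso = ∅) : M.IsRemovable T₁ (M.Z ∩ T₁) := by
  refine ⟨⟨_, isClosed_compl_R₀_inter_closure, hT.Z_inter_eq hiso⟩, fun S hS hST => ?_,
    fun x hx => hT.joinedToBdry hroom hiso hx⟩
  obtain ⟨-, -, -, -, -, -, -, p, hp, hZ, -⟩ := exists_supporting_curve hS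
  exact ⟨p, hp, hZ, hST hp⟩

theorem IsTrappedComponent.eq_of_isRemovable (hT : M.IsTrappedComponent T₁)
    (hiso : M.AHiso = ∅) {Z' : Set Event} (hZ' : Z' ⊆ M.Z ∩ T₁) (hrem : M.IsRemovable T₁ Z') :
    Z' = M.Z ∩ T₁ := by
  refine Subset.antisymm hZ' fun x hx => ?_
  by_contra hxZ'
  obtain ⟨⟨F, hF, hFZ⟩, hsurf, hjoin⟩ := hrem
  have hxV : x ∈ M.carrier := (mem_Z_iff.1 hx.1).1
  obtain h | ⟨c, hc, hc0, hc1, hcV⟩ := hjoin x ⟨subset_closure ⟨hxV, hxZ'⟩, hxV⟩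
  · exact hT.not_mem_bdry hiso hx h
  have hc1Z : c 1 ∉ M.Z ∩ T₁ := fun h => hT.not_mem_bdry hiso h hc1
  -- The curve starts in `𝒵 ∩ T₁` and ends outside it, so it crosses the boundary, at an event of
  -- `AH` that avoids `Z'`.
  obtain ⟨y, ⟨s, hs, rfl⟩, hyf⟩ := inter_frontier_nonempty
    (isPreconnected_Icc.image c hc) (t := M.Z ∩ T₁) ⟨c 0, mem_image_of_mem c (by simp), hc0 ▸ hx⟩
    ⟨c 1, mem_image_of_mem c (by simp), hc1Z⟩
  have hcs : c s ∈ M.carrier := by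
    rcases hs.1.eq_or_lt with h | h
    · rw [← h, hc0]; exact hxV
    rcases hs.2.eq_or_lt with h' | h'
    · rw [h']; exact hc1.2
    · exact (hcV s ⟨h, h'⟩).1
  have hAH : c s ∈ M.AH ∩ T₁ := by
    rw [← hT.bdry_Z_inter hiso]; exact ⟨hyf, hcs⟩
  have hsZ' : c s ∉ Z' := by
    rcases hs.1.eq_or_lt with h | h
    · rw [← h, hc0]; exact hxZ'
    rcases hs.2.eq_or_lt with h' | h'
    · rw [h'] at hAH
      exact absurd ⟨AH_subset_Z hAH.1, hAH.2⟩ hc1Z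
    · exact (hcV s ⟨h, h'⟩).2
  have hsF : c s ∉ F := fun h => hsZ' (hFZ ▸ ⟨h, hcs⟩)
  -- The neighbourhood avoids the closed set `F` and lies in `T₁`. The surface therefore belongs to
  -- `T₁` by connectedness, yet its intersection with `𝒵`, hence any intersection with `Z'`, avoids
  -- `F`.
  obtain ⟨S, hS, hSO, hSne⟩ := exists_localized_surface hiso hAH.1
    (inter_mem (hF.isOpen_compl.mem_nhds hsF) (hT.mem_nhds hiso ⟨AH_subset_Z hAH.1, hAH.2⟩))
  have hST : S ⊆ T₁ := hT.subset_of_isPreconnected hS.2.2.1.isPreconnected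
    (fun z hz => ⟨S, hS, hz⟩) (hSne.mono fun z hz => ⟨hz.1, hz.2.2⟩)
  obtain ⟨w, hwS, hwZ'⟩ := hsurf S hS hST
  have h1 := hSO ⟨hwS, (hZ' hwZ').1⟩
  rw [hFZ] at hwZ'
  exact h1.1 hwZ'.1

theorem IsTrappedComponent.isCore (hT : M.IsTrappedComponent T₁) (hroom : M.LeavesRoom T₁)
    (hiso : M.AHiso = ∅) {Z₁ : Set Event} (hZ : M.IsZComponent Z₁) (h : M.Z ∩ T₁ = Z₁) :
    M.IsCore T₁ Z₁ ∧ M.bdry Z₁ = M.AH ∩ Z₁ := by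
  obtain ⟨p, hp, hZp⟩ := hZ
  refine ⟨⟨?_, h ▸ hT.isRemovable hroom hiso, ?_⟩, ?_⟩
  · rw [hZp]
    exact isConnected_connectedComponentIn_iff.2 hp
  · rintro Z' hZ' - hrem
    rw [← h] at hZ' ⊢
    exact hT.eq_of_isRemovable hiso hZ' hrem
  · rw [← h, hT.bdry_Z_inter hiso, ← inter_assoc, inter_eq_left.2 AH_subset_Z]

end SphSpacetime

/-! ### Imploding spacetimes. -/

namespace SphSpacetime
variable {M : SphSpacetime}

lemma exists_event_of_mem_spheres {q : ℝ × ℝ} (hq : q ∈ M.spheres) :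
    ∃ p ∈ M.carrier, vr p = q := by
  obtain ⟨-, x, hx, hxc⟩ := hq
  exact ⟨_, hxc, by ext <;> simp [vr, advTime, radius, hx]⟩

lemma IsImploding.fderiv_fval_neg (him : M.IsImploding) (hiso : M.AHiso = ∅) {q : ℝ × ℝ}
    (hq : q ∈ M.spheres) (hf : M.fval q = 0) : fderiv ℝ M.fval q (1, 0) < 0 := by
  obtain ⟨p, hp, rfl⟩ := exists_event_of_mem_spheres hq
  have hAH : p ∈ M.AH := mem_AH_iff.2 ⟨hp, hq.1, hf⟩
  have h1 := him.influx p hAH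
  have h2 := massFlux_eq hq
  refine lt_of_le_of_ne ?_ (fderiv_fval_ne_zero hiso hAH)
  have h3 : 0 < (vr p).2 := hq.1
  change 0 ≤ M.massFlux (vr p).1 (vr p).2 at h1
  rw [h2] at h1
  by_contra hcon
  have := mul_pos (half_pos h3) (not_le.1 hcon)
  linarith

/-- In an imploding spacetime the condition `2m < r` persists to the past along `r = const`. -/
lemma IsImploding.fval_pos_of_le (him : M.IsImploding) (hiso : M.AHiso = ∅) {v v' r : ℝ}
    (hq : (v, r) ∈ M.spheres) (hf : 0 < M.fval (v, r)) (hv : v' ≤ v) : 0 < M.fval (v', r) := by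
  by_contra hcon
  have hder : ∀ w ≤ v, HasDerivAt (fun w => M.fval (w, r)) (fderiv ℝ M.fval (w, r) (1, 0)) w :=
    fun w hw => hasDerivAt_fval_line (him.extends_to_past v w r hw hq)
  have hcont : ContinuousOn (fun w => M.fval (w, r)) (Icc v' v) := fun w hw =>
    (hder w hw.2).continuousAt.continuousWithinAt
  have hcomp : IsCompact (Icc v' v ∩ (fun w => M.fval (w, r)) ⁻¹' Iic 0) :=
    isCompact_Icc.of_isClosed_subset (hcont.preimage_isClosed_of_isClosed isClosed_Icc isClosed_Iic)
      inter_subset_left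
  -- At the last parameter `s` with `f ≤ 0`, either `f < 0` or `f = 0` with negative derivative; in
  -- both cases `f ≤ 0` persists just after `s`.
  obtain ⟨s, ⟨hs, hs0⟩, hgr⟩ := hcomp.exists_isGreatest ⟨v', ⟨le_rfl, hv⟩, not_lt.1 hcon⟩
  have hs0 : M.fval (s, r) ≤ 0 := hs0
  have hsv : s < v := lt_of_le_of_ne hs.2 fun h => by rw [h] at hs0; linarith
  have hev : ∀ᶠ w in 𝓝[>] s, M.fval (w, r) ≤ 0 := by
    rcases hs0.eq_or_lt with h | h
    · have hneg := him.fderiv_fval_neg hiso (him.extends_to_past v s r hs.2 hq) h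
      have h1 := (hasDerivAt_iff_tendsto_slope.1 (hder s hs.2)).mono_left
        (nhdsWithin_mono s (t := {s}ᶜ) (s := Ioi s) fun w hw => ne_of_gt hw)
      filter_upwards [h1.eventually (Iio_mem_nhds hneg), self_mem_nhdsWithin] with w hw hsw
      have hw : _root_.slope (fun w => M.fval (w, r)) s w < 0 := hw
      rw [slope_def_field, div_lt_iff₀ (sub_pos.2 hsw), h] at hw
      linarith
    · have h1 := (hder s hs.2).continuousAt.eventually (Iio_mem_nhds h)
      exact nhdsWithin_le_nhds (h1.mono fun w hw => le_of_lt hw)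
  obtain ⟨w, hw, hw1, hw2⟩ := (hev.and (Ioo_mem_nhdsGT hsv)).exists
  exact absurd (hgr ⟨⟨hs.1.trans hw1.le, hw2.le⟩, hw⟩) (not_le.2 hw1)

lemma IsImploding.fval_eq_one (him : M.IsImploding) {v r : ℝ} (hv : v < 0) (hr : 0 < r) :
    M.fval (v, r) = 1 := by
  simp [fval, (him.empty_past v r hv hr).2]

lemma mem_R₀_of_fval_pos {p : Event} (hp : p ∈ M.carrier) (hf : 0 < M.fval (vr p)) : p ∈ M.R₀ := by
  refine mem_R₀_iff_lapse.2 ⟨hp, ?_⟩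
  rw [lapse_eq]
  have := M.expβ_pos (vr p)
  positivity

/-- Every component of `ℛ₀` in an imploding spacetime contains the empty past region. -/
lemma IsImploding.past_subset_component (him : M.IsImploding) (hiso : M.AHiso = ∅) {p : Event}
    (hp : p ∈ M.R₀) :
    {p' : Event | advTime p' < 0 ∧ 0 < radius p'} ⊆ connectedComponentIn M.R₀ p := by
  have hNR : {p' : Event | advTime p' < 0 ∧ 0 < radius p'} ⊆ M.R₀ := fun p' hp' =>
    mem_R₀_of_fval_pos ((vr_mem_spheres hp'.2).1 (him.empty_past _ _ hp'.1 hp'.2).1)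
      (by rw [vr, him.fval_eq_one hp'.1 hp'.2]; exact one_pos)
  have hNc : IsPreconnected {p' : Event | advTime p' < 0 ∧ 0 < radius p'} := by
    have h1 : IsPreconnected (({0} : Set E3)ᶜ) :=
      (isConnected_compl_singleton_of_one_lt_rank (by
        rw [← Module.finrank_eq_rank, finrank_euclideanSpace_fin]; norm_num) 0).isPreconnected
    have h2 := (isPreconnected_Iio (a := (0 : ℝ))).prod h1
    have h3 := h2.image (fun a : ℝ × E3 => ((a.1 - ‖a.2‖, a.2) : Event)) (by fun_prop)
    convert h3 using 1
    ext p'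
    constructor
    · intro hp'
      exact ⟨(advTime p', p'.2), ⟨hp'.1, radius_pos.1 hp'.2⟩, by simp [advTime]⟩
    · rintro ⟨a, ⟨ha1, ha2⟩, rfl⟩
      exact ⟨by simpa [advTime] using ha1, radius_pos.2 ha2⟩
  -- The given event may lie on the axis; openness of the component supplies another one off the
  -- axis.
  obtain ⟨p₁, hp₁, hr⟩ : ∃ p₁ ∈ connectedComponentIn M.R₀ p, 0 < radius p₁ := by
    have hd : Dense ((univ : Set ℝ) ×ˢ ({0}ᶜ : Set E3)) :=
      dense_univ.prod (dense_compl_singleton 0)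
    obtain ⟨p₁, h1, h2⟩ := hd.inter_open_nonempty _ isOpen_R₀.connectedComponentIn
      ⟨p, mem_connectedComponentIn hp⟩
    exact ⟨p₁, h1, radius_pos.2 h2.2⟩
  have hp₁R := connectedComponentIn_subset _ _ hp₁
  rw [connectedComponentIn_eq hp₁]
  have hq := (vr_mem_spheres hr).2 hp₁R.1
  have hfq : 0 < M.fval (vr p₁) := by
    by_contra hcon
    exact hp₁R.2 (mem_Z_iff.2 ⟨hp₁R.1, hr, not_lt.1 hcon⟩)
  set ℓ : ℝ → Event := fun s => (s - radius p₁, p₁.2) with hℓ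
  have hvr : ∀ s, vr (ℓ s) = (s, radius p₁) := fun s => by simp [hℓ, vr, advTime, radius]
  have hL : ℓ '' Iic (advTime p₁) ⊆ connectedComponentIn M.R₀ p₁ := by
    refine (isPreconnected_Iic.image ℓ (by fun_prop)).subset_connectedComponentIn
      ⟨advTime p₁, self_mem_Iic, by simp [hℓ, advTime, radius]⟩ ?_
    rintro _ ⟨s, hs, rfl⟩
    refine mem_R₀_of_fval_pos ((vr_mem_spheres (p := ℓ s) hr).1 ?_) ?_
    · rw [hvr]
      exact him.extends_to_past _ _ _ hs hq
    · rw [hvr]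
      exact him.fval_pos_of_le hiso hq hfq hs
  set s := min (advTime p₁) (-1) with hs
  have hmem : ℓ s ∈ connectedComponentIn M.R₀ p₁ := hL ⟨s, mem_Iic.2 (min_le_left _ _), rfl⟩
  rw [connectedComponentIn_eq hmem]
  refine hNc.subset_connectedComponentIn ⟨?_, hr⟩ hNR
  have h1 : (vr (ℓ s)).1 = s := by rw [hvr]
  change (vr (ℓ s)).1 < 0
  rw [h1]
  have : s ≤ -1 := min_le_right _ _
  linarith

/-- Far out in the empty past there are no closed f-trapped surfaces. -/
lemma IsImploding.not_mem_trapped (him : M.IsImploding) {C : ℝ} (hC0 : 0 ≤ C)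
    (hC : ∀ v r : ℝ, (v, r) ∈ M.spheres → M.m v r ≤ C) {p : Event} (hv : advTime p = -1)
    (hr : 2 * C < radius p) : p ∉ M.trapped := by
  rintro ⟨S, hS, hpS⟩
  obtain ⟨R, T, G, hT, hR, hle, hG, p', hp'S, hp'Z, hp'R⟩ := exists_supporting_curve hS
  have hT1 := abs_lt.1 (hT p hpS)
  -- Where `r > 2C ≥ 2m` the slope of the supporting curve is nonnegative, so from `v = -1` on the
  -- curve cannot drop below the radius of `p`.
  have hstay : ∀ v ∈ Ico (-1) T, radius p ≤ R v := by
    intro v hv'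
    by_contra hcon
    have hcont : ContinuousOn R (Icc (-1) v) := fun w hw =>
      (hR w ⟨by linarith [hw.1], hw.2.trans_lt hv'.2⟩).continuousAt.continuousWithinAt
    have hcomp : IsCompact (Icc (-1) v ∩ R ⁻¹' Ici (radius p)) :=
      isCompact_Icc.of_isClosed_subset
        (hcont.preimage_isClosed_of_isClosed isClosed_Icc isClosed_Ici) inter_subset_left
    obtain ⟨s, ⟨hs, hs0⟩, hgr⟩ := hcomp.exists_isGreatest
      ⟨-1, ⟨le_rfl, hv'.1⟩, by have := hle p hpS; rwa [hv] at this⟩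
    have hs0 : radius p ≤ R s := hs0
    have hsv : s < v := lt_of_le_of_ne hs.2 fun h => hcon (h ▸ hs0)
    have hmemT : ∀ w ∈ Icc s v, w ∈ Ioo (-T) T := fun w hw =>
      ⟨by linarith [hw.1, hs.1], hw.2.trans_lt hv'.2⟩
    have hev : ∀ᶠ w in 𝓝[>] s, 2 * C < R w := nhdsWithin_le_nhds
      ((hR s (hmemT s ⟨le_rfl, hsv.le⟩)).continuousAt.eventually (lt_mem_nhds (hr.trans_le hs0)))
    obtain ⟨u, hu, hsub⟩ := mem_nhdsGT_iff_exists_Ioc_subset.1 (hev.and (Ioo_mem_nhdsGT hsv))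
    have hsu : s < u := hu
    have huv : u < v := (hsub ⟨hsu, le_rfl⟩).2.2
    have hmono : MonotoneOn R (Icc s u) := by
      refine monotoneOn_of_deriv_nonneg (convex_Icc s u) ?_ ?_ ?_
      · exact fun w hw => (hR w (hmemT w ⟨hw.1, hw.2.trans huv.le⟩)).continuousAt.continuousWithinAt
      · intro w hw
        rw [interior_Icc] at hw
        exact (hR w (hmemT w ⟨hw.1.le, hw.2.le.trans huv.le⟩)).differentiableAt.differentiableWithinAt
      · intro w hw
        rw [interior_Icc] at hw
        rw [(hR w (hmemT w ⟨hw.1.le, hw.2.le.trans huv.le⟩)).deriv]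
        have hRw : 2 * C < R w := (hsub ⟨hw.1, hw.2.le⟩).1
        have hRw0 : 0 < R w := by linarith
        refine hG (w, R w) hRw0 fun hq => ?_
        have h1 := hC w (R w) hq
        rw [fval, sub_nonneg, div_le_one hRw0]
        simp only
        linarith
    have h1 := hmono ⟨le_rfl, hsu.le⟩ ⟨hsu.le, le_rfl⟩ hsu.le
    exact absurd (hgr ⟨⟨hs.1.trans hsu.le, huv.le⟩, hs0.trans h1⟩) (not_le.2 hsu)
  obtain ⟨hc, hr0, hm⟩ := hp'Z
  -- The contact event has `r ≤ 2m`. For `v < -1` this contradicts `m = 0`; for `v ≥ -1` it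
  -- contradicts `r = R(v) > 2C`.
  rcases lt_or_ge (advTime p') (-1) with h | h
  · have := (him.empty_past (advTime p') (radius p') (by linarith) hr0).2
    rw [this] at hm
    linarith
  · have h1 := hstay _ ⟨h, (abs_lt.1 (hT p' hp'S)).2⟩
    have h2 := hC _ _ ((vr_mem_spheres hr0).2 hc)
    linarith

theorem IsImploding.leavesRoom (him : M.IsImploding) (hiso : M.AHiso = ∅) {T₁ : Set Event}
    (hT : M.IsTrappedComponent T₁) : M.LeavesRoom T₁ := by
  intro p hp hsub
  obtain ⟨C, hC⟩ := him.bounded_mass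
  obtain ⟨x, hx⟩ := exists_norm_eq E3 (c := 2 * |C| + 1) (by positivity)
  have hadv : advTime (-1 - ‖x‖, x) = -1 := by simp [advTime]
  have hrad : radius (-1 - ‖x‖, x) = 2 * |C| + 1 := hx
  refine him.not_mem_trapped (p := (-1 - ‖x‖, x)) (abs_nonneg C)
    (fun v r h => (hC v r h).trans (le_abs_self C)) hadv (by rw [hrad]; linarith)
    (hT.subset_trapped (hsub (him.past_subset_component hiso hp ⟨?_, ?_⟩)))
  · rw [hadv]; norm_num
  · rw [hrad]; positivity

end SphSpacetime

end TrappedCore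

theorem mainTheorem4 (M : TrappedCore.SphSpacetime) (hiso : M.AHiso = ∅) :
    -- the region `𝒵` lies in the trapped region, its boundary is `AH`, and every closed
    -- f-trapped surface meets it
    (M.Z ⊆ M.trapped ∧ M.bdry M.Z = M.AH ∧
      ∀ S, M.IsClosedFTrapped S → (S ∩ M.Z).Nonempty) ∧
    -- for each component `T₁` of the trapped region, `𝒵 ∩ T₁` is minimal among the
    -- (not necessarily connected) removable sets
    (∀ T₁, M.IsTrappedComponent T₁ → M.LeavesRoom T₁ →
      M.IsRemovable T₁ (M.Z ∩ T₁) ∧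
      (∀ Z' ⊆ M.Z ∩ T₁, M.IsRemovable T₁ Z' → Z' = M.Z ∩ T₁) ∧
      M.bdry (M.Z ∩ T₁) = M.AH ∩ T₁) ∧
    -- each connected component of `𝒵` is a core of the corresponding component of the
    -- trapped region, and its boundary is formed by components of `AH`
    (∀ Z₁ T₁, M.IsZComponent Z₁ → M.IsTrappedComponent T₁ → M.LeavesRoom T₁ →
      M.Z ∩ T₁ = Z₁ → M.IsCore T₁ Z₁ ∧ M.bdry Z₁ = M.AH ∩ Z₁) ∧
    -- in imploding spacetimes no component of the trapped region fills a component of `ℛ₀`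
    (M.IsImploding → ∀ T₁, M.IsTrappedComponent T₁ → M.LeavesRoom T₁) := by
  refine ⟨⟨TrappedCore.SphSpacetime.Z_subset_trapped hiso, TrappedCore.SphSpacetime.bdry_Z hiso,
    fun S hS => ?_⟩, fun T₁ hT hroom => ⟨hT.isRemovable hroom hiso,
    fun Z' hZ' hrem => hT.eq_of_isRemovable hiso hZ' hrem, hT.bdry_Z_inter hiso⟩,
    fun Z₁ T₁ hZ hT hroom h => hT.isCore hroom hiso hZ h,
    fun him T₁ hT => him.leavesRoom hiso hT⟩
  obtain ⟨-, -, -, -, -, -, -, p, hp, hZ, -⟩ :=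
    TrappedCore.SphSpacetime.exists_supporting_curve hS
  exact ⟨p, hp, hZ⟩
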